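/- Let $d\ge 1$, $\alpha\in(0,2)$ and $0<\kappa_0\le\kappa_1$. For a function $f$ on $\mathbb R^d$ put $\delta_f(x;z):=f(x+z)+f(x-z)-2f(x)$. For measurable $\kappa:\mathbb R^d\to\mathbb R$ with $\kappa(z)=\kappa(-z)$ and $\kappa_0\le\kappa(z)\le\kappa_1$ for all $z$, let $$\mathscr L^\kappa_\alpha f(x):=\mathrm{p.v.}\int_{\mathbb R^d}(f(x+z)-f(x))\,\kappa(z)|z|^{-d-\alpha}\,dz=\frac12\int_{\mathbb R^d}\delta_f(x;z)\,\kappa(z)|z|^{-d-\alpha}\,dz .$$ A heat kernel of $\mathscr L^\kappa_\alpha$ is a function $p(t,x)$, $t>0$, $x\in\mathbb R^d$, such that each $p(t,\cdot)$ is a probability density, $p\in C((0,\infty);C^\infty_b(\mathbb R^d))$ (that is, each $p(t,\cdot)$ is smooth and bounded together with each of its derivatives, and each space derivative depends continuously on $t$ in the supremum norm), $\partial_t p(t,x)=\mathscr L^\kappa_\alpha p(t,\cdot)(x)$ for all $t>0$ and $x$, and $\lim_{t\downarrow0}p(t,\cdot)=\delta_0$, i.e. $\int p(t,y)f(y)\,dy\to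 f(0)$ as $t\downarrow 0$ for every bounded continuous $f$. Write $\delta_p(t,x;z):=\delta_{p(t,\cdot)}(x;z)$ and $\varrho^0_0(t,x):=(t^{1/\alpha}+|x|)^{-d-\alpha}$. There is a constant $C>0$ depending only on $d,\alpha,\kappa_0,\kappa_1$ such that for every such $\kappa$ a heat kernel of $\mathscr L^\kappa_\alpha$ exists, and every heat kernel $p=p^\kappa_\alpha$ of $\mathscr L^\kappa_\alpha$ satisfies, for all $t\in(0,1]$ and $x,x'\in\mathbb R^d$, $$\int_{\mathbb R^d}|\delta_{p}(t,x;z)|\,|z|^{-d-\alpha}\,dz\le C\,\varrho^0_0(t,x),$$ $$\int_{\mathbb R^d}|\delta_{p}(t,x;z)-\delta_{p}(t,x';z)|\,|z|^{-d-\alpha}\,dz\le C\big((t^{-1/\alpha}|x-x'|)\wedge1\big)\big\{\varrho^0_0(t,x)+\varrho^0_0(t,x')\big\},$$ where both integrals converge. -/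

import Mathlib

open MeasureTheory Filter Topology
open scoped ContDiff BoundedContinuousFunction

noncomputable section

/-- The symmetric second difference `δ_f(x; z) = f (x + z) + f (x - z) - 2 f x`. -/
def secondDiff {d : ℕ} (f : EuclideanSpace ℝ (Fin d) → ℝ) (x z : EuclideanSpace ℝ (Fin d)) : ℝ :=
  f (x + z) + f (x - z) - 2 * f x

/-- The spatially homogeneous symmetric stable-like operator
`L f (x) = (1/2) ∫ δ_f(x; z) κ(z) |z|^(-d-α) dz`.
For an even bounded `κ` and `f` in `C²_b` the integral converges absolutely, and it equals
`p.v. ∫ (f (x + z) - f x) κ(z) |z|^(-d-α) dz`. -/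
def stableLikeOp {d : ℕ} (α : ℝ) (κ : EuclideanSpace ℝ (Fin d) → ℝ)
    (f : EuclideanSpace ℝ (Fin d) → ℝ) (x : EuclideanSpace ℝ (Fin d)) : ℝ :=
  (1 / 2) * ∫ z, secondDiff f x z * κ z * ‖z‖ ^ (-(d : ℝ) - α)

/-- `p` (only its values at times `t > 0` matter) is the heat kernel of `stableLikeOp α κ`:
a probability density `p t` for every `t > 0`, continuous in `t ∈ (0, ∞)` with values in `C^∞_b`,
which solves `∂_t p = L p` and tends to the Dirac mass at `0` as `t ↓ 0`. -/
structure IsHeatKernel {d : ℕ} (α : ℝ) (κ : EuclideanSpace ℝ (Fin d) → ℝ)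
    (p : ℝ → EuclideanSpace ℝ (Fin d) → ℝ) : Prop where
  nonneg : ∀ t, 0 < t → ∀ x, 0 ≤ p t x
  integrable : ∀ t, 0 < t → Integrable (p t)
  integral_eq_one : ∀ t, 0 < t → ∫ x, p t x = 1
  contDiff : ∀ t, 0 < t → ContDiff ℝ ∞ (p t)
  bounded_deriv : ∀ t, 0 < t → ∀ k : ℕ, ∃ M : ℝ, ∀ x, ‖iteratedFDeriv ℝ k (p t) x‖ ≤ M
  continuous_time : ∀ t, 0 < t → ∀ k : ℕ,
    TendstoUniformly (fun s => iteratedFDeriv ℝ k (p s)) (iteratedFDeriv ℝ k (p t)) (𝓝 t)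
  heat_equation : ∀ t, 0 < t → ∀ x, HasDerivAt (fun s => p s x) (stableLikeOp α κ (p t) x) t
  initial : ∀ f : EuclideanSpace ℝ (Fin d) →ᵇ ℝ,
    Tendsto (fun t => ∫ y, p t y * f y) (𝓝[>] 0) (𝓝 (f 0))

/-- `ϱ^β_γ(t, x) = t^(γ/α) (|x|^β ∧ 1) (t^(1/α) + |x|)^(-d-α)`. -/
def varrho {d : ℕ} (α β γ t : ℝ) (x : EuclideanSpace ℝ (Fin d)) : ℝ :=
  t ^ (γ / α) * min (‖x‖ ^ β) 1 * (t ^ (1 / α) + ‖x‖) ^ (-(d : ℝ) - α)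

end

/-!
The operator is a Fourier multiplier with symbol `-ψ`, where
`ψ w = ∫ (1 - cos (2π⟨w, z⟩)) k z` and `k z = κ z |z|^(-d-α)`, so the heat kernel has to be
`stableKernel k t`, the inverse Fourier transform of `exp (-tψ)`. As `κ₀ ≤ κ`, the symbol is at
least a multiple of `|w|^α` away from the unit ball (`le_symbol`), and `exp (-tψ)` is integrable
against all powers of `|w|`.

**The estimates.** The class of densities `k` with `κ₀ |z|^(-d-α) ≤ k z ≤ κ₁ |z|^(-d-α)` is
invariant under `k ↦ s^(d+α) k (s ·)`, which reduces everything to `t = 1` with constants uniform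
in the class (`exists_secondDiff_stableKernel_le`). There `ϱ⁰₀(1, x) = (1 + |x|)^(-d-α)` is the
function `decay`. Split `k` into the jumps inside and outside the unit ball. For the small jumps
the symbol is differentiable. A finite difference in `x` with step `h` multiplies the Fourier
transform of the kernel by `e^{2πi⟨w, h⟩} - 1`, of size `|w| |h|`, so iterated differences are
bounded by the product of the lengths of the steps. Integration by parts in `w` gains a power of
`|x|` at the price of a derivative of `ψ`, and multiplication by that derivative is an average of
first differences with respect to `z k(z) dz`. So one power of decay costs one more difference, and
by induction iterated differences of the small-jump part decay faster than any power
(`exists_pow_mul_norm_invFT_le`); only one derivative of `ψ` is ever needed. The large jumps are a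
finite measure with density bounded by a multiple of `decay`, so their semigroup is a compound
Poisson series; since `decay ∗ decay ≤ C decay` (`integral_decay_mul_decay_le`), convolution with it
preserves bounds by multiples of `decay` (`norm_invFT_exp_neg_symbol_le`). The differences `δ_p(1, x; z)` and `δ_p(1, x; z) - δ_p(1, x'; z)`
are iterated differences of this kind, and they are integrated against `|z|^(-d-α)` separately over
`|z| ≤ 1`, where `|z|²` compensates the singularity, and over `|z| > 1`, again by the convolution
inequality.

**Existence.** `stableKernel k t` is smooth, solves the equation, and has mass one and the right
initial value by direct Fourier analysis. It is nonnegative as the limit of the inverse transforms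
of `exp (-tψₙ)`, regularized by Gaussians, where `ψₙ` is the symbol of the jumps longer than
`1 / (n + 1)`: for a finite jump measure the exponential series has nonnegative terms.

**Uniqueness.** Let `p` be any heat kernel. Plane waves are eigenfunctions of the operator with
eigenvalue `-ψ w`. Approximating them by integrable functions and using the symmetry of the
operator, `t ↦ exp (tψ w) ∫ p t x cos (2π⟨w, x⟩ + θ) dx` is constant
(`IsStableDensity.integral_mul_cosWave`). So `p t` has the Fourier transform `exp (-tψ)`, and
Fourier inversion gives `p t = stableKernel k t` (`IsStableDensity.eq_stableKernel`).
-/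

noncomputable section

local notation:max "𝓔" n:max => EuclideanSpace ℝ (Fin n)

namespace StableKernel

variable {d : ℕ}

/-! ### Power weights -/

/-- The density `|z|^(-d-α)` of the isotropic stable Lévy measure. -/
def jumpWeight (α : ℝ) (z : 𝓔 d) : ℝ := ‖z‖ ^ (-(d : ℝ) - α)

/-- The weight `(1 + |x|)^(-d-α)`, that is `ϱ^0_0(1, x)`. -/
def decay (α : ℝ) (x : 𝓔 d) : ℝ := (1 + ‖x‖) ^ (-(d : ℝ) - α)

theorem jumpWeight_nonneg (α : ℝ) (z : 𝓔 d) : 0 ≤ jumpWeight α z :=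
  Real.rpow_nonneg (norm_nonneg _) _

theorem measurable_jumpWeight (α : ℝ) : Measurable (jumpWeight α : 𝓔 d → ℝ) := by
  unfold jumpWeight; fun_prop

theorem jumpWeight_neg (α : ℝ) (z : 𝓔 d) : jumpWeight α (-z) = jumpWeight α z := by
  simp [jumpWeight]

theorem decay_pos (α : ℝ) (x : 𝓔 d) : 0 < decay α x := by
  unfold decay; positivity

theorem decay_neg (α : ℝ) (x : 𝓔 d) : decay α (-x) = decay α x := by
  simp [decay]

theorem continuous_decay (α : ℝ) : Continuous (decay α : 𝓔 d → ℝ) := by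
  unfold decay
  refine Continuous.rpow_const (by fun_prop) fun x => Or.inl ?_
  positivity

theorem neg_sub_eq (α : ℝ) : -(d : ℝ) - α = -(d + α) := by ring

theorem integrable_decay {α : ℝ} (hα : 0 < α) : Integrable (decay α : 𝓔 d → ℝ) := by
  have h := integrable_one_add_norm (E := 𝓔 d) (μ := volume) (r := d + α) (by simpa using hα)
  rwa [← neg_sub_eq] at h

theorem rpow_neg_le_of_le_two_mul {a b s : ℝ} (ha : 0 < a) (hs : 0 ≤ s) (hab : a ≤ 2 * b) :
    b ^ (-s) ≤ 2 ^ s * a ^ (-s) := by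
  have hb : 0 < b := by linarith
  rw [Real.rpow_neg hb.le, Real.rpow_neg ha.le, ← div_eq_mul_inv, ← one_div,
    div_le_div_iff₀ (by positivity) (by positivity), one_mul, ← Real.mul_rpow (by norm_num) hb.le]
  exact Real.rpow_le_rpow ha.le hab hs

theorem decay_add_le {α : ℝ} (hα : 0 < α) (x : 𝓔 d) {z : 𝓔 d} (hz : ‖z‖ ≤ 1) :
    decay α (x + z) ≤ 2 ^ (d + α) * decay α x := by
  unfold decay
  rw [neg_sub_eq]
  refine rpow_neg_le_of_le_two_mul (by positivity) (by positivity) ?_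
  have : ‖x‖ ≤ ‖x + z‖ + ‖z‖ := by simpa using norm_sub_le (x + z) z
  nlinarith [norm_nonneg (x + z)]

theorem jumpWeight_le_decay {α : ℝ} (hα : 0 < α) {z : 𝓔 d} (hz : 1 ≤ ‖z‖) :
    jumpWeight α z ≤ 2 ^ (d + α) * decay α z := by
  unfold decay jumpWeight
  rw [neg_sub_eq]
  exact rpow_neg_le_of_le_two_mul (by positivity) (by positivity) (by linarith)

theorem decay_mul_decay_le {α : ℝ} (hα : 0 < α) (x z : 𝓔 d) :
    decay α (x + z) * decay α z ≤ 2 ^ (d + α) * decay α x * (decay α (x + z) + decay α z) := by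
  have hx := decay_pos α x
  have hz := decay_pos α z
  have hxz := decay_pos α (x + z)
  have h2 : (0 : ℝ) < 2 ^ (d + α) := by positivity
  have key : ‖x‖ ≤ ‖x + z‖ + ‖z‖ := by simpa using norm_sub_le (x + z) z
  rcases le_total ‖x + z‖ ‖z‖ with h | h
  · have : decay α z ≤ 2 ^ (d + α) * decay α x := by
      unfold decay
      rw [neg_sub_eq]
      exact rpow_neg_le_of_le_two_mul (by positivity) (by positivity) (by linarith)
    calc _ ≤ decay α (x + z) * (2 ^ (d + α) * decay α x) := by gcongr
      _ ≤ _ := by nlinarith [mul_pos (mul_pos h2 hx) hz]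
  · have : decay α (x + z) ≤ 2 ^ (d + α) * decay α x := by
      unfold decay
      rw [neg_sub_eq]
      exact rpow_neg_le_of_le_two_mul (by positivity) (by positivity) (by linarith)
    calc _ ≤ (2 ^ (d + α) * decay α x) * decay α z := by gcongr
      _ ≤ _ := by nlinarith [mul_pos (mul_pos h2 hx) hxz]

/-- The constant in `∫ ϱ(x + z) ϱ(z) dz ≤ C ϱ(x)` for `ϱ = decay α`. -/
def convConst (d : ℕ) (α : ℝ) : ℝ :=
  2 ^ (d + α) * (2 * ∫ z : EuclideanSpace ℝ (Fin d), decay α z)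

theorem convConst_nonneg (α : ℝ) : 0 ≤ convConst d α := by
  unfold convConst
  have : 0 ≤ ∫ z : 𝓔 d, decay α z := integral_nonneg fun z => (decay_pos α z).le
  positivity

theorem integrable_decay_mul_decay {α : ℝ} (hα : 0 < α) (x : 𝓔 d) :
    Integrable fun z : 𝓔 d => decay α (x + z) * decay α z := by
  refine Integrable.mono' (((integrable_decay hα).comp_add_left x |>.add (integrable_decay hα)).const_mul
    (2 ^ (d + α) * decay α x)) ?_ (ae_of_all _ fun z => ?_)
  · have := continuous_decay (d := d) α
    exact Continuous.aestronglyMeasurable (by fun_prop)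
  · rw [Real.norm_of_nonneg (by have := decay_pos α z; have := decay_pos α (x+z); positivity)]
    exact decay_mul_decay_le hα x z

theorem integral_decay_mul_decay_le {α : ℝ} (hα : 0 < α) (x : 𝓔 d) :
    ∫ z : 𝓔 d, decay α (x + z) * decay α z ≤ convConst d α * decay α x := by
  calc _ ≤ ∫ z : 𝓔 d, 2 ^ (d + α) * decay α x * (decay α (x + z) + decay α z) :=
        integral_mono (integrable_decay_mul_decay hα x)
          (((integrable_decay hα).comp_add_left x |>.add (integrable_decay hα)).const_mul _)
          fun z => decay_mul_decay_le hα x z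
    _ = _ := by
        rw [integral_const_mul, integral_add ((integrable_decay hα).comp_add_left x)
          (integrable_decay hα), integral_add_left_eq_self (fun z => decay α z) x]
        unfold convConst; ring

theorem integrable_min_sq_mul_jumpWeight {α : ℝ} (hα0 : 0 < α) (hα2 : α < 2) :
    Integrable fun z : 𝓔 d => min 1 (‖z‖ ^ 2) * jumpWeight α z := by
  rcases Nat.eq_zero_or_pos d with rfl | hd
  · have : (fun z : EuclideanSpace ℝ (Fin 0) => min 1 (‖z‖ ^ 2) * jumpWeight α z) = 0 := by
      ext z; simp [Subsingleton.elim z 0]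
    rw [this]; exact integrable_zero _ _ _
  have : Nonempty (Fin d) := ⟨⟨0, hd⟩⟩
  have hmeas : Measurable fun z : 𝓔 d => min 1 (‖z‖ ^ 2) * jumpWeight α z :=
    (by fun_prop : Measurable fun z : 𝓔 d => min 1 (‖z‖ ^ 2)).mul (measurable_jumpWeight α)
  have h1 : IntegrableOn (fun z : 𝓔 d => min 1 (‖z‖ ^ 2) * jumpWeight α z) (Metric.ball 0 1) := by
    have h := (integrableOn_fun_norm_addHaar (E := 𝓔 d) (volume : Measure 𝓔 d)
      (f := fun y : ℝ => y ^ (2 - d - α)) (r := 1)).2 ?_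
    · refine Integrable.mono' h hmeas.aestronglyMeasurable
        (ae_restrict_of_forall_mem measurableSet_ball fun z hz => ?_)
      have hz1 : ‖z‖ < 1 := by simpa using hz
      rw [Real.norm_of_nonneg (by have := jumpWeight_nonneg α z; positivity)]
      rcases eq_or_ne z 0 with rfl | h0
      · simp; exact Real.rpow_nonneg le_rfl _
      have hz0 : 0 < ‖z‖ := norm_pos_iff.2 h0
      calc _ ≤ ‖z‖ ^ 2 * jumpWeight α z := by
            gcongr
            · exact jumpWeight_nonneg α z
            · exact min_le_right _ _
        _ = _ := by
            unfold jumpWeight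
            rw [← Real.rpow_natCast, ← Real.rpow_add hz0]; congr 1; push_cast; ring
    · have : IntegrableOn (fun y : ℝ => y ^ (1 - α)) (Set.Ioo 0 1) :=
        (intervalIntegral.integrableOn_Ioo_rpow_iff one_pos).2 (by linarith)
      refine this.congr_fun (fun y hy => ?_) measurableSet_Ioo
      have hy0 : 0 < y := hy.1
      simp only [finrank_euclideanSpace, Fintype.card_fin, smul_eq_mul]
      rw [← Real.rpow_natCast, ← Real.rpow_add hy0, Nat.cast_sub hd]
      congr 1; push_cast; ring
  have h2 : IntegrableOn (fun z : 𝓔 d => min 1 (‖z‖ ^ 2) * jumpWeight α z) (Metric.ball 0 1)ᶜ := by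
    refine Integrable.mono' ((integrable_decay hα0).const_mul (2 ^ (d + α))).integrableOn
      hmeas.aestronglyMeasurable
      (ae_restrict_of_forall_mem measurableSet_ball.compl fun z hz => ?_)
    have hz1 : 1 ≤ ‖z‖ := by simpa using hz
    rw [Real.norm_of_nonneg (by have := jumpWeight_nonneg α z; positivity)]
    calc _ ≤ 1 * jumpWeight α z := by
          gcongr
          · exact jumpWeight_nonneg α z
          · exact min_le_left _ _
      _ ≤ _ := by rw [one_mul]; exact jumpWeight_le_decay hα0 hz1
  rw [← integrableOn_univ, ← Set.union_compl_self (Metric.ball (0:𝓔 d) 1)]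
  exact h1.union h2

/-! ### Lévy symbols -/

/-- A symmetric jump density dominated by `Λ |z|^(-d-α)`. -/
structure IsJumpDensity (α Λ : ℝ) (k : 𝓔 d → ℝ) : Prop where
  measurable : Measurable k
  even : ∀ z, k (-z) = k z
  nonneg : ∀ z, 0 ≤ k z
  le : ∀ z, k z ≤ Λ * jumpWeight α z

/-- The Lévy symbol `∫ (1 - cos (2π⟨w, z⟩)) k(z) dz`, in the normalization of `𝓕`. -/
def symbol (k : 𝓔 d → ℝ) (w : 𝓔 d) : ℝ :=
  ∫ z, (1 - Real.cos (2 * Real.pi * inner ℝ w z)) * k z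

/-- The total mass `∫ (1 ∧ |z|²) |z|^(-d-α) dz`. -/
def levyMass (d : ℕ) (α : ℝ) : ℝ :=
  ∫ z : EuclideanSpace ℝ (Fin d), min 1 (‖z‖ ^ 2) * jumpWeight α z

theorem levyMass_nonneg (α : ℝ) : 0 ≤ levyMass d α :=
  integral_nonneg fun z => by have := jumpWeight_nonneg α z; positivity

theorem abs_two_pi_inner_le (w z : 𝓔 d) :
    |2 * Real.pi * inner ℝ w z| ≤ 2 * Real.pi * (‖w‖ * ‖z‖) := by
  rw [abs_mul, abs_of_pos Real.two_pi_pos]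
  gcongr
  exact abs_real_inner_le_norm w z

theorem one_sub_cos_le (w z : 𝓔 d) : 1 - Real.cos (2 * Real.pi * inner ℝ w z) ≤
    (2 + 2 * Real.pi ^ 2 * ‖w‖ ^ 2) * min 1 (‖z‖ ^ 2) := by
  have h1 := Real.neg_one_le_cos (2 * Real.pi * inner ℝ w z)
  have h2 := Real.one_sub_sq_div_two_le_cos (x := 2 * Real.pi * inner ℝ w z)
  have h3 : (2 * Real.pi * inner ℝ w z) ^ 2 ≤ (2 * Real.pi * (‖w‖ * ‖z‖)) ^ 2 :=
    sq_le_sq' (abs_le.1 (abs_two_pi_inner_le w z)).1 (abs_le.1 (abs_two_pi_inner_le w z)).2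
  have hw : 0 ≤ Real.pi ^ 2 * ‖w‖ ^ 2 := by positivity
  rcases le_total 1 (‖z‖ ^ 2) with h | h
  · rw [min_eq_left h]; nlinarith
  · rw [min_eq_right h]; nlinarith [sq_nonneg ‖z‖]

theorem one_sub_cos_nonneg (t : ℝ) : 0 ≤ 1 - Real.cos t := by
  linarith [Real.cos_le_one t]

namespace IsJumpDensity
variable {α Λ : ℝ} {k : 𝓔 d → ℝ}

theorem min_mul_le (hk : IsJumpDensity α Λ k) (z : 𝓔 d) :
    min 1 (‖z‖ ^ 2) * k z ≤ Λ * (min 1 (‖z‖ ^ 2) * jumpWeight α z) := by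
  calc _ ≤ min 1 (‖z‖ ^ 2) * (Λ * jumpWeight α z) := by gcongr; exact hk.le z
    _ = _ := by ring

theorem integrable_min_mul (hk : IsJumpDensity α Λ k) (hα0 : 0 < α) (hα2 : α < 2) :
    Integrable fun z => min 1 (‖z‖ ^ 2) * k z := by
  refine ((integrable_min_sq_mul_jumpWeight hα0 hα2).const_mul Λ).mono'
    ((by fun_prop : Measurable fun z : 𝓔 d => min 1 (‖z‖ ^ 2)).mul hk.measurable).aestronglyMeasurable
    (ae_of_all _ fun z => ?_)
  rw [Real.norm_of_nonneg (by have := hk.nonneg z; positivity)]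
  exact hk.min_mul_le z

theorem integral_min_mul_le (hk : IsJumpDensity α Λ k) (hα0 : 0 < α) (hα2 : α < 2) :
    ∫ z, min 1 (‖z‖ ^ 2) * k z ≤ Λ * levyMass d α := by
  rw [levyMass, ← integral_const_mul]
  exact integral_mono (hk.integrable_min_mul hα0 hα2)
    ((integrable_min_sq_mul_jumpWeight hα0 hα2).const_mul Λ) hk.min_mul_le

theorem integrand_le (hk : IsJumpDensity α Λ k) (w z : 𝓔 d) :
    (1 - Real.cos (2 * Real.pi * inner ℝ w z)) * k z ≤
      (2 + 2 * Real.pi ^ 2 * ‖w‖ ^ 2) * (min 1 (‖z‖ ^ 2) * k z) := by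
  rw [← mul_assoc]
  exact mul_le_mul_of_nonneg_right (one_sub_cos_le w z) (hk.nonneg z)

theorem integrand_nonneg (hk : IsJumpDensity α Λ k) (w z : 𝓔 d) :
    0 ≤ (1 - Real.cos (2 * Real.pi * inner ℝ w z)) * k z :=
  mul_nonneg (one_sub_cos_nonneg _) (hk.nonneg z)

theorem measurable_integrand (hk : IsJumpDensity α Λ k) (w : 𝓔 d) :
    Measurable fun z => (1 - Real.cos (2 * Real.pi * inner ℝ w z)) * k z :=
  (by fun_prop : Measurable fun z : 𝓔 d => 1 - Real.cos (2 * Real.pi * inner ℝ w z)).mul hk.measurable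

theorem integrable_integrand (hk : IsJumpDensity α Λ k) (hα0 : 0 < α) (hα2 : α < 2) (w : 𝓔 d) :
    Integrable fun z => (1 - Real.cos (2 * Real.pi * inner ℝ w z)) * k z := by
  refine ((hk.integrable_min_mul hα0 hα2).const_mul (2 + 2 * Real.pi ^ 2 * ‖w‖ ^ 2)).mono'
    (hk.measurable_integrand w).aestronglyMeasurable (ae_of_all _ fun z => ?_)
  rw [Real.norm_of_nonneg (hk.integrand_nonneg w z)]
  exact hk.integrand_le w z

theorem symbol_nonneg (hk : IsJumpDensity α Λ k) (w : 𝓔 d) : 0 ≤ symbol k w :=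
  integral_nonneg (hk.integrand_nonneg w)

theorem symbol_le (hk : IsJumpDensity α Λ k) (hα0 : 0 < α) (hα2 : α < 2) (w : 𝓔 d) :
    symbol k w ≤ (2 + 2 * Real.pi ^ 2 * ‖w‖ ^ 2) * (Λ * levyMass d α) := by
  calc symbol k w ≤ ∫ z, (2 + 2 * Real.pi ^ 2 * ‖w‖ ^ 2) * (min 1 (‖z‖ ^ 2) * k z) :=
        integral_mono (hk.integrable_integrand hα0 hα2 w)
          ((hk.integrable_min_mul hα0 hα2).const_mul _) (hk.integrand_le w)
    _ ≤ _ := by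
        rw [integral_const_mul]
        gcongr
        exact hk.integral_min_mul_le hα0 hα2

theorem continuous_symbol (hk : IsJumpDensity α Λ k) (hα0 : 0 < α) (hα2 : α < 2) :
    Continuous (symbol k) := by
  refine continuous_iff_continuousAt.2 fun w₀ => ?_
  refine continuousAt_of_dominated
    (bound := fun z => (2 + 2 * Real.pi ^ 2 * (‖w₀‖ + 1) ^ 2) * (min 1 (‖z‖ ^ 2) * k z))
    (Eventually.of_forall fun w => (hk.measurable_integrand w).aestronglyMeasurable) ?_
    ((hk.integrable_min_mul hα0 hα2).const_mul _) (ae_of_all _ fun z => ?_)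
  · filter_upwards [Metric.ball_mem_nhds w₀ one_pos] with w hw
    refine ae_of_all _ fun z => ?_
    rw [Real.norm_of_nonneg (hk.integrand_nonneg w z)]
    refine (hk.integrand_le w z).trans ?_
    have hw' : ‖w‖ ≤ ‖w₀‖ + 1 := by
      have := norm_sub_norm_le w w₀
      rw [Metric.mem_ball, dist_eq_norm] at hw; linarith
    have := hk.nonneg z
    gcongr
  · exact Continuous.continuousAt (by fun_prop)

/-- If the jump density is at least `κ₀ |z|^(-d-α)` on the unit ball, its symbol is of order
at least `|w|^α`. -/
theorem le_symbol (hk : IsJumpDensity α Λ k) (hα0 : 0 < α) (hα2 : α < 2) {κ₀ : ℝ} (hκ₀ : 0 ≤ κ₀)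
    (hlow : ∀ z, ‖z‖ ≤ 1 → κ₀ * jumpWeight α z ≤ k z) {w : 𝓔 d} (hw : 1 ≤ ‖w‖) :
    κ₀ * volume.real (Metric.ball (0 : 𝓔 d) (1 / 4)) * ‖w‖ ^ α ≤ symbol k w := by
  have hw0 : 0 < ‖w‖ := by linarith
  -- on this ball `⟨w, z⟩` lies between `1/4` and `3/4`, so that the cosine is nonpositive
  set B : Set 𝓔 d := Metric.ball ((1 / (2 * ‖w‖ ^ 2)) • w) (1 / ‖w‖ * (1 / 4)) with hB
  have hvol : volume.real B = (1 / ‖w‖) ^ d * volume.real (Metric.ball (0 : 𝓔 d) (1 / 4)) := by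
    rw [hB, measureReal_def, Measure.addHaar_ball_mul_of_pos _ _ (by positivity),
      ENNReal.toReal_mul, ENNReal.toReal_ofReal (by positivity), measureReal_def]
    simp
  have hin : ∀ z ∈ B, κ₀ * ‖w‖ ^ (d + α) ≤ (1 - Real.cos (2 * Real.pi * inner ℝ w z)) * k z := by
    intro z hz
    rw [hB, Metric.mem_ball, dist_eq_norm] at hz
    set y := z - (1 / (2 * ‖w‖ ^ 2)) • w with hy
    have hzy : z = (1 / (2 * ‖w‖ ^ 2)) • w + y := by rw [hy]; abel
    have hwy : |inner ℝ w y| ≤ 1 / 4 := by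
      refine (abs_real_inner_le_norm w y).trans ?_
      calc ‖w‖ * ‖y‖ ≤ ‖w‖ * (1 / ‖w‖ * (1 / 4)) := by gcongr
        _ = 1 / 4 := by field_simp
    have hwz : inner ℝ w z = 1 / 2 + inner ℝ w y := by
      rw [hzy, inner_add_right, inner_smul_right, real_inner_self_eq_norm_sq]
      field_simp
    have hy2 := abs_le.1 hwy
    have hcos : Real.cos (2 * Real.pi * inner ℝ w z) ≤ 0 := by
      apply Real.cos_nonpos_of_pi_div_two_le_of_le <;> rw [hwz] <;> nlinarith [Real.pi_pos]
    have hz0 : 0 < ‖z‖ := by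
      rw [norm_pos_iff]; rintro rfl
      rw [inner_zero_right] at hwz; linarith
    have hzle : ‖z‖ ≤ ‖w‖⁻¹ := by
      rw [hzy]
      refine (norm_add_le _ _).trans ?_
      rw [norm_smul, Real.norm_of_nonneg (by positivity)]
      calc 1 / (2 * ‖w‖ ^ 2) * ‖w‖ + ‖y‖ ≤ 1 / (2 * ‖w‖ ^ 2) * ‖w‖ + 1 / ‖w‖ * (1 / 4) := by gcongr
        _ = 3 / 4 * ‖w‖⁻¹ := by field_simp; norm_num
        _ ≤ _ := by have := inv_pos.2 hw0; linarith
    have hz1 : ‖z‖ ≤ 1 := hzle.trans (inv_le_one_of_one_le₀ hw)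
    have hJ : ‖w‖ ^ (d + α) ≤ jumpWeight α z := by
      unfold jumpWeight
      rw [neg_sub_eq]
      calc ‖w‖ ^ (d + α) = (‖w‖⁻¹) ^ (-(d + α)) := by
            rw [Real.rpow_neg (by positivity), Real.inv_rpow (by positivity), inv_inv]
        _ ≤ _ := Real.rpow_le_rpow_of_nonpos hz0 hzle (by have : (0:ℝ) ≤ d := by positivity
                                                          linarith)
    calc κ₀ * ‖w‖ ^ (d + α) ≤ κ₀ * jumpWeight α z := by gcongr
      _ ≤ 1 * k z := by rw [one_mul]; exact hlow z hz1
      _ ≤ _ := by have := hk.nonneg z; gcongr; linarith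
  have hBfin : volume B ≠ ⊤ := by rw [hB]; exact measure_ball_lt_top.ne
  calc κ₀ * volume.real (Metric.ball (0 : 𝓔 d) (1 / 4)) * ‖w‖ ^ α
      = ∫ _ in B, κ₀ * ‖w‖ ^ (d + α) := by
        rw [setIntegral_const, hvol, smul_eq_mul, Real.rpow_add hw0, Real.rpow_natCast, div_pow, one_pow]
        field_simp
    _ ≤ ∫ z in B, (1 - Real.cos (2 * Real.pi * inner ℝ w z)) * k z :=
        setIntegral_mono_on (integrableOn_const hBfin)
          (hk.integrable_integrand hα0 hα2 w).integrableOn measurableSet_ball hin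
    _ ≤ _ := setIntegral_le_integral (hk.integrable_integrand hα0 hα2 w)
        (ae_of_all _ (hk.integrand_nonneg w))

end IsJumpDensity

theorem symbol_neg (k : 𝓔 d → ℝ) (w : 𝓔 d) : symbol k (-w) = symbol k w := by
  simp [symbol, inner_neg_left]

/-! ### Integrability against stretched exponentials -/

theorem pow_mul_exp_neg_le {α : ℝ} (hα : 0 < α) {a : ℝ} (ha : 0 < a) (n : ℕ) :
    ∃ C, 0 ≤ C ∧ ∀ w : 𝓔 d, ‖w‖ ^ n * Real.exp (-(a * ‖w‖ ^ α)) ≤ C * decay 1 w := by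
  obtain ⟨M, hM⟩ := exists_nat_ge ((n + d + 1) / α)
  rw [div_le_iff₀ hα] at hM
  refine ⟨2 ^ ((d : ℝ) + 1) * (1 + M.factorial / a ^ M), by positivity, fun w => ?_⟩
  have hMa : 0 ≤ M.factorial / a ^ M := by positivity
  have hd : (0 : ℝ) < 2 ^ ((d : ℝ) + 1) := by positivity
  rcases le_total 1 ‖w‖ with h | h
  · have hw0 : 0 < ‖w‖ := by linarith
    have h1 : ‖w‖ ^ n * Real.exp (-(a * ‖w‖ ^ α)) ≤ M.factorial / a ^ M * jumpWeight 1 w := by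
      have h2 := Real.pow_div_factorial_le_exp (a * ‖w‖ ^ α) (by positivity) M
      have h3 : ‖w‖ ^ ((n : ℝ) + d + 1) ≤ (‖w‖ ^ α) ^ M := by
        rw [← Real.rpow_natCast (‖w‖ ^ α), ← Real.rpow_mul hw0.le]
        exact Real.rpow_le_rpow_of_exponent_le h (by linarith)
      have h4 : ‖w‖ ^ n = ‖w‖ ^ ((n : ℝ) + d + 1) * jumpWeight 1 w := by
        rw [jumpWeight, ← Real.rpow_add hw0, ← Real.rpow_natCast]; congr 1; ring
      have h5 : ‖w‖ ^ ((n : ℝ) + d + 1) * Real.exp (-(a * ‖w‖ ^ α)) ≤ M.factorial / a ^ M := by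
        rw [Real.exp_neg, ← div_eq_mul_inv, div_le_iff₀ (Real.exp_pos _)]
        calc _ ≤ (‖w‖ ^ α) ^ M := h3
          _ = M.factorial / a ^ M * ((a * ‖w‖ ^ α) ^ M / M.factorial) := by
              rw [mul_pow]; field_simp
          _ ≤ _ := by gcongr
      calc _ = ‖w‖ ^ ((n : ℝ) + d + 1) * Real.exp (-(a * ‖w‖ ^ α)) * jumpWeight 1 w := by
            rw [h4]; ring
        _ ≤ _ := by gcongr; exact jumpWeight_nonneg _ _
    have h6 := jumpWeight_le_decay one_pos h
    calc _ ≤ _ := h1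
      _ ≤ M.factorial / a ^ M * (2 ^ ((d : ℝ) + 1) * decay 1 w) := by gcongr
      _ ≤ _ := by nlinarith [mul_pos hd (decay_pos 1 w)]
  · have h1 : ‖w‖ ^ n * Real.exp (-(a * ‖w‖ ^ α)) ≤ 1 := by
      refine mul_le_one₀ (pow_le_one₀ (norm_nonneg _) h) (Real.exp_pos _).le ?_
      rw [Real.exp_le_one_iff]
      have := Real.rpow_nonneg (norm_nonneg w) α
      nlinarith
    have h2 : 1 ≤ 2 ^ ((d : ℝ) + 1) * decay 1 w := by
      have := decay_add_le one_pos w (z := -w) (by simpa using h)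
      simpa [decay] using this
    calc _ ≤ 1 := h1
      _ ≤ _ := h2
      _ ≤ _ := by nlinarith [mul_pos hd (decay_pos 1 w)]

theorem integrable_pow_mul_exp_neg {α : ℝ} (hα : 0 < α) {a : ℝ} (ha : 0 < a) (n : ℕ) :
    Integrable fun w : 𝓔 d => ‖w‖ ^ n * Real.exp (-(a * ‖w‖ ^ α)) := by
  obtain ⟨C, -, hC⟩ := pow_mul_exp_neg_le (d := d) hα ha n
  refine ((integrable_decay one_pos).const_mul C).mono' ?_ (ae_of_all _ fun w => ?_)
  · have : Measurable fun w : 𝓔 d => ‖w‖ ^ n * Real.exp (-(a * ‖w‖ ^ α)) := by fun_prop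
    exact this.aestronglyMeasurable
  · rw [Real.norm_of_nonneg (by positivity)]; exact hC w

/-- The symbol lower bound in the form `e^{-tψ(w)} ≤ e^{tc} e^{-tc|w|^α}`, valid for all `w`. -/
theorem exp_neg_symbol_le {α Λ κ₀ : ℝ} {k : 𝓔 d → ℝ} (hk : IsJumpDensity α Λ k) (hα0 : 0 < α)
    (hα2 : α < 2) (hκ₀ : 0 ≤ κ₀) (hlow : ∀ z, ‖z‖ ≤ 1 → κ₀ * jumpWeight α z ≤ k z) {t : ℝ}
    (ht : 0 ≤ t) (w : 𝓔 d) :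
    Real.exp (-(t * symbol k w)) ≤
      Real.exp (t * (κ₀ * volume.real (Metric.ball (0 : 𝓔 d) (1 / 4)))) *
        Real.exp (-(t * (κ₀ * volume.real (Metric.ball (0 : 𝓔 d) (1 / 4))) * ‖w‖ ^ α)) := by
  rw [← Real.exp_add, Real.exp_le_exp]
  have hc : 0 ≤ κ₀ * volume.real (Metric.ball (0 : 𝓔 d) (1 / 4)) := by positivity
  set c := κ₀ * volume.real (Metric.ball (0 : 𝓔 d) (1 / 4))
  rcases le_total 1 ‖w‖ with h | h
  · have := hk.le_symbol hα0 hα2 hκ₀ hlow h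
    nlinarith [mul_nonneg ht hc, mul_le_mul_of_nonneg_left this ht]
  · have h1 := hk.symbol_nonneg w
    have h2 : ‖w‖ ^ α ≤ 1 := Real.rpow_le_one (norm_nonneg _) h hα0.le
    nlinarith [mul_nonneg ht hc, mul_nonneg ht h1]

/-! ### Plane waves and the inverse Fourier integral -/

/-- The plane wave `e^{2πi⟨w, x⟩}`. -/
def wave (w x : 𝓔 d) : ℂ := Complex.exp ((2 * Real.pi * inner ℝ w x : ℝ) * Complex.I)

theorem norm_wave (w x : 𝓔 d) : ‖wave w x‖ = 1 := Complex.norm_exp_ofReal_mul_I _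

theorem wave_add (w x y : 𝓔 d) : wave w (x + y) = wave w x * wave w y := by
  rw [wave, wave, wave, ← Complex.exp_add, inner_add_right]
  congr 1; push_cast; ring

theorem wave_zero (w : 𝓔 d) : wave w 0 = 1 := by simp [wave]

theorem wave_re (w x : 𝓔 d) : (wave w x).re = Real.cos (2 * Real.pi * inner ℝ w x) :=
  Complex.exp_ofReal_mul_I_re _

theorem wave_im (w x : 𝓔 d) : (wave w x).im = Real.sin (2 * Real.pi * inner ℝ w x) :=
  Complex.exp_ofReal_mul_I_im _

theorem continuous_wave : Continuous fun p : 𝓔 d × 𝓔 d => wave p.1 p.2 := by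
  unfold wave; fun_prop

theorem continuous_wave_left (x : 𝓔 d) : Continuous fun w : 𝓔 d => wave w x := by
  unfold wave; fun_prop

theorem continuous_wave_right (w : 𝓔 d) : Continuous fun x : 𝓔 d => wave w x := by
  unfold wave; fun_prop

theorem norm_wave_sub_one_le (w h : 𝓔 d) : ‖wave w h - 1‖ ≤ 2 * Real.pi * (‖w‖ * ‖h‖) := by
  have := Real.norm_exp_I_mul_ofReal_sub_one_le (x := 2 * Real.pi * inner ℝ w h)
  rw [mul_comm] at this
  exact this.trans (abs_two_pi_inner_le w h)

theorem wave_add_wave_neg (w z : 𝓔 d) :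
    wave w z + wave w (-z) = 2 * Real.cos (2 * Real.pi * inner ℝ w z) := by
  rw [wave, wave, inner_neg_right, Complex.ofReal_cos, Complex.two_cos]
  congr 2; push_cast; ring

theorem wave_sub_wave_neg (w z : 𝓔 d) :
    wave w z - wave w (-z) = 2 * Real.sin (2 * Real.pi * inner ℝ w z) * Complex.I := by
  apply Complex.ext <;> simp [wave_re, wave_im, -Complex.ofReal_sin] ; ring

/-- The inverse Fourier integral `∫ e^{2πi⟨w, x⟩} m(w) dw`. -/
def invFT (m : 𝓔 d → ℂ) (x : 𝓔 d) : ℂ := ∫ w, wave w x * m w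

theorem invFT_eq_fourierInv (m : 𝓔 d → ℂ) : invFT m = FourierTransformInv.fourierInv m := by
  ext x
  rw [Real.fourierInv_eq', invFT]
  rfl

theorem integrable_wave_mul {m : 𝓔 d → ℂ} (hm : Integrable m) (x : 𝓔 d) :
    Integrable fun w => wave w x * m w :=
  hm.bdd_mul (c := 1) (continuous_wave_left x).aestronglyMeasurable
    (ae_of_all _ fun w => (norm_wave w x).le)

theorem norm_invFT_le (m : 𝓔 d → ℂ) (x : 𝓔 d) : ‖invFT m x‖ ≤ ∫ w, ‖m w‖ := by
  refine (norm_integral_le_integral_norm _).trans_eq ?_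
  simp [norm_wave]

theorem invFT_add_right (m : 𝓔 d → ℂ) (x h : 𝓔 d) :
    invFT m (x + h) = invFT (fun w => wave w h * m w) x := by
  simp only [invFT, wave_add, mul_assoc]

theorem invFT_sub {m₁ m₂ : 𝓔 d → ℂ} (h₁ : Integrable m₁) (h₂ : Integrable m₂) (x : 𝓔 d) :
    invFT (fun w => m₁ w - m₂ w) x = invFT m₁ x - invFT m₂ x := by
  simp only [invFT, mul_sub]
  exact integral_sub (integrable_wave_mul h₁ x) (integrable_wave_mul h₂ x)

theorem invFT_add_sub {m : 𝓔 d → ℂ} (hm : Integrable m) (x h : 𝓔 d) :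
    invFT m (x + h) - invFT m x = invFT (fun w => (wave w h - 1) * m w) x := by
  rw [invFT_add_right, ← invFT_sub (integrable_wave_mul hm h) hm]
  simp only [sub_mul, one_mul]

theorem continuous_invFT {m : 𝓔 d → ℂ} (hm : Integrable m) : Continuous (invFT m) := by
  refine continuous_of_dominated (bound := fun w => ‖m w‖)
    (fun x => (integrable_wave_mul hm x).aestronglyMeasurable) (fun x => ae_of_all _ fun w => ?_)
    hm.norm (ae_of_all _ fun w => ?_)
  · rw [norm_mul, norm_wave, one_mul]
  · exact (continuous_wave_right w).mul continuous_const

theorem integrable_wave_mul_prod {b : 𝓔 d → 𝓔 d → ℂ}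
    (hb : Integrable (Function.uncurry b) (volume.prod volume)) (x : 𝓔 d) :
    Integrable (Function.uncurry fun z w => wave w x * b z w) (volume.prod volume) := by
  refine hb.bdd_mul (c := 1) (f := fun p : 𝓔 d × 𝓔 d => wave p.2 x) ?_
    (ae_of_all _ fun p => (norm_wave p.2 x).le)
  exact ((continuous_wave_left x).comp continuous_snd).aestronglyMeasurable

/-- Fubini for superpositions of inverse Fourier integrals. -/
theorem integral_invFT {b : 𝓔 d → 𝓔 d → ℂ}
    (hb : Integrable (Function.uncurry b) (volume.prod volume)) (x : 𝓔 d) :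
    ∫ z, invFT (b z) x = invFT (fun w => ∫ z, b z w) x := by
  simp only [invFT]
  rw [integral_integral_swap (integrable_wave_mul_prod hb x)]
  simp only [integral_const_mul]

/-! ### Integrable jump densities -/

/-- The Fourier transform `∫ k(z) e^{2πi⟨w, z⟩} dz` of a jump density. -/
def jumpFT (k : 𝓔 d → ℝ) (w : 𝓔 d) : ℂ := ∫ z, (k z : ℂ) * wave w z

theorem norm_jumpFT_le {k : 𝓔 d → ℝ} (hk0 : ∀ z, 0 ≤ k z) (w : 𝓔 d) :
    ‖jumpFT k w‖ ≤ ∫ z, k z := by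
  refine (norm_integral_le_integral_norm _).trans_eq ?_
  congr 1; ext z
  rw [norm_mul, norm_wave, mul_one, Complex.norm_real, Real.norm_of_nonneg (hk0 z)]

theorem integrable_mul_wave {k : 𝓔 d → ℝ} (hk : Integrable k) (w : 𝓔 d) :
    Integrable fun z => (k z : ℂ) * wave w z :=
  (hk.ofReal (𝕜 := ℂ)).mul_bdd (c := 1) (continuous_wave_right w).aestronglyMeasurable
    (ae_of_all _ fun z => (norm_wave w z).le)

theorem continuous_jumpFT {k : 𝓔 d → ℝ} (hk : Integrable k) : Continuous (jumpFT k) := by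
  refine continuous_of_dominated (bound := fun z => ‖k z‖)
    (fun w => (integrable_mul_wave hk w).aestronglyMeasurable)
    (fun w => ae_of_all _ fun z => ?_) hk.norm (ae_of_all _ fun z => ?_)
  · rw [norm_mul, norm_wave, mul_one, Complex.norm_real]
  · exact continuous_const.mul (continuous_wave_left z)

theorem integrable_jumpFT_mul {k : 𝓔 d → ℝ} (hk : Integrable k) (hk0 : ∀ z, 0 ≤ k z)
    {m : 𝓔 d → ℂ} (hm : Integrable m) : Integrable fun w => jumpFT k w * m w :=
  hm.bdd_mul (c := ∫ z, k z) (continuous_jumpFT hk).aestronglyMeasurable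
    (ae_of_all _ fun w => norm_jumpFT_le hk0 w)

/-- Multiplying `m` by the Fourier transform of `k` averages `invFT m` over jumps. -/
theorem invFT_jumpFT_mul {k : 𝓔 d → ℝ} (hk : Integrable k) {m : 𝓔 d → ℂ} (hm : Integrable m)
    (x : 𝓔 d) : invFT (fun w => jumpFT k w * m w) x = ∫ z, (k z : ℂ) * invFT m (x + z) := by
  have hb : Integrable (Function.uncurry fun z w : 𝓔 d => (k z : ℂ) * wave w z * m w)
      (volume.prod volume) := by
    have h1 := (hk.ofReal (𝕜 := ℂ)).mul_prod hm
    refine (h1.bdd_mul (c := 1) (f := fun p : 𝓔 d × 𝓔 d => wave p.2 p.1)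
      (continuous_wave.comp continuous_swap).aestronglyMeasurable
      (ae_of_all _ fun p => (norm_wave p.2 p.1).le)).congr (ae_of_all _ fun p => ?_)
    simp only [Function.uncurry, Complex.coe_algebraMap]
    ring
  have h2 := integral_invFT hb x
  have h3 : (fun w => ∫ z, (k z : ℂ) * wave w z * m w) = fun w => jumpFT k w * m w := by
    ext w; rw [integral_mul_const, jumpFT]
  rw [← h3, ← h2]
  congr 1; ext z
  rw [invFT_add_right, invFT, invFT, ← integral_const_mul]
  congr 1; ext w; ring

theorem integrable_jumpFT_pow_mul {k : 𝓔 d → ℝ} (hk : Integrable k) (hk0 : ∀ z, 0 ≤ k z)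
    {m : 𝓔 d → ℂ} (hm : Integrable m) (n : ℕ) : Integrable fun w => jumpFT k w ^ n * m w := by
  induction n with
  | zero => simpa using hm
  | succ n ih => simpa only [pow_succ', mul_assoc] using integrable_jumpFT_mul hk hk0 ih

/-- The compound Poisson expansion: `e^{k̂}` acts on `m` as the exponential series of jumps. -/
theorem hasSum_invFT_exp_jumpFT {k : 𝓔 d → ℝ} (hk : Integrable k) (hk0 : ∀ z, 0 ≤ k z)
    {m : 𝓔 d → ℂ} (hm : Integrable m) (x : 𝓔 d) :
    HasSum (fun n : ℕ => invFT (fun w => jumpFT k w ^ n * m w) x / n.factorial)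
      (invFT (fun w => Complex.exp (jumpFT k w) * m w) x) := by
  have hint : ∀ n : ℕ, Integrable fun w => wave w x * (jumpFT k w ^ n * m w) / n.factorial :=
    fun n => (integrable_wave_mul (integrable_jumpFT_pow_mul hk hk0 hm n) x).div_const _
  have hbd : ∀ (n : ℕ) w, ‖wave w x * (jumpFT k w ^ n * m w) / n.factorial‖ ≤
      (∫ z, k z) ^ n / n.factorial * ‖m w‖ := by
    intro n w
    rw [norm_div, norm_mul, norm_wave, one_mul, norm_mul, norm_pow, Complex.norm_natCast,
      mul_div_right_comm]
    gcongr
    exact norm_jumpFT_le hk0 w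
  have hsum := hasSum_integral_of_summable_integral_norm hint ?_
  · have h1 : ∀ n : ℕ, ∫ w, wave w x * (jumpFT k w ^ n * m w) / n.factorial =
        invFT (fun w => jumpFT k w ^ n * m w) x / n.factorial :=
      fun n => by rw [integral_div, invFT]
    have h2 : ∫ w, ∑' n : ℕ, wave w x * (jumpFT k w ^ n * m w) / n.factorial =
        invFT (fun w => Complex.exp (jumpFT k w) * m w) x := by
      rw [invFT]
      congr 1; ext w
      rw [Complex.exp_eq_exp_ℂ, NormedSpace.exp_eq_tsum_div, ← tsum_mul_right, ← tsum_mul_left]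
      congr 1; ext n; ring
    simpa only [h1, h2] using hsum
  · refine Summable.of_nonneg_of_le (fun n => integral_nonneg fun w => norm_nonneg _)
      (fun n => integral_mono (hint n).norm (hm.norm.const_mul _) (hbd n)) ?_
    simp only [integral_const_mul]
    exact (Real.summable_pow_div_factorial _).mul_right _

theorem symbol_eq_sub_jumpFT {k : 𝓔 d → ℝ} (hk : Integrable k) (heven : ∀ z, k (-z) = k z)
    (w : 𝓔 d) : ((symbol k w : ℝ) : ℂ) = ((∫ z, k z : ℝ) : ℂ) - jumpFT k w := by
  have hre : (jumpFT k w).re = (∫ z, k z) - symbol k w := by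
    have h1 : (jumpFT k w).re = ∫ z, Real.cos (2 * Real.pi * inner ℝ w z) * k z := by
      rw [jumpFT, ← RCLike.re_eq_complex_re, ← integral_re (integrable_mul_wave hk w)]
      congr 1; ext z
      rw [RCLike.re_eq_complex_re, Complex.re_ofReal_mul, wave_re, mul_comm]
    have h2 : Integrable fun z => Real.cos (2 * Real.pi * inner ℝ w z) * k z :=
      hk.bdd_mul (c := 1) (Continuous.aestronglyMeasurable (by fun_prop))
        (ae_of_all _ fun z => Real.abs_cos_le_one _)
    have h3 : symbol k w = (∫ z, k z) - ∫ z, Real.cos (2 * Real.pi * inner ℝ w z) * k z := by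
      rw [symbol, ← integral_sub hk h2]
      congr 1; ext z; ring
    rw [h1, h3]; ring
  have him : (jumpFT k w).im = 0 := by
    have h1 : (jumpFT k w).im = ∫ z, Real.sin (2 * Real.pi * inner ℝ w z) * k z := by
      rw [jumpFT, ← RCLike.im_eq_complex_im, ← integral_im (integrable_mul_wave hk w)]
      congr 1; ext z
      rw [RCLike.im_eq_complex_im, Complex.im_ofReal_mul, wave_im, mul_comm]
    have h2 := integral_neg_eq_self (fun z => Real.sin (2 * Real.pi * inner ℝ w z) * k z) volume
    simp only [inner_neg_right, mul_neg, Real.sin_neg, heven, neg_mul, integral_neg] at h2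
    rw [h1]; linarith
  apply Complex.ext
  · simp [hre]
  · simp [him]

/-- Integrable jumps with a density of order `ϱ` preserve bounds by a multiple of `ϱ`. -/
theorem norm_invFT_exp_neg_symbol_le {α : ℝ} (hα : 0 < α) {k : 𝓔 d → ℝ} {Λ : ℝ} (hΛ : 0 ≤ Λ)
    (hkm : Measurable k) (hk0 : ∀ z, 0 ≤ k z) (heven : ∀ z, k (-z) = k z)
    (hle : ∀ z, k z ≤ Λ * decay α z) {m : 𝓔 d → ℂ} (hm : Integrable m) {M : ℝ} (hM : 0 ≤ M)
    (hmM : ∀ x, ‖invFT m x‖ ≤ M * decay α x) (x : 𝓔 d) :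
    ‖invFT (fun w => Real.exp (-symbol k w) * m w) x‖ ≤
      M * Real.exp (Λ * convConst d α) * decay α x := by
  have hk : Integrable k := by
    refine ((integrable_decay hα).const_mul Λ).mono' hkm.aestronglyMeasurable
      (ae_of_all _ fun z => ?_)
    rw [Real.norm_of_nonneg (hk0 z)]; exact hle z
  have hC := convConst_nonneg (d := d) α
  have hpow : ∀ (n : ℕ) x, ‖invFT (fun w => jumpFT k w ^ n * m w) x‖ ≤
      M * (Λ * convConst d α) ^ n * decay α x := by
    intro n
    induction n with
    | zero => intro x; simpa using hmM x
    | succ n ih =>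
      intro x
      have h1 := invFT_jumpFT_mul hk (integrable_jumpFT_pow_mul hk hk0 hm n) x
      simp only [pow_succ', mul_assoc] at h1 ⊢
      rw [h1]
      have hc : 0 ≤ M * (Λ * convConst d α) ^ n * Λ := by positivity
      calc _ ≤ ∫ z, M * (Λ * convConst d α) ^ n * Λ * (decay α (x + z) * decay α z) := by
            refine norm_integral_le_of_norm_le ((integrable_decay_mul_decay hα x).const_mul _)
              (ae_of_all _ fun z => ?_)
            rw [norm_mul, Complex.norm_real, Real.norm_of_nonneg (hk0 z)]
            calc _ ≤ (Λ * decay α z) * (M * (Λ * convConst d α) ^ n * decay α (x + z)) := by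
                  have := decay_pos α z
                  gcongr
                  · exact hle z
                  · exact ih _
              _ = _ := by ring
        _ ≤ M * (Λ * convConst d α) ^ n * Λ * (convConst d α * decay α x) := by
            rw [integral_const_mul]
            gcongr
            exact integral_decay_mul_decay_le hα x
        _ = _ := by ring
  have hexp : (fun w => (Real.exp (-symbol k w) : ℂ) * m w) =
      fun w => Real.exp (-∫ z, k z) * (Complex.exp (jumpFT k w) * m w) := by
    ext w
    push_cast
    rw [symbol_eq_sub_jumpFT hk heven, ← mul_assoc, ← Complex.exp_add]
    congr 2; ring
  have hfac : invFT (fun w => Real.exp (-symbol k w) * m w) x =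
      Real.exp (-∫ z, k z) * invFT (fun w => Complex.exp (jumpFT k w) * m w) x := by
    rw [hexp, invFT, invFT, ← integral_const_mul]
    congr 1; ext w; ring
  have hs := hasSum_invFT_exp_jumpFT hk hk0 hm x
  have hS : HasSum (fun n : ℕ => M * decay α x * ((Λ * convConst d α) ^ n / n.factorial))
      (M * decay α x * Real.exp (Λ * convConst d α)) := by
    have h := NormedSpace.expSeries_div_hasSum_exp (Λ * convConst d α)
    rw [← Real.exp_eq_exp_ℝ] at h
    exact h.mul_left _
  have hle' : ‖invFT (fun w => Complex.exp (jumpFT k w) * m w) x‖ ≤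
      M * decay α x * Real.exp (Λ * convConst d α) := by
    rw [← hs.tsum_eq]
    refine tsum_of_norm_bounded hS fun n => ?_
    rw [norm_div, Complex.norm_natCast, ← mul_div_assoc]
    gcongr
    calc _ ≤ _ := hpow n x
      _ = _ := by ring
  rw [hfac, norm_mul, Complex.norm_real, Real.norm_of_nonneg (Real.exp_pos _).le]
  have h1 : Real.exp (-∫ z, k z) ≤ 1 := by
    rw [Real.exp_le_one_iff, neg_nonpos]; exact integral_nonneg hk0
  calc _ ≤ 1 * (M * decay α x * Real.exp (Λ * convConst d α)) := by
        have := decay_pos α x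
        gcongr
    _ = _ := by ring

/-- Integrable jumps preserve positivity of the real part. -/
theorem re_invFT_exp_neg_symbol_nonneg {k : 𝓔 d → ℝ} (hk : Integrable k) (hk0 : ∀ z, 0 ≤ k z)
    (heven : ∀ z, k (-z) = k z) {m : 𝓔 d → ℂ} (hm : Integrable m)
    (hpos : ∀ x, 0 ≤ (invFT m x).re) (x : 𝓔 d) :
    0 ≤ (invFT (fun w => Real.exp (-symbol k w) * m w) x).re := by
  have hpow : ∀ (n : ℕ) x, 0 ≤ (invFT (fun w => jumpFT k w ^ n * m w) x).re := by
    intro n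
    induction n with
    | zero => intro x; simpa using hpos x
    | succ n ih =>
      intro x
      have hmn := integrable_jumpFT_pow_mul hk hk0 hm n
      have h1 := invFT_jumpFT_mul hk hmn x
      simp only [pow_succ', mul_assoc] at h1 ⊢
      have hint : Integrable fun z => (k z : ℂ) * invFT (fun w => jumpFT k w ^ n * m w) (x + z) :=
        (hk.ofReal (𝕜 := ℂ)).mul_bdd (c := ∫ w, ‖jumpFT k w ^ n * m w‖)
          ((continuous_invFT hmn).comp (continuous_const_add x)).aestronglyMeasurable
          (ae_of_all _ fun z => norm_invFT_le _ _)
      rw [h1, ← RCLike.re_eq_complex_re, ← integral_re hint]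
      refine integral_nonneg fun z => ?_
      simp only [RCLike.re_eq_complex_re, Complex.re_ofReal_mul]
      exact mul_nonneg (hk0 z) (ih _)
  have hfac : invFT (fun w => Real.exp (-symbol k w) * m w) x =
      Real.exp (-∫ z, k z) * invFT (fun w => Complex.exp (jumpFT k w) * m w) x := by
    rw [invFT, invFT, ← integral_const_mul]
    congr 1; ext w
    have : ((Real.exp (-symbol k w) : ℝ) : ℂ) =
        Real.exp (-∫ z, k z) * Complex.exp (jumpFT k w) := by
      push_cast
      rw [symbol_eq_sub_jumpFT hk heven, ← Complex.exp_add]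
      congr 1; ring
    rw [this]; ring
  have hs := Complex.hasSum_re (hasSum_invFT_exp_jumpFT hk hk0 hm x)
  rw [hfac, Complex.re_ofReal_mul]
  refine mul_nonneg (Real.exp_pos _).le (hs.nonneg fun n => ?_)
  rw [Complex.div_natCast_re]
  exact div_nonneg (hpow n x) (Nat.cast_nonneg _)

/-! ### Small jumps -/

/-- A jump density supported in the unit ball and comparable to `|z|^(-d-α)` there. -/
structure IsSmallJumpDensity (α Λ κ₀ : ℝ) (k : 𝓔 d → ℝ) : Prop extends IsJumpDensity α Λ k where
  eq_zero : ∀ z, 1 < ‖z‖ → k z = 0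
  low : ∀ z, ‖z‖ ≤ 1 → κ₀ * jumpWeight α z ≤ k z

/-- The derivative of `symbol k` in the direction `u`, for `k` supported in the unit ball. -/
def symbolDeriv (k : 𝓔 d → ℝ) (u w : 𝓔 d) : ℝ :=
  ∫ z, 2 * Real.pi * inner ℝ u z * Real.sin (2 * Real.pi * inner ℝ w z) * k z

/-- The constant `c` in the lower bound `c |w|^α` of the symbol. -/
def ellipticity (d : ℕ) (κ₀ : ℝ) : ℝ :=
  κ₀ * volume.real (Metric.ball (0 : 𝓔 d) (1 / 4))

theorem ellipticity_pos {κ₀ : ℝ} (hκ₀ : 0 < κ₀) : 0 < ellipticity d κ₀ := by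
  unfold ellipticity
  refine mul_pos hκ₀ (ENNReal.toReal_pos ?_ measure_ball_lt_top.ne)
  exact (Metric.measure_ball_pos _ _ (by norm_num)).ne'

/-- The product `∏ (e^{2πi⟨w, hᵢ⟩} - 1)`, the Fourier multiplier of an iterated difference. -/
def diffProd (A : Finset ℕ) (h : ℕ → 𝓔 d) (w : 𝓔 d) : ℂ := ∏ i ∈ A, (wave w (h i) - 1)

theorem continuous_diffProd (A : Finset ℕ) (h : ℕ → 𝓔 d) : Continuous (diffProd A h) := by
  unfold diffProd
  exact continuous_finsetProd _ fun i _ => (continuous_wave_left _).sub continuous_const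

theorem norm_diffProd_le (A : Finset ℕ) (h : ℕ → 𝓔 d) (w : 𝓔 d) :
    ‖diffProd A h w‖ ≤ (2 * Real.pi * ‖w‖) ^ A.card * ∏ i ∈ A, ‖h i‖ := by
  rw [diffProd, norm_prod, ← Finset.prod_const, ← Finset.prod_mul_distrib]
  refine Finset.prod_le_prod (fun i _ => norm_nonneg _) fun i _ => ?_
  rw [mul_assoc]; exact norm_wave_sub_one_le w (h i)

theorem diffProd_insert_update {A : Finset ℕ} {j : ℕ} (hj : j ∉ A) (h : ℕ → 𝓔 d) (z w : 𝓔 d) :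
    diffProd (insert j A) (Function.update h j z) w = (wave w z - 1) * diffProd A h w := by
  rw [diffProd, Finset.prod_insert hj, Function.update_self, diffProd]
  congr 1
  refine Finset.prod_congr rfl fun i hi => ?_
  rw [Function.update_of_ne (by rintro rfl; exact hj hi)]

theorem hasDerivAt_wave_line (w u x : 𝓔 d) (t : ℝ) :
    HasDerivAt (fun t : ℝ => wave (w + t • u) x)
      ((2 * Real.pi * inner ℝ u x : ℝ) * Complex.I * wave (w + t • u) x) t := by
  have h1 : HasDerivAt (fun t : ℝ => 2 * Real.pi * inner ℝ (w + t • u) x)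
      (2 * Real.pi * inner ℝ u x) t := by
    have h : HasDerivAt (fun t : ℝ => 2 * Real.pi * inner ℝ w x + t * (2 * Real.pi * inner ℝ u x))
        (1 * (2 * Real.pi * inner ℝ u x)) t :=
      ((hasDerivAt_id t).mul_const _).const_add _
    rw [one_mul] at h
    refine h.congr_of_eventuallyEq (Eventually.of_forall fun s => ?_)
    simp only [inner_add_left, inner_smul_left, conj_trivial]
    ring
  have h2 := (h1.ofReal_comp.mul_const Complex.I).cexp
  rw [mul_comm]
  exact h2

theorem hasLineDerivAt_wave (w u x : 𝓔 d) :
    HasLineDerivAt ℝ (fun w => wave w x)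
      ((2 * Real.pi * inner ℝ u x : ℝ) * Complex.I * wave w x) w u := by
  simpa [HasLineDerivAt] using hasDerivAt_wave_line w u x 0

theorem hasLineDerivAt_diffProd (A : Finset ℕ) (h : ℕ → 𝓔 d) (w u : 𝓔 d) :
    HasLineDerivAt ℝ (diffProd A h)
      (∑ i ∈ A, diffProd (A.erase i) h w *
        ((2 * Real.pi * inner ℝ u (h i) : ℝ) * Complex.I * wave w (h i))) w u := by
  have := HasDerivAt.fun_finsetProd (u := A) (x := (0 : ℝ))
    (f := fun i (t : ℝ) => wave (w + t • u) (h i) - 1)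
    (fun i _ => (hasDerivAt_wave_line w u (h i) 0).sub_const 1)
  simpa [HasLineDerivAt, diffProd] using this

/-- Integration by parts: a linear factor in physical space is a derivative of the multiplier. -/
theorem inner_mul_invFT {m m' : 𝓔 d → ℂ} (u x : 𝓔 d) (hm : Integrable m) (hm' : Integrable m')
    (hderiv : ∀ w, HasLineDerivAt ℝ m (m' w) w u) :
    ((2 * Real.pi * inner ℝ u x : ℝ) * Complex.I) * invFT m x = -invFT m' x := by
  have h := integral_bilinear_hasLineDerivAt_right_eq_neg_left_of_integrable (μ := volume)
    (B := ContinuousLinearMap.mul ℝ ℂ) (f := fun w => wave w x)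
    (f' := fun w => (2 * Real.pi * inner ℝ u x : ℝ) * Complex.I * wave w x) (g := m) (g' := m')
    (v := u) ?_ (integrable_wave_mul hm' x) (integrable_wave_mul hm x)
    (fun w _ => hasLineDerivAt_wave w u x) (fun w _ => hderiv w)
  · simp only [ContinuousLinearMap.mul_apply'] at h
    rw [invFT, invFT, h, neg_neg, ← integral_const_mul]
    congr 1; ext w; ring
  · simpa only [ContinuousLinearMap.mul_apply', mul_assoc] using
      (integrable_wave_mul hm x).const_mul ((2 * Real.pi * inner ℝ u x : ℝ) * Complex.I)

/-- The Fourier multiplier of an iterated difference of the kernel of `k`. -/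
def diffSymbol (k : 𝓔 d → ℝ) (A : Finset ℕ) (h : ℕ → 𝓔 d) (w : 𝓔 d) : ℂ :=
  diffProd A h w * Real.exp (-symbol k w)

namespace IsSmallJumpDensity
variable {α Λ κ₀ : ℝ} {k : 𝓔 d → ℝ}

theorem sq_mul_eq (hk : IsSmallJumpDensity α Λ κ₀ k) (z : 𝓔 d) :
    ‖z‖ ^ 2 * k z = min 1 (‖z‖ ^ 2) * k z := by
  rcases le_or_gt ‖z‖ 1 with h | h
  · rw [min_eq_right (pow_le_one₀ (norm_nonneg _) h)]
  · simp [hk.eq_zero z h]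

theorem integrable_sq_mul (hk : IsSmallJumpDensity α Λ κ₀ k) (hα0 : 0 < α) (hα2 : α < 2) :
    Integrable fun z => ‖z‖ ^ 2 * k z := by
  simpa only [hk.sq_mul_eq] using hk.integrable_min_mul hα0 hα2

theorem integral_sq_mul_le (hk : IsSmallJumpDensity α Λ κ₀ k) (hα0 : 0 < α) (hα2 : α < 2) :
    ∫ z, ‖z‖ ^ 2 * k z ≤ Λ * levyMass d α := by
  simpa only [hk.sq_mul_eq] using hk.integral_min_mul_le hα0 hα2

theorem abs_derivIntegrand_le (hk : IsSmallJumpDensity α Λ κ₀ k) (u w z : 𝓔 d) :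
    ‖2 * Real.pi * inner ℝ u z * Real.sin (2 * Real.pi * inner ℝ w z) * k z‖ ≤
      4 * Real.pi ^ 2 * ‖u‖ * ‖w‖ * (‖z‖ ^ 2 * k z) := by
  have h2 : |Real.sin (2 * Real.pi * inner ℝ w z)| ≤ 2 * Real.pi * (‖w‖ * ‖z‖) :=
    Real.abs_sin_le_abs.trans (abs_two_pi_inner_le w z)
  have h0 := hk.nonneg z
  rw [norm_mul, norm_mul, Real.norm_eq_abs, Real.norm_eq_abs, Real.norm_of_nonneg h0]
  calc _ ≤ 2 * Real.pi * (‖u‖ * ‖z‖) * (2 * Real.pi * (‖w‖ * ‖z‖)) * k z := by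
        gcongr
        exact abs_two_pi_inner_le u z
    _ = _ := by ring

theorem measurable_derivIntegrand (hk : IsSmallJumpDensity α Λ κ₀ k) (u : 𝓔 d) :
    Measurable fun p : 𝓔 d × 𝓔 d =>
      2 * Real.pi * inner ℝ u p.2 * Real.sin (2 * Real.pi * inner ℝ p.1 p.2) * k p.2 :=
  (Continuous.measurable (by fun_prop)).mul (hk.measurable.comp measurable_snd)

theorem abs_symbolDeriv_le (hk : IsSmallJumpDensity α Λ κ₀ k) (hα0 : 0 < α) (hα2 : α < 2)
    (u w : 𝓔 d) : ‖symbolDeriv k u w‖ ≤ 4 * Real.pi ^ 2 * ‖u‖ * ‖w‖ * (Λ * levyMass d α) := by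
  refine (norm_integral_le_of_norm_le ((hk.integrable_sq_mul hα0 hα2).const_mul _)
    (ae_of_all _ fun z => hk.abs_derivIntegrand_le u w z)).trans ?_
  rw [integral_const_mul]
  gcongr
  exact hk.integral_sq_mul_le hα0 hα2

theorem measurable_symbolDeriv (hk : IsSmallJumpDensity α Λ κ₀ k) (u : 𝓔 d) :
    Measurable (symbolDeriv k u) :=
  (hk.measurable_derivIntegrand u).stronglyMeasurable.integral_prod_right'.measurable

theorem hasLineDerivAt_symbol (hk : IsSmallJumpDensity α Λ κ₀ k) (hα0 : 0 < α) (hα2 : α < 2)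
    (u w : 𝓔 d) : HasLineDerivAt ℝ (symbol k) (symbolDeriv k u w) w u := by
  have h := hasDerivAt_integral_of_dominated_loc_of_deriv_le (μ := volume) (x₀ := (0 : ℝ))
    (F := fun (t : ℝ) z => (1 - Real.cos (2 * Real.pi * inner ℝ (w + t • u) z)) * k z)
    (F' := fun (t : ℝ) z =>
      2 * Real.pi * inner ℝ u z * Real.sin (2 * Real.pi * inner ℝ (w + t • u) z) * k z)
    (bound := fun z => 4 * Real.pi ^ 2 * ‖u‖ * (‖w‖ + ‖u‖) * (‖z‖ ^ 2 * k z))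
    (Metric.ball_mem_nhds 0 one_pos)
    (Eventually.of_forall fun t => (hk.measurable_integrand _).aestronglyMeasurable)
    (hk.integrable_integrand hα0 hα2 _)
    ((hk.measurable_derivIntegrand u).comp measurable_prodMk_left).aestronglyMeasurable
    (ae_of_all _ fun z t ht => ?_) ((hk.integrable_sq_mul hα0 hα2).const_mul _)
    (ae_of_all _ fun z t _ => ?_)
  · simpa [HasLineDerivAt, symbol, symbolDeriv] using h.2
  · refine (hk.abs_derivIntegrand_le u _ z).trans ?_
    have ht1 : |t| ≤ 1 := by
      rw [Metric.mem_ball, dist_zero_right, Real.norm_eq_abs] at ht; exact ht.le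
    have hwt : ‖w + t • u‖ ≤ ‖w‖ + ‖u‖ := by
      refine (norm_add_le _ _).trans ?_
      rw [norm_smul, Real.norm_eq_abs]
      nlinarith [norm_nonneg u]
    have := hk.nonneg z
    gcongr
  · have h1 : HasDerivAt (fun t : ℝ => 2 * Real.pi * inner ℝ (w + t • u) z)
        (2 * Real.pi * inner ℝ u z) t := by
      have h : HasDerivAt
          (fun t : ℝ => 2 * Real.pi * inner ℝ w z + t * (2 * Real.pi * inner ℝ u z))
          (1 * (2 * Real.pi * inner ℝ u z)) t :=
        ((hasDerivAt_id t).mul_const _).const_add _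
      rw [one_mul] at h
      refine h.congr_of_eventuallyEq (Eventually.of_forall fun s => ?_)
      simp only [inner_add_left, inner_smul_left, conj_trivial]
      ring
    exact ((h1.cos.const_sub 1).mul_const (k z)).congr_deriv (by ring)

theorem norm_diffSymbol_le (hk : IsSmallJumpDensity α Λ κ₀ k) (hα0 : 0 < α) (hα2 : α < 2)
    (hκ₀ : 0 < κ₀) (A : Finset ℕ) (h : ℕ → 𝓔 d) (w : 𝓔 d) :
    ‖diffSymbol k A h w‖ ≤ (2 * Real.pi) ^ A.card * Real.exp (ellipticity d κ₀) *
      (∏ i ∈ A, ‖h i‖) * (‖w‖ ^ A.card * Real.exp (-(ellipticity d κ₀ * ‖w‖ ^ α))) := by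
  have h1 := norm_diffProd_le A h w
  have h2 := exp_neg_symbol_le hk.toIsJumpDensity hα0 hα2 hκ₀.le hk.low zero_le_one w
  simp only [one_mul] at h2
  rw [diffSymbol, norm_mul, Complex.norm_real, Real.norm_of_nonneg (Real.exp_pos _).le]
  calc _ ≤ ((2 * Real.pi * ‖w‖) ^ A.card * ∏ i ∈ A, ‖h i‖) * (Real.exp (ellipticity d κ₀) *
        Real.exp (-(ellipticity d κ₀ * ‖w‖ ^ α))) := by
        gcongr; exact h2
    _ = _ := by rw [mul_pow]; ring

theorem continuous_diffSymbol (hk : IsSmallJumpDensity α Λ κ₀ k) (hα0 : 0 < α) (hα2 : α < 2)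
    (A : Finset ℕ) (h : ℕ → 𝓔 d) : Continuous (diffSymbol k A h) := by
  have := hk.continuous_symbol hα0 hα2
  have := continuous_diffProd A h
  unfold diffSymbol
  fun_prop

theorem integrable_pow_mul_diffSymbol (hk : IsSmallJumpDensity α Λ κ₀ k) (hα0 : 0 < α)
    (hα2 : α < 2) (hκ₀ : 0 < κ₀) (A : Finset ℕ) (h : ℕ → 𝓔 d) (n : ℕ) :
    Integrable fun w => (‖w‖ ^ n : ℂ) * diffSymbol k A h w := by
  refine ((integrable_pow_mul_exp_neg hα0 (ellipticity_pos (d := d) hκ₀) (n + A.card)).const_mul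
    ((2 * Real.pi) ^ A.card * Real.exp (ellipticity d κ₀) * (∏ i ∈ A, ‖h i‖))).mono' ?_
    (ae_of_all _ fun w => ?_)
  · have := hk.continuous_diffSymbol hα0 hα2 A h
    exact Continuous.aestronglyMeasurable (by fun_prop)
  · rw [norm_mul, norm_pow, Complex.norm_real, norm_norm]
    exact (mul_le_mul_of_nonneg_left (hk.norm_diffSymbol_le hα0 hα2 hκ₀ A h w)
      (by positivity)).trans_eq (by rw [pow_add]; ring)

theorem integrable_diffSymbol (hk : IsSmallJumpDensity α Λ κ₀ k) (hα0 : 0 < α)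
    (hα2 : α < 2) (hκ₀ : 0 < κ₀) (A : Finset ℕ) (h : ℕ → 𝓔 d) :
    Integrable (diffSymbol k A h) := by
  simpa using hk.integrable_pow_mul_diffSymbol hα0 hα2 hκ₀ A h 0

theorem integrable_symbolDeriv_mul (hk : IsSmallJumpDensity α Λ κ₀ k) (hα0 : 0 < α)
    (hα2 : α < 2) (hκ₀ : 0 < κ₀) (A : Finset ℕ) (h : ℕ → 𝓔 d) (u : 𝓔 d) :
    Integrable fun w => (symbolDeriv k u w : ℂ) * diffSymbol k A h w := by
  refine ((hk.integrable_pow_mul_diffSymbol hα0 hα2 hκ₀ A h 1).norm.const_mul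
    (4 * Real.pi ^ 2 * ‖u‖ * (Λ * levyMass d α))).mono' ?_ (ae_of_all _ fun w => ?_)
  · exact ((hk.measurable_symbolDeriv u).complex_ofReal.mul
      (hk.continuous_diffSymbol hα0 hα2 A h).measurable).aestronglyMeasurable
  · rw [norm_mul, norm_mul, norm_pow, Complex.norm_real, Complex.norm_real, norm_norm, pow_one]
    calc _ ≤ 4 * Real.pi ^ 2 * ‖u‖ * ‖w‖ * (Λ * levyMass d α) * ‖diffSymbol k A h w‖ := by
          gcongr; exact hk.abs_symbolDeriv_le hα0 hα2 u w
      _ = _ := by ring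

theorem hasLineDerivAt_diffSymbol (hk : IsSmallJumpDensity α Λ κ₀ k) (hα0 : 0 < α) (hα2 : α < 2)
    (A : Finset ℕ) (h : ℕ → 𝓔 d) (u w : 𝓔 d) :
    HasLineDerivAt ℝ (diffSymbol k A h)
      ((∑ i ∈ A, (2 * Real.pi * inner ℝ u (h i) : ℝ) * Complex.I *
          (wave w (h i) * diffSymbol k (A.erase i) h w)) -
        symbolDeriv k u w * diffSymbol k A h w) w u := by
  have h1 : HasDerivAt (fun t : ℝ => diffProd A h (w + t • u)) _ 0 :=
    hasLineDerivAt_diffProd A h w u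
  have h2 : HasDerivAt (fun t : ℝ => symbol k (w + t • u)) _ 0 :=
    hk.hasLineDerivAt_symbol hα0 hα2 u w
  have h3 := h1.mul (h2.neg.exp.ofReal_comp)
  have h4 : HasDerivAt (fun t : ℝ => diffSymbol k A h (w + t • u)) _ 0 := h3
  refine HasDerivAt.congr_deriv h4 ?_
  simp only [diffSymbol, zero_smul, add_zero, Finset.sum_mul, Pi.neg_apply]
  push_cast
  rw [sub_eq_add_neg]
  congr 1
  · refine Finset.sum_congr rfl fun i _ => ?_; ring
  · ring

/-- Multiplication by the derivative of the symbol averages antisymmetric first differences. -/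
theorem invFT_symbolDeriv_mul (hk : IsSmallJumpDensity α Λ κ₀ k) (hα0 : 0 < α)
    (hα2 : α < 2) (hκ₀ : 0 < κ₀) {A : Finset ℕ} {j : ℕ} (hj : j ∉ A) (h : ℕ → 𝓔 d) (u x : 𝓔 d) :
    invFT (fun w => (symbolDeriv k u w : ℂ) * diffSymbol k A h w) x =
      ∫ z, (Real.pi * inner ℝ u z * k z : ℝ) * (-Complex.I) *
        (invFT (diffSymbol k (insert j A) (Function.update h j z)) x -
          invFT (diffSymbol k (insert j A) (Function.update h j (-z))) x) := by
  set b : 𝓔 d → 𝓔 d → ℂ := fun z w =>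
    (2 * Real.pi * inner ℝ u z * Real.sin (2 * Real.pi * inner ℝ w z) * k z : ℝ) *
      diffSymbol k A h w with hb
  have hbi : Integrable (Function.uncurry b) (volume.prod volume) := by
    have h1 := ((hk.integrable_sq_mul hα0 hα2).ofReal (𝕜 := ℂ)).mul_prod
      (hk.integrable_pow_mul_diffSymbol hα0 hα2 hκ₀ A h 1)
    refine (h1.norm.const_mul (4 * Real.pi ^ 2 * ‖u‖)).mono' ?_ (ae_of_all _ fun p => ?_)
    · exact (((hk.measurable_derivIntegrand u).comp measurable_swap).complex_ofReal.mul
        ((hk.continuous_diffSymbol hα0 hα2 A h).measurable.comp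
          measurable_snd)).aestronglyMeasurable
    · simp only [Function.uncurry, hb]
      rw [norm_mul, Complex.norm_real]
      have h0 := hk.nonneg p.1
      calc _ ≤ 4 * Real.pi ^ 2 * ‖u‖ * ‖p.2‖ * (‖p.1‖ ^ 2 * k p.1) * ‖diffSymbol k A h p.2‖ := by
            gcongr; exact hk.abs_derivIntegrand_le u p.2 p.1
        _ = _ := by
            simp [abs_of_nonneg h0]; ring
  have h2 := integral_invFT hbi x
  have h3 : (fun w => ∫ z, b z w) = fun w => (symbolDeriv k u w : ℂ) * diffSymbol k A h w := by
    ext w; rw [hb]; simp only []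
    rw [integral_mul_const, integral_complex_ofReal, symbolDeriv]
  rw [← h3, ← h2]
  congr 1; ext z
  rw [← invFT_sub (hk.integrable_diffSymbol hα0 hα2 hκ₀ _ _)
    (hk.integrable_diffSymbol hα0 hα2 hκ₀ _ _), invFT, invFT, ← integral_const_mul]
  congr 1; ext w
  have hs := wave_sub_wave_neg w z
  simp only [hb, diffSymbol, diffProd_insert_update hj]
  have hw : wave w z = wave w (-z) +
    2 * Real.sin (2 * Real.pi * inner ℝ w z) * Complex.I := by rw [← hs]; ring
  rw [hw]
  push_cast
  linear_combination (2 * (Real.pi : ℂ) * (inner ℝ u z : ℝ) *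
    Complex.sin (2 * Real.pi * (inner ℝ w z : ℝ)) * k z * wave w x * diffProd A h w *
    Complex.exp (-(symbol k w : ℂ))) * Complex.I_sq
end IsSmallJumpDensity

namespace IsSmallJumpDensity
variable {α Λ κ₀ : ℝ} {k : 𝓔 d → ℝ}

/-- The contribution of the derivative of the symbol: the antisymmetric difference gains a factor
`|z|`, which makes `|z|² k(z)` integrable. -/
theorem norm_invFT_symbolDeriv_mul_le (hk : IsSmallJumpDensity α Λ κ₀ k) (hα0 : 0 < α)
    (hα2 : α < 2) (hκ₀ : 0 < κ₀) {A : Finset ℕ} {h : ℕ → 𝓔 d} {N : ℕ} {C₂ : ℝ} (hC₂ : 0 ≤ C₂)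
    (h₂ : ∀ j ∉ A, ∀ z : 𝓔 d, ‖z‖ ≤ 1 → ∀ x,
      (1 + ‖x‖) ^ N * ‖invFT (diffSymbol k (insert j A) (Function.update h j z)) x‖ ≤
        C₂ * (‖z‖ * ∏ j ∈ A, ‖h j‖)) (x : 𝓔 d) :
    ‖invFT (fun w => (symbolDeriv k x w : ℂ) * diffSymbol k A h w) x‖ ≤
      2 * Real.pi * ‖x‖ * (C₂ * (∏ j ∈ A, ‖h j‖) / (1 + ‖x‖) ^ N) * (Λ * levyMass d α) := by
  have hP : 0 ≤ ∏ j ∈ A, ‖h j‖ := Finset.prod_nonneg fun _ _ => norm_nonneg _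
  set B : ℝ := (1 + ‖x‖) ^ N with hB
  have hB0 : 0 < B := by positivity
  set P := ∏ j ∈ A, ‖h j‖
  obtain ⟨j, hj⟩ := Infinite.exists_notMem_finset A
  rw [hk.invFT_symbolDeriv_mul hα0 hα2 hκ₀ hj h x x]
  refine (norm_integral_le_of_norm_le ((hk.integrable_sq_mul hα0 hα2).const_mul
    (2 * Real.pi * ‖x‖ * (C₂ * P / B))) (ae_of_all _ fun z => ?_)).trans ?_
  · rcases le_or_gt ‖z‖ 1 with hz | hz
    · have hF : ∀ z : 𝓔 d, ‖z‖ ≤ 1 →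
          ‖invFT (diffSymbol k (insert j A) (Function.update h j z)) x‖ ≤ C₂ * (‖z‖ * P) / B := by
        intro z hz
        rw [le_div_iff₀ hB0, mul_comm]; exact h₂ j hj z hz x
      have hFz := hF z hz
      have hFz' := hF (-z) (by simpa using hz)
      rw [norm_neg] at hFz'
      have h0 := hk.nonneg z
      rw [norm_mul, norm_mul, norm_neg, Complex.norm_I, mul_one, Complex.norm_real, norm_mul,
        norm_mul, Real.norm_of_nonneg Real.pi_pos.le, Real.norm_of_nonneg h0]
      calc _ ≤ Real.pi * (‖x‖ * ‖z‖) * k z * (C₂ * (‖z‖ * P) / B + C₂ * (‖z‖ * P) / B) := by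
            gcongr
            · exact abs_real_inner_le_norm x z
            · exact (norm_sub_le _ _).trans (add_le_add hFz hFz')
        _ = _ := by ring
    · simp [hk.eq_zero z hz]
  · rw [integral_const_mul]
    exact mul_le_mul_of_nonneg_left (hk.integral_sq_mul_le hα0 hα2) (by positivity)

/-- One more power of decay in terms of bounds for one difference more and one difference less. -/
theorem norm_mul_invFT_le (hk : IsSmallJumpDensity α Λ κ₀ k) (hα0 : 0 < α) (hα2 : α < 2)
    (hκ₀ : 0 < κ₀) {A : Finset ℕ} {h : ℕ → 𝓔 d} (hh : ∀ i ∈ A, ‖h i‖ ≤ 1) {N : ℕ} {C₁ C₂ : ℝ}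
    (hC₁ : 0 ≤ C₁) (hC₂ : 0 ≤ C₂)
    (h₁ : ∀ i ∈ A, ∀ x, (1 + ‖x‖) ^ N * ‖invFT (diffSymbol k (A.erase i) h) x‖ ≤
      C₁ * ∏ j ∈ A.erase i, ‖h j‖)
    (h₂ : ∀ j ∉ A, ∀ z : 𝓔 d, ‖z‖ ≤ 1 → ∀ x,
      (1 + ‖x‖) ^ N * ‖invFT (diffSymbol k (insert j A) (Function.update h j z)) x‖ ≤
        C₂ * (‖z‖ * ∏ j ∈ A, ‖h j‖)) (x : 𝓔 d) :
    (1 + ‖x‖) ^ N * (‖x‖ * ‖invFT (diffSymbol k A h) x‖) ≤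
      (A.card * 2 ^ N * C₁ + C₂ * (Λ * levyMass d α)) * ∏ j ∈ A, ‖h j‖ := by
  have hP : 0 ≤ ∏ j ∈ A, ‖h j‖ := Finset.prod_nonneg fun _ _ => norm_nonneg _
  have hΛL : 0 ≤ Λ * levyMass d α :=
    le_trans (integral_nonneg fun z => by have := hk.nonneg z; positivity)
      (hk.integral_min_mul_le hα0 hα2)
  rcases eq_or_ne x 0 with rfl | hx
  · simp only [norm_zero, zero_mul, mul_zero]; positivity
  have hx0 : 0 < ‖x‖ := norm_pos_iff.2 hx
  set B : ℝ := (1 + ‖x‖) ^ N with hB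
  have hB0 : 0 < B := by positivity
  set P := ∏ j ∈ A, ‖h j‖
  have hterm : ∀ i ∈ A, Integrable fun w => (2 * Real.pi * inner ℝ x (h i) : ℝ) * Complex.I *
      (wave w (h i) * diffSymbol k (A.erase i) h w) := fun i _ =>
    (integrable_wave_mul (hk.integrable_diffSymbol hα0 hα2 hκ₀ _ h) _).const_mul _
  have hsum := integrable_finsetSum A hterm
  have hder := hk.integrable_symbolDeriv_mul hα0 hα2 hκ₀ A h x
  have hid := inner_mul_invFT x x (hk.integrable_diffSymbol hα0 hα2 hκ₀ A h) (hsum.sub hder)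
    (fun w => hk.hasLineDerivAt_diffSymbol hα0 hα2 A h x w)
  have hsplit := invFT_sub hsum hder x
  have hfin : invFT (fun w => ∑ i ∈ A, (2 * Real.pi * inner ℝ x (h i) : ℝ) * Complex.I *
      (wave w (h i) * diffSymbol k (A.erase i) h w)) x =
      ∑ i ∈ A, (2 * Real.pi * inner ℝ x (h i) : ℝ) * Complex.I *
        invFT (diffSymbol k (A.erase i) h) (x + h i) := by
    simp only [invFT, Finset.mul_sum]
    rw [integral_finsetSum A fun i hi => integrable_wave_mul (hterm i hi) x]
    refine Finset.sum_congr rfl fun i _ => ?_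
    rw [← integral_const_mul]
    congr 1; ext w; rw [wave_add]; ring
  have hS1 : ‖∑ i ∈ A, (2 * Real.pi * inner ℝ x (h i) : ℝ) * Complex.I *
        invFT (diffSymbol k (A.erase i) h) (x + h i)‖ ≤
      A.card * (2 * Real.pi * ‖x‖ * (2 ^ N * C₁ * P) / B) := by
    rw [← nsmul_eq_mul]
    refine (norm_sum_le _ _).trans (Finset.sum_le_card_nsmul _ _ _ fun i hi => ?_)
    rw [norm_mul, norm_mul, Complex.norm_I, mul_one, Complex.norm_real, Real.norm_eq_abs,
      le_div_iff₀ hB0]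
    have hF := h₁ i hi (x + h i)
    have hB2 : B ≤ 2 ^ N * (1 + ‖x + h i‖) ^ N := by
      rw [hB, ← mul_pow]
      have : ‖x‖ ≤ ‖x + h i‖ + ‖h i‖ := by simpa using norm_sub_le (x + h i) (h i)
      have := hh i hi
      gcongr
      nlinarith [norm_nonneg (x + h i)]
    have hPi : ‖h i‖ * ∏ j ∈ A.erase i, ‖h j‖ = P := Finset.mul_prod_erase A (fun j => ‖h j‖) hi
    calc _ ≤ 2 * Real.pi * (‖x‖ * ‖h i‖) * ‖invFT (diffSymbol k (A.erase i) h) (x + h i)‖ *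
          (2 ^ N * (1 + ‖x + h i‖) ^ N) := by
          gcongr; exact abs_two_pi_inner_le x (h i)
      _ = 2 * Real.pi * ‖x‖ * (2 ^ N * ‖h i‖ * ((1 + ‖x + h i‖) ^ N *
          ‖invFT (diffSymbol k (A.erase i) h) (x + h i)‖)) := by ring
      _ ≤ 2 * Real.pi * ‖x‖ * (2 ^ N * ‖h i‖ * (C₁ * ∏ j ∈ A.erase i, ‖h j‖)) := by gcongr
      _ = _ := by rw [← hPi]; ring
  have hS2 : ‖invFT (fun w => (symbolDeriv k x w : ℂ) * diffSymbol k A h w) x‖ ≤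
      2 * Real.pi * ‖x‖ * (C₂ * P / B) * (Λ * levyMass d α) :=
    hk.norm_invFT_symbolDeriv_mul_le hα0 hα2 hκ₀ hC₂ h₂ x
  have hmain : 2 * Real.pi * ‖x‖ * (‖x‖ * ‖invFT (diffSymbol k A h) x‖) ≤
      A.card * (2 * Real.pi * ‖x‖ * (2 ^ N * C₁ * P) / B) +
        2 * Real.pi * ‖x‖ * (C₂ * P / B) * (Λ * levyMass d α) := by
    have hn := congrArg norm hid
    rw [norm_neg] at hn
    have hn2 : ‖((2 * Real.pi * inner ℝ x x : ℝ) * Complex.I) * invFT (diffSymbol k A h) x‖ =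
        2 * Real.pi * ‖x‖ * (‖x‖ * ‖invFT (diffSymbol k A h) x‖) := by
      rw [norm_mul, norm_mul, Complex.norm_I, mul_one, Complex.norm_real,
        real_inner_self_eq_norm_sq, Real.norm_of_nonneg (by positivity)]
      ring
    rw [← hn2, hn]
    refine (le_of_eq ?_).trans ((norm_sub_le _ _).trans (add_le_add hS1 hS2))
    rw [← hfin, ← hsplit]
    rfl
  have hpos : 0 < 2 * Real.pi * ‖x‖ / B := by positivity
  refine le_of_mul_le_mul_left ?_ hpos
  calc 2 * Real.pi * ‖x‖ / B * (B * (‖x‖ * ‖invFT (diffSymbol k A h) x‖))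
      = 2 * Real.pi * ‖x‖ * (‖x‖ * ‖invFT (diffSymbol k A h) x‖) := by field_simp
    _ ≤ _ := hmain
    _ = _ := by field_simp

end IsSmallJumpDensity

/-- All iterated differences of the small-jump kernel decay faster than any power, uniformly over
the class of jump densities: the induction trades one power of decay for one more difference. -/
theorem exists_pow_mul_norm_invFT_le (d : ℕ) {α Λ κ₀ : ℝ} (hα0 : 0 < α) (hα2 : α < 2)
    (hΛ : 0 ≤ Λ) (hκ₀ : 0 < κ₀) (N n : ℕ) :
    ∃ C, 0 ≤ C ∧ ∀ k : 𝓔 d → ℝ, IsSmallJumpDensity α Λ κ₀ k → ∀ A : Finset ℕ, A.card = n →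
      ∀ h : ℕ → 𝓔 d, (∀ i ∈ A, ‖h i‖ ≤ 1) → ∀ x,
        (1 + ‖x‖) ^ N * ‖invFT (diffSymbol k A h) x‖ ≤
          C * ∏ i ∈ A, ‖h i‖ := by
  induction N generalizing n with
  | zero =>
    refine ⟨(2 * Real.pi) ^ n * Real.exp (ellipticity d κ₀) *
      ∫ w : 𝓔 d, ‖w‖ ^ n * Real.exp (-(ellipticity d κ₀ * ‖w‖ ^ α)), ?_, ?_⟩
    · have : 0 ≤ ∫ w : 𝓔 d, ‖w‖ ^ n * Real.exp (-(ellipticity d κ₀ * ‖w‖ ^ α)) :=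
        integral_nonneg fun w => by positivity
      positivity
    · rintro k hk A rfl h - x
      rw [pow_zero, one_mul]
      refine (norm_invFT_le _ x).trans ?_
      have hb := (integrable_pow_mul_exp_neg (d := d) hα0 (ellipticity_pos (d := d) hκ₀) A.card).const_mul
        ((2 * Real.pi) ^ A.card * Real.exp (ellipticity d κ₀) * ∏ i ∈ A, ‖h i‖)
      refine (integral_mono (hk.integrable_diffSymbol hα0 hα2 hκ₀ A h).norm hb
        (hk.norm_diffSymbol_le hα0 hα2 hκ₀ A h)).trans_eq ?_
      rw [integral_const_mul]; ring
  | succ N ih =>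
    obtain ⟨C, hC, hCb⟩ := ih n
    obtain ⟨C₁, hC₁, h₁⟩ := ih (n - 1)
    obtain ⟨C₂, hC₂, h₂⟩ := ih (n + 1)
    have hL := levyMass_nonneg (d := d) α
    refine ⟨C + (n * 2 ^ N * C₁ + C₂ * (Λ * levyMass d α)), by positivity, ?_⟩
    rintro k hk A rfl h hh x
    have hmain := hk.norm_mul_invFT_le hα0 hα2 hκ₀ hh (N := N) hC₁ hC₂ ?_ ?_ x
    · calc _ = (1 + ‖x‖) ^ N * ‖invFT (diffSymbol k A h) x‖ +
            (1 + ‖x‖) ^ N * (‖x‖ * ‖invFT (diffSymbol k A h) x‖) := by ring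
        _ ≤ _ := add_le_add (hCb k hk A rfl h hh x) hmain
        _ = _ := by ring
    · intro i hi y
      exact h₁ k hk _ (Finset.card_erase_of_mem hi) h (fun j hj => hh j (Finset.mem_of_mem_erase hj)) y
    · intro j hj z hz y
      refine (h₂ k hk _ (Finset.card_insert_of_notMem hj) (Function.update h j z) ?_ y).trans_eq ?_
      · intro i hi
        rcases eq_or_ne i j with rfl | hij
        · simpa using hz
        · rw [Function.update_of_ne hij]
          exact hh i (Finset.mem_of_mem_insert_of_ne hi hij)
      · rw [Finset.prod_insert hj, Function.update_self]
        congr 2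
        refine Finset.prod_congr rfl fun i hi => ?_
        rw [Function.update_of_ne (by rintro rfl; exact hj hi)]

/-! ### Spatial bounds at time one -/

/-- A jump density comparable to `|z|^(-d-α)`, with constants `κ₀` and `κ₁`. -/
structure IsStableDensity (α κ₀ κ₁ : ℝ) (k : 𝓔 d → ℝ) : Prop extends IsJumpDensity α κ₁ k where
  low : ∀ z, κ₀ * jumpWeight α z ≤ k z

/-- The restriction of a jump density to the unit ball. -/
def smallPart (k : 𝓔 d → ℝ) : 𝓔 d → ℝ := (Metric.closedBall 0 1).indicator k

/-- The restriction of a jump density to the complement of the unit ball. -/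
def largePart (k : 𝓔 d → ℝ) : 𝓔 d → ℝ := (Metric.closedBall 0 1)ᶜ.indicator k

theorem indicator_even {k : 𝓔 d → ℝ} {s : Set (𝓔 d)} (hs : ∀ z, -z ∈ s ↔ z ∈ s)
    (hk : ∀ z, k (-z) = k z) (z : 𝓔 d) : s.indicator k (-z) = s.indicator k z := by
  classical
  simp only [Set.indicator_apply, hs, hk]

theorem IsJumpDensity.indicator {α Λ : ℝ} {k : 𝓔 d → ℝ} (hk : IsJumpDensity α Λ k)
    {s : Set (𝓔 d)} (hs : MeasurableSet s) (hneg : ∀ z, -z ∈ s ↔ z ∈ s) :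
    IsJumpDensity α Λ (s.indicator k) where
  measurable := hk.measurable.indicator hs
  even := indicator_even hneg hk.even
  nonneg := Set.indicator_nonneg fun z _ => hk.nonneg z
  le z := (Set.indicator_le_self' (fun z _ => hk.nonneg z) z).trans (hk.le z)

theorem IsJumpDensity.largePart_le {α Λ : ℝ} {k : 𝓔 d → ℝ} (hk : IsJumpDensity α Λ k)
    (hα : 0 < α) (hΛ : 0 ≤ Λ) (z : 𝓔 d) : largePart k z ≤ Λ * 2 ^ (d + α) * decay α z := by
  have h0 := decay_pos α z
  unfold largePart
  by_cases hz : z ∈ (Metric.closedBall (0 : 𝓔 d) 1)ᶜ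
  · rw [Set.indicator_of_mem hz]
    have hz1 : 1 ≤ ‖z‖ := by
      simp only [Set.mem_compl_iff, mem_closedBall_zero_iff, not_le] at hz; exact hz.le
    refine (hk.le z).trans ?_
    rw [mul_assoc]
    exact mul_le_mul_of_nonneg_left (jumpWeight_le_decay hα hz1) hΛ
  · rw [Set.indicator_of_notMem hz]; positivity

theorem symbol_indicator_add {α Λ : ℝ} {k : 𝓔 d → ℝ} (hk : IsJumpDensity α Λ k) (hα0 : 0 < α)
    (hα2 : α < 2) {s : Set (𝓔 d)} (hs : MeasurableSet s) (hneg : ∀ z, -z ∈ s ↔ z ∈ s) (w : 𝓔 d) :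
    symbol k w = symbol (s.indicator k) w + symbol (sᶜ.indicator k) w := by
  rw [symbol, symbol, symbol,
    ← integral_add ((hk.indicator hs hneg).integrable_integrand hα0 hα2 w)
      ((hk.indicator hs.compl fun z => not_congr (hneg z)).integrable_integrand hα0 hα2 w)]
  congr 1; ext z
  rw [← mul_add, ← congrFun (Set.indicator_self_add_compl s k) z, Pi.add_apply]

theorem neg_mem_closedBall_iff (r : ℝ) (z : 𝓔 d) :
    -z ∈ Metric.closedBall (0 : 𝓔 d) r ↔ z ∈ Metric.closedBall 0 r := by simp

theorem IsStableDensity.smallPart {α κ₀ κ₁ : ℝ} {k : 𝓔 d → ℝ} (hk : IsStableDensity α κ₀ κ₁ k) :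
    IsSmallJumpDensity α κ₁ κ₀ (smallPart k) where
  toIsJumpDensity := hk.toIsJumpDensity.indicator Metric.isClosed_closedBall.measurableSet
    (neg_mem_closedBall_iff 1)
  eq_zero z hz := Set.indicator_of_notMem (by simpa using hz) _
  low z hz := by
    rw [StableKernel.smallPart, Set.indicator_of_mem (by simpa using hz)]
    exact hk.low z

theorem pow_neg_le_decay {α : ℝ} (hα2 : α < 2) (x : 𝓔 d) : ((1 + ‖x‖) ^ (d + 2))⁻¹ ≤ decay α x := by
  unfold decay
  rw [← Real.rpow_natCast, ← Real.rpow_neg (by positivity)]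
  refine Real.rpow_le_rpow_of_exponent_le (by linarith [norm_nonneg x]) ?_
  push_cast; linarith

/-- Iterated differences of the kernel at time one are bounded by a multiple of `ϱ`. -/
theorem exists_norm_invFT_diffSymbol_le (d : ℕ) {α κ₀ κ₁ : ℝ} (hα0 : 0 < α) (hα2 : α < 2)
    (hκ₀ : 0 < κ₀) (hκ₁ : 0 ≤ κ₁) (n : ℕ) :
    ∃ C, 0 ≤ C ∧ ∀ k : 𝓔 d → ℝ, IsStableDensity α κ₀ κ₁ k → ∀ A : Finset ℕ, A.card = n →
      ∀ h : ℕ → 𝓔 d, (∀ i ∈ A, ‖h i‖ ≤ 1) → ∀ x,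
        ‖invFT (diffSymbol k A h) x‖ ≤ C * (∏ i ∈ A, ‖h i‖) * decay α x := by
  obtain ⟨C, hC, hb⟩ := exists_pow_mul_norm_invFT_le d hα0 hα2 hκ₁ hκ₀ (d + 2) n
  refine ⟨C * Real.exp (κ₁ * 2 ^ (d + α) * convConst d α), by positivity, ?_⟩
  intro k hk A hA h hh x
  have hP : 0 ≤ ∏ j ∈ A, ‖h j‖ := Finset.prod_nonneg fun _ _ => norm_nonneg _
  have hball : MeasurableSet (Metric.closedBall (0 : 𝓔 d) 1) :=
    Metric.isClosed_closedBall.measurableSet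
  have hL := hk.toIsJumpDensity.indicator hball.compl (by simp)
  have hmain := norm_invFT_exp_neg_symbol_le hα0 (k := largePart k) (Λ := κ₁ * 2 ^ (d + α))
    (by positivity) hL.measurable hL.nonneg hL.even (hk.largePart_le hα0 hκ₁)
    (hk.smallPart.integrable_diffSymbol hα0 hα2 hκ₀ A h) (M := C * ∏ j ∈ A, ‖h j‖)
    (by positivity) (fun y => ?_) x
  · have heq : diffSymbol k A h = fun w =>
        (Real.exp (-symbol (largePart k) w) : ℂ) * diffSymbol (smallPart k) A h w := by
      ext w
      rw [diffSymbol, diffSymbol, symbol_indicator_add hk.toIsJumpDensity hα0 hα2 hball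
        (neg_mem_closedBall_iff 1) w, neg_add, Real.exp_add, largePart, smallPart]
      push_cast; ring
    rw [heq]
    refine hmain.trans_eq ?_
    ring
  · have h1 := hb _ hk.smallPart A hA h hh y
    rw [← le_div_iff₀' (by positivity), div_eq_mul_inv] at h1
    refine h1.trans ?_
    gcongr
    exact pow_neg_le_decay hα2 y

theorem integrable_wave_sub_one_mul {m : 𝓔 d → ℂ} (hm : Integrable m) (z : 𝓔 d) :
    Integrable fun w => (wave w z - 1) * m w := by
  have : Integrable fun w => wave w z * m w - m w := (integrable_wave_mul hm z).sub hm
  simpa only [sub_mul, one_mul] using this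

theorem secondDiff_re_invFT {m : 𝓔 d → ℂ} (hm : Integrable m) (x z : 𝓔 d) :
    secondDiff (fun y => (invFT m y).re) x z =
      (invFT (fun w => (wave w z - 1) * ((wave w z - 1) * m w)) (x - z)).re := by
  rw [← invFT_add_sub (integrable_wave_sub_one_mul hm z), ← invFT_add_sub hm, ← invFT_add_sub hm, secondDiff]
  simp only [sub_add_cancel, Complex.sub_re]
  ring

/-- The constant in the integral bound of second differences against `|z|^(-d-α)`. -/
def diffConst (d : ℕ) (α : ℝ) : ℝ :=
  levyMass d α + 2 ^ (d + α) * (2 * convConst d α + 2 * ∫ z : 𝓔 d, decay α z)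

theorem diffConst_nonneg (α : ℝ) : 0 ≤ diffConst d α := by
  have h1 := levyMass_nonneg (d := d) α
  have h2 := convConst_nonneg (d := d) α
  have h3 : 0 ≤ ∫ z : 𝓔 d, decay α z := integral_nonneg fun z => (decay_pos α z).le
  unfold diffConst; positivity

/-- Pointwise bounds of a function and its second differences by `ϱ` bound the absolute integral
of the second differences. -/
theorem integral_abs_secondDiff_le {α : ℝ} (hα0 : 0 < α) (hα2 : α < 2) {f : 𝓔 d → ℝ}
    (hf : Continuous f) {M : ℝ} (hfM : ∀ x, |f x| ≤ M * decay α x)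
    (hδ : ∀ x z, ‖z‖ ≤ 1 → |secondDiff f x z| ≤ M * ‖z‖ ^ 2 * decay α x) (x : 𝓔 d) :
    Integrable (fun z => |secondDiff f x z| * jumpWeight α z) ∧
      ∫ z, |secondDiff f x z| * jumpWeight α z ≤ M * diffConst d α * decay α x := by
  have hM : 0 ≤ M := by
    have := (abs_nonneg _).trans (hfM 0)
    exact nonneg_of_mul_nonneg_left this (decay_pos α 0)
  have hc := continuous_decay (d := d) α
  have hx := decay_pos α x
  have hi1 := (integrable_min_sq_mul_jumpWeight (d := d) hα0 hα2).const_mul (M * decay α x)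
  have hi2 := integrable_decay_mul_decay hα0 x
  have hi3 : Integrable fun z : 𝓔 d => decay α (x - z) * decay α z := by
    simpa [decay_neg, sub_eq_add_neg] using hi2.comp_neg
  have hv3 : ∫ z : 𝓔 d, decay α (x - z) * decay α z ≤ convConst d α * decay α x := by
    have := integral_neg_eq_self (fun z : 𝓔 d => decay α (x - z) * decay α z) volume
    simp only [decay_neg, sub_neg_eq_add] at this
    rw [← this]; exact integral_decay_mul_decay_le hα0 x
  have hi4 := (integrable_decay (d := d) hα0).const_mul (2 * decay α x)
  have hi23 : Integrable fun z : 𝓔 d => decay α (x + z) * decay α z + decay α (x - z) * decay α z :=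
    hi2.add hi3
  have hi234 : Integrable fun z : 𝓔 d => decay α (x + z) * decay α z +
      decay α (x - z) * decay α z + 2 * decay α x * decay α z := hi23.add hi4
  have hi5 := hi234.const_mul (M * 2 ^ (d + α))
  have hbd : ∀ z, |secondDiff f x z| * jumpWeight α z ≤
      M * decay α x * (min 1 (‖z‖ ^ 2) * jumpWeight α z) + M * 2 ^ (d + α) *
        (decay α (x + z) * decay α z + decay α (x - z) * decay α z +
          2 * decay α x * decay α z) := by
    intro z
    have h1 := decay_pos α z
    have h2 := decay_pos α (x + z)
    have h3 := decay_pos α (x - z)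
    have hJ := jumpWeight_nonneg α z
    rcases le_total ‖z‖ 1 with hz | hz
    · refine le_add_of_le_of_nonneg ?_ (by positivity)
      rw [min_eq_right (pow_le_one₀ (norm_nonneg _) hz)]
      calc _ ≤ M * ‖z‖ ^ 2 * decay α x * jumpWeight α z := by gcongr; exact hδ x z hz
        _ = _ := by ring
    · refine le_add_of_nonneg_of_le (by positivity) ?_
      have hab : |secondDiff f x z| ≤ M * (decay α (x + z) + decay α (x - z) + 2 * decay α x) := by
        have e1 := abs_le.1 (hfM (x + z))
        have e2 := abs_le.1 (hfM (x - z))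
        have e3 := abs_le.1 (hfM x)
        unfold secondDiff
        rw [abs_le]; constructor <;> linarith
      calc _ ≤ M * (decay α (x + z) + decay α (x - z) + 2 * decay α x) *
            (2 ^ (d + α) * decay α z) := by
            gcongr; exact jumpWeight_le_decay hα0 hz
        _ = _ := by ring
  have hint : Integrable fun z => |secondDiff f x z| * jumpWeight α z := by
    refine (hi1.add hi5).mono' ?_ (ae_of_all _ fun z => ?_)
    · have : Continuous fun z => |secondDiff f x z| := by unfold secondDiff; fun_prop
      exact (this.measurable.mul (measurable_jumpWeight α)).aestronglyMeasurable
    · rw [Real.norm_of_nonneg (mul_nonneg (abs_nonneg _) (jumpWeight_nonneg α z))]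
      exact hbd z
  refine ⟨hint, (integral_mono hint (hi1.add hi5) hbd).trans ?_⟩
  have hval : ∫ z, (M * decay α x * (min 1 (‖z‖ ^ 2) * jumpWeight α z) + M * 2 ^ (d + α) *
        (decay α (x + z) * decay α z + decay α (x - z) * decay α z +
          2 * decay α x * decay α z)) = M * decay α x * levyMass d α + M * 2 ^ (d + α) *
        ((∫ z : 𝓔 d, decay α (x + z) * decay α z) + (∫ z : 𝓔 d, decay α (x - z) * decay α z) +
          2 * decay α x * ∫ z : 𝓔 d, decay α z) := by
    rw [integral_add hi1 hi5, integral_const_mul, integral_const_mul, integral_add hi23 hi4,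
      integral_add hi2 hi3, integral_const_mul, levyMass]
  refine hval.le.trans ?_
  calc _ ≤ M * decay α x * levyMass d α + M * 2 ^ (d + α) *
        (convConst d α * decay α x + convConst d α * decay α x +
          2 * decay α x * ∫ z : 𝓔 d, decay α z) := by
        gcongr
        exact integral_decay_mul_decay_le hα0 x
    _ = _ := by unfold diffConst; ring

theorem IsStableDensity.integrable_pow_mul_exp {α κ₀ κ₁ : ℝ} {k : 𝓔 d → ℝ}
    (hk : IsStableDensity α κ₀ κ₁ k) (hα0 : 0 < α) (hα2 : α < 2) (hκ₀ : 0 < κ₀) {t : ℝ}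
    (ht : 0 < t) (n : ℕ) : Integrable fun w => ‖w‖ ^ n * Real.exp (-(t * symbol k w)) := by
  have hc : 0 < t * ellipticity d κ₀ := mul_pos ht (ellipticity_pos hκ₀)
  refine ((integrable_pow_mul_exp_neg (d := d) hα0 hc n).const_mul
    (Real.exp (t * ellipticity d κ₀))).mono' ?_ (ae_of_all _ fun w => ?_)
  · have := hk.continuous_symbol hα0 hα2
    exact Continuous.aestronglyMeasurable (by fun_prop)
  · rw [Real.norm_of_nonneg (by positivity)]
    have h := exp_neg_symbol_le hk.toIsJumpDensity hα0 hα2 hκ₀.le (fun z _ => hk.low z) ht.le w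
    exact (mul_le_mul_of_nonneg_left h (by positivity)).trans_eq (by unfold ellipticity; ring)

theorem IsStableDensity.integrable_exp {α κ₀ κ₁ : ℝ} {k : 𝓔 d → ℝ}
    (hk : IsStableDensity α κ₀ κ₁ k) (hα0 : 0 < α) (hα2 : α < 2) (hκ₀ : 0 < κ₀) {t : ℝ}
    (ht : 0 < t) : Integrable fun w => (Real.exp (-(t * symbol k w)) : ℂ) := by
  have := hk.integrable_pow_mul_exp hα0 hα2 hκ₀ ht 0
  simp only [pow_zero, one_mul] at this
  exact this.ofReal

/-- The candidate for the heat kernel: the inverse Fourier integral of `e^{-tψ}`. -/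
def stableKernel (k : 𝓔 d → ℝ) (t : ℝ) (x : 𝓔 d) : ℝ :=
  (invFT (fun w => Real.exp (-(t * symbol k w))) x).re

theorem stableKernel_one (k : 𝓔 d → ℝ) (h : ℕ → 𝓔 d) :
    stableKernel k 1 = fun x => (invFT (diffSymbol k ∅ h) x).re := by
  have : diffSymbol k ∅ h = fun w => (Real.exp (-(1 * symbol k w)) : ℂ) := by
    ext w; simp [diffSymbol, diffProd]
  rw [this]; rfl

theorem exists_stableKernel_one_le (d : ℕ) {α κ₀ κ₁ : ℝ} (hα0 : 0 < α) (hα2 : α < 2)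
    (hκ₀ : 0 < κ₀) (hκ₁ : 0 ≤ κ₁) :
    ∃ C, 0 ≤ C ∧ ∀ k : 𝓔 d → ℝ, IsStableDensity α κ₀ κ₁ k → ∀ x,
      |stableKernel k 1 x| ≤ C * decay α x := by
  obtain ⟨C, hC, hb⟩ := exists_norm_invFT_diffSymbol_le d hα0 hα2 hκ₀ hκ₁ 0
  refine ⟨C, hC, fun k hk x => ?_⟩
  rw [stableKernel_one k 0]
  have := hb k hk ∅ rfl 0 (by simp) x
  simp only [Finset.prod_empty, mul_one] at this
  exact (Complex.abs_re_le_norm _).trans this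

/-- The two integral estimates at time one. -/
theorem exists_secondDiff_stableKernel_one_le (d : ℕ) {α κ₀ κ₁ : ℝ} (hα0 : 0 < α) (hα2 : α < 2)
    (hκ₀ : 0 < κ₀) (hκ₁ : 0 ≤ κ₁) :
    ∃ C, 0 < C ∧ ∀ k : 𝓔 d → ℝ, IsStableDensity α κ₀ κ₁ k →
      (∀ x, Integrable (fun z => |secondDiff (stableKernel k 1) x z| * jumpWeight α z) ∧
        ∫ z, |secondDiff (stableKernel k 1) x z| * jumpWeight α z ≤ C * decay α x) ∧
      (∀ x x', Integrable (fun z => |secondDiff (stableKernel k 1) x z -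
          secondDiff (stableKernel k 1) x' z| * jumpWeight α z) ∧
        ∫ z, |secondDiff (stableKernel k 1) x z -
          secondDiff (stableKernel k 1) x' z| * jumpWeight α z ≤
            C * min ‖x - x'‖ 1 * (decay α x + decay α x')) := by
  obtain ⟨C₀, hC₀, h₀⟩ := exists_norm_invFT_diffSymbol_le d hα0 hα2 hκ₀ hκ₁ 0
  obtain ⟨C₁, hC₁, h₁⟩ := exists_norm_invFT_diffSymbol_le d hα0 hα2 hκ₀ hκ₁ 1
  obtain ⟨C₂, hC₂, h₂⟩ := exists_norm_invFT_diffSymbol_le d hα0 hα2 hκ₀ hκ₁ 2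
  obtain ⟨C₃, hC₃, h₃⟩ := exists_norm_invFT_diffSymbol_le d hα0 hα2 hκ₀ hκ₁ 3
  have hD := diffConst_nonneg (d := d) α
  have h2 : (0 : ℝ) < 2 ^ (d + α) := by positivity
  set M := C₀ + C₁ + 2 ^ (d + α) * (C₂ + C₃) with hM
  have hM0 : 0 ≤ M := by positivity
  have hMC₀ : C₀ ≤ M := by rw [hM]; linarith [mul_nonneg h2.le (add_nonneg hC₂ hC₃)]
  have hMC₁ : C₁ ≤ M := by rw [hM]; linarith [mul_nonneg h2.le (add_nonneg hC₂ hC₃)]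
  have hMC₂ : 2 ^ (d + α) * C₂ ≤ M := by rw [hM]; linarith [mul_nonneg h2.le hC₃]
  have hMC₃ : 2 ^ (d + α) * C₃ ≤ M := by rw [hM]; linarith [mul_nonneg h2.le hC₂]
  refine ⟨M * diffConst d α + 1, by positivity, fun k hk => ?_⟩
  set m : 𝓔 d → ℂ := fun w => Real.exp (-(1 * symbol k w)) with hm
  have hmi : Integrable m := hk.integrable_exp hα0 hα2 hκ₀ one_pos
  set g := stableKernel k 1 with hg
  have hgc : Continuous g := Complex.continuous_re.comp (continuous_invFT hmi)
  have hgle : ∀ x, |g x| ≤ M * decay α x := by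
    intro x
    rw [hg, stableKernel_one k 0]
    have := h₀ k hk ∅ rfl 0 (by simp) x
    simp only [Finset.prod_empty, mul_one] at this
    refine (Complex.abs_re_le_norm _).trans (this.trans ?_)
    have := decay_pos α x
    gcongr
  have hshift : ∀ (x z : 𝓔 d), ‖z‖ ≤ 1 → decay α (x - z) ≤ 2 ^ (d + α) * decay α x := by
    intro x z hz
    rw [sub_eq_add_neg]
    exact decay_add_le hα0 x (by simpa using hz)
  have hgδ : ∀ x z, ‖z‖ ≤ 1 → |secondDiff g x z| ≤ M * ‖z‖ ^ 2 * decay α x := by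
    intro x z hz
    have h := h₂ k hk {0, 1} rfl (fun _ => z) (fun _ _ => hz) (x - z)
    have he : (fun w => (wave w z - 1) * ((wave w z - 1) * m w)) =
        diffSymbol k {0, 1} (fun _ => z) := by
      ext w; simp [diffSymbol, diffProd, hm, mul_assoc, pow_two]
    rw [hg, show stableKernel k 1 = fun y => (invFT m y).re from rfl,
      secondDiff_re_invFT hmi, he]
    refine (Complex.abs_re_le_norm _).trans (h.trans ?_)
    have := decay_pos α x
    rw [Finset.prod_const, show Finset.card {0, 1} = 2 from rfl]
    calc _ ≤ C₂ * ‖z‖ ^ 2 * (2 ^ (d + α) * decay α x) := by gcongr; exact hshift x z hz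
      _ = 2 ^ (d + α) * C₂ * ‖z‖ ^ 2 * decay α x := by ring
      _ ≤ _ := by gcongr
  have hone := integral_abs_secondDiff_le hα0 hα2 hgc hgle hgδ
  have hCle : M * diffConst d α ≤ M * diffConst d α + 1 := by linarith
  refine ⟨fun x => ⟨(hone x).1, (hone x).2.trans ?_⟩, fun x x' => ?_⟩
  · have := decay_pos α x; gcongr
  have hx := decay_pos α x
  have hx' := decay_pos α x'
  rcases le_total ‖x - x'‖ 1 with hh | hh
  · set h := x - x' with hh_def
    set mh : 𝓔 d → ℂ := fun w => (wave w h - 1) * m w with hmh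
    have hmhi : Integrable mh := integrable_wave_sub_one_mul hmi h
    have hfg : ∀ y, (invFT mh y).re = g (y + h) - g y := by
      intro y
      rw [hmh, ← invFT_add_sub hmi, Complex.sub_re]
      rfl
    have hfc : Continuous fun y => (invFT mh y).re :=
      Complex.continuous_re.comp (continuous_invFT hmhi)
    have hfle : ∀ y, |(invFT mh y).re| ≤ M * ‖h‖ * decay α y := by
      intro y
      have hb := h₁ k hk {0} rfl (fun _ => h) (fun _ _ => hh) y
      have he : mh = diffSymbol k {0} (fun _ => h) := by
        ext w; simp [diffSymbol, diffProd, hm, hmh]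
      rw [he]
      refine (Complex.abs_re_le_norm _).trans (hb.trans ?_)
      have := decay_pos α y
      rw [Finset.prod_singleton]
      gcongr
    have hfδ : ∀ y z, ‖z‖ ≤ 1 →
        |secondDiff (fun y => (invFT mh y).re) y z| ≤ M * ‖h‖ * ‖z‖ ^ 2 * decay α y := by
      intro y z hz
      have hb := h₃ k hk {0, 1, 2} rfl (fun i => if i = 2 then h else z)
        (fun i _ => by split_ifs <;> assumption) (y - z)
      have he : (fun w => (wave w z - 1) * ((wave w z - 1) * mh w)) =
          diffSymbol k {0, 1, 2} (fun i => if i = 2 then h else z) := by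
        ext w; simp [diffSymbol, diffProd, hm, hmh, mul_assoc]
      rw [secondDiff_re_invFT hmhi, he]
      refine (Complex.abs_re_le_norm _).trans (hb.trans ?_)
      have := decay_pos α y
      have hp : ∏ i ∈ ({0, 1, 2} : Finset ℕ), ‖(if i = 2 then h else z)‖ = ‖h‖ * ‖z‖ ^ 2 := by
        simp; ring
      rw [hp]
      calc _ ≤ C₃ * (‖h‖ * ‖z‖ ^ 2) * (2 ^ (d + α) * decay α y) := by gcongr; exact hshift y z hz
        _ = 2 ^ (d + α) * C₃ * ‖h‖ * ‖z‖ ^ 2 * decay α y := by ring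
        _ ≤ _ := by gcongr
    have hres := integral_abs_secondDiff_le hα0 hα2 hfc hfle hfδ x'
    have heq : ∀ z, secondDiff (fun y => (invFT mh y).re) x' z =
        secondDiff g x z - secondDiff g x' z := by
      intro z
      have hxx : x = x' + h := by rw [hh_def]; abel
      simp only [secondDiff, hfg]
      rw [hxx, add_right_comm x' h z, add_sub_right_comm x' h z]
      ring
    simp only [heq] at hres
    refine ⟨hres.1, hres.2.trans ?_⟩
    rw [min_eq_left hh]
    calc M * ‖h‖ * diffConst d α * decay α x' = M * diffConst d α * ‖h‖ * (0 + decay α x') := by ring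
      _ ≤ _ := by gcongr
  · have hle : ∀ z, |secondDiff g x z - secondDiff g x' z| * jumpWeight α z ≤
        |secondDiff g x z| * jumpWeight α z + |secondDiff g x' z| * jumpWeight α z := by
      intro z
      rw [← add_mul]
      exact mul_le_mul_of_nonneg_right (abs_sub _ _) (jumpWeight_nonneg α z)
    have hint : Integrable fun z => |secondDiff g x z - secondDiff g x' z| * jumpWeight α z := by
      refine ((hone x).1.add (hone x').1).mono' ?_ (ae_of_all _ fun z => ?_)
      · have : Continuous fun z => |secondDiff g x z - secondDiff g x' z| := by
          unfold secondDiff; fun_prop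
        exact (this.measurable.mul (measurable_jumpWeight α)).aestronglyMeasurable
      · rw [Real.norm_of_nonneg (mul_nonneg (abs_nonneg _) (jumpWeight_nonneg α z))]
        exact hle z
    refine ⟨hint, (integral_mono hint ((hone x).1.add (hone x').1) hle).trans ?_⟩
    rw [min_eq_right hh, mul_one, mul_add]
    refine (integral_add (hone x).1 (hone x').1).le.trans (add_le_add ?_ ?_)
    · refine (hone x).2.trans ?_; gcongr
    · refine (hone x').2.trans ?_; gcongr

/-! ### Scaling -/

/-- The jump density `s^(d+α) k(s z)`, the image of `k` under the stable scaling. -/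
def rescale (α s : ℝ) (k : 𝓔 d → ℝ) (z : 𝓔 d) : ℝ := s ^ (d + α) * k (s • z)

theorem jumpWeight_smul (α : ℝ) {s : ℝ} (hs : 0 < s) (z : 𝓔 d) :
    jumpWeight α (s • z) = s ^ (-(d : ℝ) - α) * jumpWeight α z := by
  rw [jumpWeight, jumpWeight, norm_smul, Real.norm_of_nonneg hs.le,
    Real.mul_rpow hs.le (norm_nonneg z)]

theorem rpow_mul_jumpWeight_smul (α : ℝ) {s : ℝ} (hs : 0 < s) (z : 𝓔 d) :
    s ^ (d + α) * jumpWeight α (s • z) = jumpWeight α z := by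
  rw [jumpWeight_smul α hs, ← mul_assoc, neg_sub_eq, ← Real.rpow_add hs, add_neg_cancel,
    Real.rpow_zero, one_mul]

theorem IsStableDensity.rescale {α κ₀ κ₁ : ℝ} {k : 𝓔 d → ℝ} (hk : IsStableDensity α κ₀ κ₁ k)
    {s : ℝ} (hs : 0 < s) : IsStableDensity α κ₀ κ₁ (rescale α s k) where
  measurable := (hk.measurable.comp (measurable_const_smul s)).const_mul _
  even z := by rw [StableKernel.rescale, smul_neg, hk.even]; rfl
  nonneg z := mul_nonneg (by positivity) (hk.nonneg _)
  le z := by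
    rw [← rpow_mul_jumpWeight_smul α hs z, mul_left_comm]
    exact mul_le_mul_of_nonneg_left (hk.le _) (by positivity)
  low z := by
    rw [← rpow_mul_jumpWeight_smul α hs z, mul_left_comm]
    exact mul_le_mul_of_nonneg_left (hk.low _) (by positivity)

theorem symbol_rescale {α s : ℝ} (hs : 0 < s) (k : 𝓔 d → ℝ) (w : 𝓔 d) :
    symbol (rescale α s k) (s • w) = s ^ α * symbol k w := by
  have h := Measure.integral_comp_smul_of_nonneg (volume : Measure (𝓔 d))
    (fun z => (1 - Real.cos (2 * Real.pi * inner ℝ w z)) * k z) s (hR := hs.le)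
  simp only [finrank_euclideanSpace, Fintype.card_fin, smul_eq_mul] at h
  have h2 : symbol (rescale α s k) (s • w) =
      s ^ (d + α) * ∫ z, (1 - Real.cos (2 * Real.pi * inner ℝ w (s • z))) * k (s • z) := by
    rw [symbol, ← integral_const_mul]
    congr 1; ext z
    rw [rescale, inner_smul_left, inner_smul_right, conj_trivial]
    ring
  rw [h2, h, ← mul_assoc, ← symbol, Real.rpow_add hs, Real.rpow_natCast]
  field_simp

theorem stableKernel_eq_rescale {α : ℝ} (hα : 0 < α) (k : 𝓔 d → ℝ) {t : ℝ} (ht : 0 < t) (x : 𝓔 d) :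
    stableKernel k t x = ((t ^ (1 / α)) ^ d)⁻¹ *
      stableKernel (rescale α (t ^ (1 / α)) k) 1 ((t ^ (1 / α))⁻¹ • x) := by
  set s := t ^ (1 / α) with hs_def
  have hs : 0 < s := by positivity
  have hst : s ^ α = t := by
    rw [hs_def, ← Real.rpow_mul ht.le, one_div_mul_cancel hα.ne', Real.rpow_one]
  have h := Measure.integral_comp_smul_of_nonneg (volume : Measure (𝓔 d))
    (fun v => wave v (s⁻¹ • x) * (Real.exp (-(1 * symbol (rescale α s k) v)) : ℂ)) s (hR := hs.le)
  simp only [finrank_euclideanSpace, Fintype.card_fin, symbol_rescale hs, hst, one_mul] at h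
  have h2 : ∀ w : 𝓔 d, wave (s • w) (s⁻¹ • x) = wave w x := by
    intro w
    rw [wave, wave, inner_smul_left, inner_smul_right, conj_trivial, mul_inv_cancel_left₀ hs.ne']
  simp only [h2] at h
  rw [stableKernel, invFT, h, Complex.real_smul, Complex.re_ofReal_mul, stableKernel, invFT]
  simp only [one_mul]

theorem varrho_eq {α : ℝ} {t : ℝ} (ht : 0 < t) (x : 𝓔 d) :
    varrho α 0 0 t x =
      (t ^ (1 / α)) ^ (-(d : ℝ) - α) * decay α ((t ^ (1 / α))⁻¹ • x) := by
  have hs : 0 < t ^ (1 / α) := by positivity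
  rw [varrho, decay, norm_smul, Real.norm_of_nonneg (by positivity),
    ← Real.mul_rpow hs.le (by positivity), mul_add, mul_one, mul_inv_cancel_left₀ hs.ne']
  simp

theorem integral_scaled {α s : ℝ} (hs : 0 < s) (F : 𝓔 d → ℝ) :
    (Integrable (fun z => F z * jumpWeight α z) →
      Integrable fun z => (s ^ d)⁻¹ * F (s⁻¹ • z) * jumpWeight α z) ∧
    ∫ z, (s ^ d)⁻¹ * F (s⁻¹ • z) * jumpWeight α z =
      s ^ (-(d : ℝ) - α) * ∫ z, F z * jumpWeight α z := by
  have heq : (fun z => (s ^ d)⁻¹ * F (s⁻¹ • z) * jumpWeight α z) = fun z =>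
      ((s ^ d)⁻¹ * s ^ (-(d : ℝ) - α)) * (fun y => F y * jumpWeight α y) (s⁻¹ • z) := by
    ext z
    have hz : jumpWeight α z = s ^ (-(d : ℝ) - α) * jumpWeight α (s⁻¹ • z) := by
      rw [← jumpWeight_smul α hs, smul_inv_smul₀ hs.ne']
    rw [hz]; ring
  rw [heq]
  refine ⟨fun h => (h.comp_smul (inv_ne_zero hs.ne')).const_mul _, ?_⟩
  rw [integral_const_mul, Measure.integral_comp_inv_smul_of_nonneg volume
    (fun y => F y * jumpWeight α y) hs.le]
  simp only [finrank_euclideanSpace, Fintype.card_fin, smul_eq_mul]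
  field_simp

theorem secondDiff_stableKernel {α : ℝ} (hα : 0 < α) (k : 𝓔 d → ℝ) {t : ℝ} (ht : 0 < t)
    (x z : 𝓔 d) : secondDiff (stableKernel k t) x z = ((t ^ (1 / α)) ^ d)⁻¹ *
      secondDiff (stableKernel (rescale α (t ^ (1 / α)) k) 1) ((t ^ (1 / α))⁻¹ • x)
        ((t ^ (1 / α))⁻¹ • z) := by
  simp only [secondDiff, stableKernel_eq_rescale hα k ht, smul_add, smul_sub]
  ring

/-- The two integral estimates at all positive times, by scaling to time one. -/
theorem exists_secondDiff_stableKernel_le (d : ℕ) {α κ₀ κ₁ : ℝ} (hα0 : 0 < α) (hα2 : α < 2)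
    (hκ₀ : 0 < κ₀) (hκ₁ : 0 ≤ κ₁) :
    ∃ C, 0 < C ∧ ∀ k : 𝓔 d → ℝ, IsStableDensity α κ₀ κ₁ k → ∀ t, 0 < t →
      (∀ x, Integrable (fun z => |secondDiff (stableKernel k t) x z| * jumpWeight α z) ∧
        ∫ z, |secondDiff (stableKernel k t) x z| * jumpWeight α z ≤ C * varrho α 0 0 t x) ∧
      (∀ x x', Integrable (fun z => |secondDiff (stableKernel k t) x z -
          secondDiff (stableKernel k t) x' z| * jumpWeight α z) ∧
        ∫ z, |secondDiff (stableKernel k t) x z -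
          secondDiff (stableKernel k t) x' z| * jumpWeight α z ≤
            C * min (t ^ (-1 / α) * ‖x - x'‖) 1 * (varrho α 0 0 t x + varrho α 0 0 t x')) := by
  obtain ⟨C, hC, h⟩ := exists_secondDiff_stableKernel_one_le d hα0 hα2 hκ₀ hκ₁
  refine ⟨C, hC, fun k hk t ht => ?_⟩
  have hs : 0 < t ^ (1 / α) := by positivity
  have hinv : t ^ (-1 / α) = (t ^ (1 / α))⁻¹ := by
    rw [← Real.rpow_neg ht.le, neg_div]
  obtain ⟨h1, h2⟩ := h _ (hk.rescale hs)
  have hc : 0 < ((t ^ (1 / α)) ^ d)⁻¹ := by positivity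
  have hp : 0 < (t ^ (1 / α)) ^ (-(d : ℝ) - α) := by positivity
  simp only [secondDiff_stableKernel hα0 k ht, ← mul_sub, abs_mul, abs_of_pos hc, varrho_eq ht,
    hinv]
  refine ⟨fun x => ?_, fun x x' => ?_⟩
  · obtain ⟨hi, hle⟩ := h1 ((t ^ (1 / α))⁻¹ • x)
    obtain ⟨e1, e2⟩ := integral_scaled (α := α) hs
      (fun z => |secondDiff (stableKernel (rescale α (t ^ (1 / α)) k) 1) ((t ^ (1 / α))⁻¹ • x) z|)
    refine ⟨e1 hi, e2.le.trans ?_⟩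
    exact (mul_le_mul_of_nonneg_left hle hp.le).trans_eq (by ring)
  · obtain ⟨hi, hle⟩ := h2 ((t ^ (1 / α))⁻¹ • x) ((t ^ (1 / α))⁻¹ • x')
    obtain ⟨e1, e2⟩ := integral_scaled (α := α) hs
      (fun z => |secondDiff (stableKernel (rescale α (t ^ (1 / α)) k) 1) ((t ^ (1 / α))⁻¹ • x) z -
        secondDiff (stableKernel (rescale α (t ^ (1 / α)) k) 1) ((t ^ (1 / α))⁻¹ • x') z|)
    refine ⟨e1 hi, e2.le.trans ?_⟩
    rw [← smul_sub, norm_smul, Real.norm_of_nonneg (inv_pos.2 hs).le] at hle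
    exact (mul_le_mul_of_nonneg_left hle hp.le).trans_eq (by ring)

/-! ### Positivity and total mass -/

theorem wave_neg_left (w x : 𝓔 d) : wave (-w) x = (starRingEnd ℂ) (wave w x) := by
  rw [wave, wave, ← Complex.exp_conj, inner_neg_left, map_mul, Complex.conj_I, Complex.conj_ofReal]
  congr 1; push_cast; ring

theorem ofReal_re_invFT {r : 𝓔 d → ℝ} (hr : ∀ w, r (-w) = r w) (x : 𝓔 d) :
    ((invFT (fun w => (r w : ℂ)) x).re : ℂ) = invFT (fun w => (r w : ℂ)) x := by
  rw [← Complex.conj_eq_iff_re, invFT, ← integral_conj,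
    ← integral_neg_eq_self (fun w => wave w x * (r w : ℂ)) volume]
  congr 1; ext w
  rw [map_mul, Complex.conj_ofReal, ← wave_neg_left, hr]

theorem invFT_eq_fourier {m : 𝓔 d → ℂ} (hm : ∀ w, m (-w) = m w) :
    invFT m = FourierTransform.fourier m := by
  rw [invFT_eq_fourierInv, Real.fourierInv_eq_fourier_comp_neg]
  simp only [hm]

theorem tendsto_invFT {ι : Type*} {l : Filter ι} [l.IsCountablyGenerated] {F : ι → 𝓔 d → ℂ}
    {f : 𝓔 d → ℂ} {g : 𝓔 d → ℝ} (hF : ∀ᶠ n in l, AEStronglyMeasurable (F n))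
    (hg : Integrable g) (hb : ∀ᶠ n in l, ∀ w, ‖F n w‖ ≤ g w)
    (hlim : ∀ w, Tendsto (fun n => F n w) l (𝓝 (f w))) (x : 𝓔 d) :
    Tendsto (fun n => invFT (F n) x) l (𝓝 (invFT f x)) := by
  refine tendsto_integral_filter_of_dominated_convergence g ?_ ?_ hg (ae_of_all _ fun w => ?_)
  · filter_upwards [hF] with n hn
    exact (continuous_wave_left x).aestronglyMeasurable.mul hn
  · filter_upwards [hb] with n hn
    refine ae_of_all _ fun w => ?_
    rw [norm_mul, norm_wave, one_mul]; exact hn w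
  · exact (hlim w).const_mul _

theorem re_invFT_gaussian_nonneg {b : ℝ} (hb : 0 < b) (x : 𝓔 d) :
    0 ≤ (invFT (fun w => (Real.exp (-(b * ‖w‖ ^ 2)) : ℂ)) x).re := by
  have h := fourier_gaussian_innerProductSpace (b := (b : ℂ)) (by simpa using hb) x
  have h1 : (fun w : 𝓔 d => (Real.exp (-(b * ‖w‖ ^ 2)) : ℂ)) =
      fun w => Complex.exp (-b * ‖w‖ ^ 2) := by
    ext w; push_cast; ring_nf
  have h2 : (Real.pi / b : ℂ) ^ (Module.finrank ℝ (𝓔 d) / 2 : ℂ) *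
      Complex.exp (-Real.pi ^ 2 * ‖x‖ ^ 2 / b) =
      ((Real.pi / b) ^ (Module.finrank ℝ (𝓔 d) / 2 : ℝ) *
        Real.exp (-Real.pi ^ 2 * ‖x‖ ^ 2 / b) : ℝ) := by
    push_cast [Complex.ofReal_cpow (by positivity : 0 ≤ Real.pi / b)]
    rfl
  rw [invFT_eq_fourier (by simp), h1, h, h2, Complex.ofReal_re]
  positivity

/-- The jumps of length more than `1 / (n + 1)`. -/
def truncate (k : 𝓔 d → ℝ) (n : ℕ) : 𝓔 d → ℝ :=
  (Metric.closedBall 0 (1 / ((n : ℝ) + 1)))ᶜ.indicator k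

theorem IsJumpDensity.truncate {α Λ : ℝ} {k : 𝓔 d → ℝ} (hk : IsJumpDensity α Λ k) (n : ℕ) :
    IsJumpDensity α Λ (truncate k n) :=
  hk.indicator Metric.isClosed_closedBall.measurableSet.compl (by simp)

theorem IsJumpDensity.integrable_truncate {α Λ : ℝ} {k : 𝓔 d → ℝ} (hk : IsJumpDensity α Λ k)
    (hα0 : 0 < α) (hα2 : α < 2) (n : ℕ) : Integrable (StableKernel.truncate k n) := by
  refine ((hk.integrable_min_mul hα0 hα2).const_mul (((n : ℝ) + 1) ^ 2)).mono'
    (hk.truncate n).measurable.aestronglyMeasurable (ae_of_all _ fun z => ?_)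
  have h0 := hk.nonneg z
  rw [Real.norm_of_nonneg ((hk.truncate n).nonneg z)]
  unfold StableKernel.truncate
  by_cases hz : z ∈ (Metric.closedBall (0 : 𝓔 d) (1 / ((n : ℝ) + 1)))ᶜ
  · rw [Set.indicator_of_mem hz]
    have hz1 : 1 / ((n : ℝ) + 1) < ‖z‖ := by simpa using hz
    rw [div_lt_iff₀ (by positivity)] at hz1
    have h1 : 1 ≤ ((n : ℝ) + 1) ^ 2 * min 1 (‖z‖ ^ 2) := by
      rw [mul_min_of_nonneg _ _ (by positivity), le_min_iff]
      constructor
      · nlinarith [(n.cast_nonneg : (0 : ℝ) ≤ n)]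
      · nlinarith
    calc k z = 1 * k z := (one_mul _).symm
      _ ≤ (((n : ℝ) + 1) ^ 2 * min 1 (‖z‖ ^ 2)) * k z := by gcongr
      _ = _ := by ring
  · rw [Set.indicator_of_notMem hz]; positivity

theorem IsJumpDensity.tendsto_symbol_truncate {α Λ : ℝ} {k : 𝓔 d → ℝ} (hk : IsJumpDensity α Λ k)
    (hα0 : 0 < α) (hα2 : α < 2) (w : 𝓔 d) :
    Tendsto (fun n => symbol (StableKernel.truncate k n) w) atTop (𝓝 (symbol k w)) := by
  refine tendsto_integral_of_dominated_convergence
    (fun z => (1 - Real.cos (2 * Real.pi * inner ℝ w z)) * k z)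
    (fun n => ((hk.truncate n).measurable_integrand w).aestronglyMeasurable)
    (hk.integrable_integrand hα0 hα2 w) (fun n => ae_of_all _ fun z => ?_)
    (ae_of_all _ fun z => ?_)
  · rw [Real.norm_of_nonneg ((hk.truncate n).integrand_nonneg w z)]
    refine mul_le_mul_of_nonneg_left ?_ (one_sub_cos_nonneg _)
    exact Set.indicator_le_self' (fun z _ => hk.nonneg z) z
  · rcases eq_or_ne z 0 with rfl | hz
    · simp
    · refine tendsto_const_nhds.congr' ?_
      have hz0 : 0 < ‖z‖ := norm_pos_iff.2 hz
      filter_upwards [tendsto_one_div_add_atTop_nhds_zero_nat.eventually_lt_const hz0] with n hn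
      rw [StableKernel.truncate, Set.indicator_of_mem (by simpa using hn)]

theorem integrable_gaussian {b : ℝ} (hb : 0 < b) :
    Integrable fun w : 𝓔 d => Real.exp (-(b * ‖w‖ ^ 2)) := by
  have := integrable_pow_mul_exp_neg (d := d) (α := 2) two_pos hb 0
  simpa using this

theorem IsStableDensity.stableKernel_one_nonneg {α κ₀ κ₁ : ℝ} {k : 𝓔 d → ℝ}
    (hk : IsStableDensity α κ₀ κ₁ k) (hα0 : 0 < α) (hα2 : α < 2) (hκ₀ : 0 < κ₀) (x : 𝓔 d) :
    0 ≤ stableKernel k 1 x := by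
  have hc := hk.continuous_symbol hα0 hα2
  -- removing the truncation at fixed Gaussian regularization
  have hreg : ∀ b : ℝ, 0 < b → 0 ≤ (invFT (fun w =>
      (Real.exp (-symbol k w) : ℂ) * Real.exp (-(b * ‖w‖ ^ 2))) x).re := by
    intro b hb
    have hgi := integrable_gaussian (d := d) hb
    have hlim := tendsto_invFT (l := atTop) (f := fun w =>
      (Real.exp (-symbol k w) : ℂ) * Real.exp (-(b * ‖w‖ ^ 2))) (F := fun (n : ℕ) w =>
      (Real.exp (-symbol (truncate k n) w) : ℂ) * Real.exp (-(b * ‖w‖ ^ 2)))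
      (Eventually.of_forall fun n => ?_) hgi (Eventually.of_forall fun n w => ?_) (fun w => ?_) x
    · refine ge_of_tendsto ((Complex.continuous_re.tendsto _).comp hlim)
        (Eventually.of_forall fun n => ?_)
      exact re_invFT_exp_neg_symbol_nonneg (hk.integrable_truncate hα0 hα2 n)
        (hk.truncate n).nonneg (hk.truncate n).even hgi.ofReal (re_invFT_gaussian_nonneg hb) x
    · have := (hk.truncate n).continuous_symbol hα0 hα2
      exact Continuous.aestronglyMeasurable (by fun_prop)
    · rw [norm_mul, Complex.norm_real, Complex.norm_real, Real.norm_of_nonneg (Real.exp_pos _).le,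
        Real.norm_of_nonneg (Real.exp_pos _).le]
      refine mul_le_of_le_one_left (Real.exp_pos _).le ?_
      rw [Real.exp_le_one_iff, neg_nonpos]
      exact (hk.truncate n).symbol_nonneg w
    · refine Tendsto.mul_const _ ((Complex.continuous_ofReal.tendsto _).comp ?_)
      exact (Real.continuous_exp.tendsto _).comp (hk.tendsto_symbol_truncate hα0 hα2 w).neg
  have hlim := tendsto_invFT (l := 𝓝[>] (0 : ℝ)) (f := fun w =>
    (Real.exp (-(1 * symbol k w)) : ℂ)) (F := fun (b : ℝ) w =>
    (Real.exp (-symbol k w) : ℂ) * Real.exp (-(b * ‖w‖ ^ 2)))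
    (Eventually.of_forall fun b => Continuous.aestronglyMeasurable (by fun_prop))
    (hk.integrable_exp hα0 hα2 hκ₀ one_pos).norm
    (by
      filter_upwards [self_mem_nhdsWithin] with b hb w
      rw [norm_mul, one_mul]
      refine mul_le_of_le_one_right (norm_nonneg _) ?_
      rw [Complex.norm_real, Real.norm_of_nonneg (Real.exp_pos _).le, Real.exp_le_one_iff,
        neg_nonpos]
      exact mul_nonneg (le_of_lt hb) (sq_nonneg _)) (fun w => by
      have : Continuous fun b : ℝ =>
        (Real.exp (-symbol k w) : ℂ) * Real.exp (-(b * ‖w‖ ^ 2)) := by fun_prop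
      have h := (this.tendsto 0).mono_left (nhdsWithin_le_nhds (s := Set.Ioi 0))
      simpa using h) x
  refine ge_of_tendsto ((Complex.continuous_re.tendsto _).comp hlim) ?_
  filter_upwards [self_mem_nhdsWithin] with b hb
  exact hreg b hb

theorem IsStableDensity.stableKernel_nonneg {α κ₀ κ₁ : ℝ} {k : 𝓔 d → ℝ}
    (hk : IsStableDensity α κ₀ κ₁ k) (hα0 : 0 < α) (hα2 : α < 2) (hκ₀ : 0 < κ₀) {t : ℝ}
    (ht : 0 < t) (x : 𝓔 d) : 0 ≤ stableKernel k t x := by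
  rw [stableKernel_eq_rescale hα0 k ht]
  exact mul_nonneg (by positivity)
    ((hk.rescale (by positivity)).stableKernel_one_nonneg hα0 hα2 hκ₀ _)

theorem ofReal_stableKernel (k : 𝓔 d → ℝ) (t : ℝ) (x : 𝓔 d) :
    (stableKernel k t x : ℂ) = invFT (fun w => (Real.exp (-(t * symbol k w)) : ℂ)) x :=
  ofReal_re_invFT (fun w => by rw [symbol_neg]) x

theorem IsStableDensity.continuous_stableKernel {α κ₀ κ₁ : ℝ} {k : 𝓔 d → ℝ}
    (hk : IsStableDensity α κ₀ κ₁ k) (hα0 : 0 < α) (hα2 : α < 2) (hκ₀ : 0 < κ₀) {t : ℝ}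
    (ht : 0 < t) : Continuous (stableKernel k t) :=
  Complex.continuous_re.comp (continuous_invFT (hk.integrable_exp hα0 hα2 hκ₀ ht))

theorem IsStableDensity.integrable_stableKernel {α κ₀ κ₁ : ℝ} {k : 𝓔 d → ℝ}
    (hk : IsStableDensity α κ₀ κ₁ k) (hα0 : 0 < α) (hα2 : α < 2) (hκ₀ : 0 < κ₀) (hκ₁ : 0 ≤ κ₁)
    {t : ℝ} (ht : 0 < t) : Integrable (stableKernel k t) := by
  obtain ⟨C, -, hb⟩ := exists_stableKernel_one_le d hα0 hα2 hκ₀ hκ₁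
  have hs : 0 < t ^ (1 / α) := by positivity
  have hone : Integrable (stableKernel (StableKernel.rescale α (t ^ (1 / α)) k) 1) :=
    ((integrable_decay hα0).const_mul C).mono'
      ((hk.rescale hs).continuous_stableKernel hα0 hα2 hκ₀ one_pos).aestronglyMeasurable
      (ae_of_all _ (hb _ (hk.rescale hs)))
  have := (hone.comp_smul (inv_ne_zero hs.ne')).const_mul ((t ^ (1 / α)) ^ d)⁻¹
  simpa only [← stableKernel_eq_rescale hα0 k ht] using this

theorem IsStableDensity.integral_stableKernel {α κ₀ κ₁ : ℝ} {k : 𝓔 d → ℝ}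
    (hk : IsStableDensity α κ₀ κ₁ k) (hα0 : 0 < α) (hα2 : α < 2) (hκ₀ : 0 < κ₀) (hκ₁ : 0 ≤ κ₁)
    {t : ℝ} (ht : 0 < t) : ∫ x, stableKernel k t x = 1 := by
  set m : 𝓔 d → ℂ := fun w => (Real.exp (-(t * symbol k w)) : ℂ) with hm
  have hsc := hk.continuous_symbol hα0 hα2
  have hmc : Continuous m := by fun_prop
  have heven : ∀ w, m (-w) = m w := fun w => by simp only [hm, symbol_neg]
  have hfun : (fun x => (stableKernel k t x : ℂ)) = FourierTransformInv.fourierInv m := by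
    rw [← invFT_eq_fourierInv]; ext x; exact ofReal_stableKernel k t x
  have hFi : Integrable (FourierTransform.fourier m) := by
    rw [← invFT_eq_fourier heven, invFT_eq_fourierInv, ← hfun]
    exact (hk.integrable_stableKernel hα0 hα2 hκ₀ hκ₁ ht).ofReal
  have hinv := congrFun (hmc.fourier_fourierInv_eq (hk.integrable_exp hα0 hα2 hκ₀ ht) hFi) 0
  rw [← hfun, Real.fourier_eq'] at hinv
  have hm0 : m 0 = 1 := by simp [hm, symbol]
  rw [hm0] at hinv
  simp only [inner_zero_right, mul_zero, Complex.ofReal_zero, zero_mul, Complex.exp_zero,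
    one_smul, integral_complex_ofReal] at hinv
  exact_mod_cast hinv

/-! ### Smoothness and the heat equation -/

theorem contDiff_re_fourier {f : 𝓔 d → ℂ} (hf : ∀ n : ℕ, Integrable fun v => ‖v‖ ^ n * ‖f v‖) :
    ContDiff ℝ ∞ fun x => (FourierTransform.fourier f x).re :=
  Complex.reCLM.contDiff.comp (Real.contDiff_fourier (N := ⊤) fun n _ => hf n)

theorem norm_iteratedFDeriv_re_fourier_le {f : 𝓔 d → ℂ} (hfm : AEStronglyMeasurable f)
    (hf : ∀ n : ℕ, Integrable fun v => ‖v‖ ^ n * ‖f v‖) (n : ℕ) (x : 𝓔 d) :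
    ‖iteratedFDeriv ℝ n (fun x => (FourierTransform.fourier f x).re) x‖ ≤
      ∫ v, (2 * Real.pi) ^ n * (‖v‖ ^ n * ‖f v‖) := by
  have hc : ContDiff ℝ (⊤ : ℕ∞) (FourierTransform.fourier f) :=
    Real.contDiff_fourier (N := ⊤) fun n _ => hf n
  have h1 := Complex.reCLM.norm_iteratedFDeriv_comp_left (x := x) (n := n)
    (hc.contDiffAt) (by exact_mod_cast le_top)
  rw [Complex.reCLM_norm, one_mul] at h1
  refine h1.trans ?_
  rw [Real.iteratedFDeriv_fourier (N := ⊤) (fun n _ => hf n) hfm (by exact_mod_cast le_top)]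
  refine (VectorFourier.norm_fourierIntegral_le_integral_norm _ _ _ _ _).trans ?_
  refine integral_mono_of_nonneg (ae_of_all _ fun v => norm_nonneg _) ((hf n).const_mul _)
    (ae_of_all _ fun v => ?_)
  refine (VectorFourier.norm_fourierPowSMulRight_le _ _ _ _).trans ?_
  have h2 : ‖(innerSL ℝ : 𝓔 d →L[ℝ] 𝓔 d →L[ℝ] ℝ)‖ ≤ 1 := norm_innerSL_le _
  rw [mul_assoc]
  exact mul_le_mul_of_nonneg_right (pow_le_pow_left₀ (by positivity)
    (mul_le_of_le_one_right (by positivity) h2) n) (by positivity)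

theorem stableKernel_eq_re_fourier (k : 𝓔 d → ℝ) (t : ℝ) : stableKernel k t = fun x =>
    (FourierTransform.fourier (fun w => (Real.exp (-(t * symbol k w)) : ℂ)) x).re := by
  ext x
  rw [stableKernel, invFT_eq_fourier]
  intro w; rw [symbol_neg]

namespace IsStableDensity
variable {α κ₀ κ₁ : ℝ} {k : 𝓔 d → ℝ}

theorem integrable_pow_mul_norm_exp (hk : IsStableDensity α κ₀ κ₁ k) (hα0 : 0 < α) (hα2 : α < 2)
    (hκ₀ : 0 < κ₀) {t : ℝ} (ht : 0 < t) (n : ℕ) :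
    Integrable fun w => ‖w‖ ^ n * ‖(Real.exp (-(t * symbol k w)) : ℂ)‖ := by
  simpa only [Complex.norm_real, Real.norm_of_nonneg (Real.exp_pos _).le] using
    hk.integrable_pow_mul_exp hα0 hα2 hκ₀ ht n

theorem contDiff_stableKernel (hk : IsStableDensity α κ₀ κ₁ k) (hα0 : 0 < α) (hα2 : α < 2)
    (hκ₀ : 0 < κ₀) {t : ℝ} (ht : 0 < t) : ContDiff ℝ ∞ (stableKernel k t) := by
  rw [stableKernel_eq_re_fourier]
  exact contDiff_re_fourier (hk.integrable_pow_mul_norm_exp hα0 hα2 hκ₀ ht)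

theorem exists_norm_iteratedFDeriv_stableKernel_le (hk : IsStableDensity α κ₀ κ₁ k)
    (hα0 : 0 < α) (hα2 : α < 2) (hκ₀ : 0 < κ₀) {t : ℝ} (ht : 0 < t) (n : ℕ) :
    ∃ M : ℝ, ∀ x, ‖iteratedFDeriv ℝ n (stableKernel k t) x‖ ≤ M := by
  rw [stableKernel_eq_re_fourier]
  exact ⟨_, norm_iteratedFDeriv_re_fourier_le (hk.integrable_exp hα0 hα2 hκ₀ ht).1
    (hk.integrable_pow_mul_norm_exp hα0 hα2 hκ₀ ht) n⟩

theorem exp_neg_mul_symbol_le (hk : IsStableDensity α κ₀ κ₁ k) {s t : ℝ} (hst : s ≤ t) (w : 𝓔 d) :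
    Real.exp (-(t * symbol k w)) ≤ Real.exp (-(s * symbol k w)) := by
  rw [Real.exp_le_exp]
  have := mul_le_mul_of_nonneg_right hst (hk.symbol_nonneg w)
  linarith

theorem tendstoUniformly_iteratedFDeriv (hk : IsStableDensity α κ₀ κ₁ k) (hα0 : 0 < α)
    (hα2 : α < 2) (hκ₀ : 0 < κ₀) {t : ℝ} (ht : 0 < t) (n : ℕ) :
    TendstoUniformly (fun s => iteratedFDeriv ℝ n (stableKernel k s))
      (iteratedFDeriv ℝ n (stableKernel k t)) (𝓝 t) := by
  set m : ℝ → 𝓔 d → ℂ := fun s w => (Real.exp (-(s * symbol k w)) : ℂ) with hm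
  have hsc := hk.continuous_symbol hα0 hα2
  have hmc : ∀ s, Continuous (m s) := fun s => by fun_prop
  have ht2 : 0 < t / 2 := by positivity
  have hnb : ∀ s, t / 2 < s → ∀ w, ‖m s w - m t w‖ ≤ 2 * Real.exp (-(t / 2 * symbol k w)) := by
    intro s hs w
    refine (norm_sub_le _ _).trans ?_
    have h1 := hk.exp_neg_mul_symbol_le hs.le w
    have h2 := hk.exp_neg_mul_symbol_le (half_le_self ht.le) w
    simp only [hm, Complex.norm_real, Real.norm_of_nonneg (Real.exp_pos _).le]
    linarith
  have hdom : ∀ j : ℕ, Integrable fun w =>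
      2 * (‖w‖ ^ j * Real.exp (-(t / 2 * symbol k w))) := fun j =>
    (hk.integrable_pow_mul_exp hα0 hα2 hκ₀ ht2 j).const_mul 2
  have hbd : ∀ (j : ℕ) s, t / 2 < s → ∀ w, ‖‖w‖ ^ j * ‖m s w - m t w‖‖ ≤
      2 * (‖w‖ ^ j * Real.exp (-(t / 2 * symbol k w))) := by
    intro j s hs w
    rw [Real.norm_of_nonneg (by positivity)]
    exact (mul_le_mul_of_nonneg_left (hnb s hs w) (by positivity)).trans_eq (by ring)
  have hint : ∀ (j : ℕ) s, t / 2 < s → Integrable fun w => ‖w‖ ^ j * ‖m s w - m t w‖ := by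
    intro j s hs
    refine (hdom j).mono' ?_ (ae_of_all _ (hbd j s hs))
    have := hmc s
    have := hmc t
    exact Continuous.aestronglyMeasurable (by fun_prop)
  have hlim : Tendsto (fun s => ∫ w, (2 * Real.pi) ^ n * (‖w‖ ^ n * ‖m s w - m t w‖)) (𝓝 t)
      (𝓝 0) := by
    have h0 : (0 : ℝ) = ∫ w : 𝓔 d, (2 * Real.pi) ^ n * (‖w‖ ^ n * ‖m t w - m t w‖) := by simp
    rw [h0]
    refine tendsto_integral_filter_of_dominated_convergence
      (fun w => (2 * Real.pi) ^ n * (2 * (‖w‖ ^ n * Real.exp (-(t / 2 * symbol k w))))) ?_ ?_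
      ((hdom n).const_mul _) (ae_of_all _ fun w => ?_)
    · filter_upwards [lt_mem_nhds (half_lt_self ht)] with s hs
      exact ((hint n s hs).const_mul _).1
    · filter_upwards [lt_mem_nhds (half_lt_self ht)] with s hs
      refine ae_of_all _ fun w => ?_
      rw [norm_mul, Real.norm_of_nonneg (by positivity)]
      exact mul_le_mul_of_nonneg_left (hbd n s hs w) (by positivity)
    · have : Continuous fun s => (2 * Real.pi) ^ n * (‖w‖ ^ n * ‖m s w - m t w‖) := by fun_prop
      exact this.tendsto t
  rw [Metric.tendstoUniformly_iff]
  intro ε hε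
  filter_upwards [lt_mem_nhds (half_lt_self ht), hlim.eventually_lt_const hε] with s hs hsε x
  have hs0 : 0 < s := ht2.trans hs
  have hsub : stableKernel k s - stableKernel k t = fun x =>
      (FourierTransform.fourier (fun w => m s w - m t w) x).re := by
    have heven : ∀ w, m s (-w) - m t (-w) = m s w - m t w := fun w => by
      simp only [hm, symbol_neg]
    rw [← invFT_eq_fourier heven]
    ext x
    rw [invFT_sub (hk.integrable_exp hα0 hα2 hκ₀ hs0) (hk.integrable_exp hα0 hα2 hκ₀ ht)]
    rfl
  have hcs : ContDiff ℝ n (stableKernel k s) :=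
    (hk.contDiff_stableKernel hα0 hα2 hκ₀ hs0).of_le (by exact_mod_cast le_top)
  have hct : ContDiff ℝ n (stableKernel k t) :=
    (hk.contDiff_stableKernel hα0 hα2 hκ₀ ht).of_le (by exact_mod_cast le_top)
  rw [dist_comm, dist_eq_norm, ← iteratedFDeriv_sub_apply hcs.contDiffAt hct.contDiffAt, hsub]
  exact (norm_iteratedFDeriv_re_fourier_le ((hmc s).sub (hmc t)).aestronglyMeasurable
    (fun j => hint j s hs) n x).trans_lt hsε

theorem integrable_symbol_mul_exp (hk : IsStableDensity α κ₀ κ₁ k) (hα0 : 0 < α) (hα2 : α < 2)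
    (hκ₀ : 0 < κ₀) {t : ℝ} (ht : 0 < t) :
    Integrable fun w => symbol k w * Real.exp (-(t * symbol k w)) := by
  have hsc := hk.continuous_symbol hα0 hα2
  refine ((((hk.integrable_pow_mul_exp hα0 hα2 hκ₀ ht 0).const_mul 2).add
    ((hk.integrable_pow_mul_exp hα0 hα2 hκ₀ ht 2).const_mul (2 * Real.pi ^ 2))).const_mul
    (κ₁ * levyMass d α)).mono' (Continuous.aestronglyMeasurable (by fun_prop))
    (ae_of_all _ fun w => ?_)
  have h0 := hk.symbol_nonneg w
  rw [Real.norm_of_nonneg (by positivity)]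
  refine (mul_le_mul_of_nonneg_right (hk.symbol_le hα0 hα2 w) (Real.exp_pos _).le).trans_eq ?_
  simp only [Pi.add_apply]; ring

/-- In Fourier variables the operator multiplies by `-ψ`. -/
theorem stableLikeOp_stableKernel {κ : 𝓔 d → ℝ}
    (hk : IsStableDensity α κ₀ κ₁ fun z => κ z * jumpWeight α z) (hα0 : 0 < α) (hα2 : α < 2)
    (hκ₀ : 0 < κ₀) {t : ℝ} (ht : 0 < t) (x : 𝓔 d) :
    stableLikeOp α κ (stableKernel (fun z => κ z * jumpWeight α z) t) x =
      (invFT (fun w => -(symbol (fun z => κ z * jumpWeight α z) w : ℂ) *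
        Real.exp (-(t * symbol (fun z => κ z * jumpWeight α z) w))) x).re := by
  set k : 𝓔 d → ℝ := fun z => κ z * jumpWeight α z with hk_def
  set m : 𝓔 d → ℂ := fun w => (Real.exp (-(t * symbol k w)) : ℂ) with hm
  have hmi : Integrable m := hk.integrable_exp hα0 hα2 hκ₀ ht
  set b : 𝓔 d → 𝓔 d → ℂ := fun z w =>
    (-2 * ((1 - Real.cos (2 * Real.pi * inner ℝ w z)) * k z) : ℝ) * m w with hb
  have hsc := hk.continuous_symbol hα0 hα2
  have hbi : Integrable (Function.uncurry b) (volume.prod volume) := by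
    have h1 := (hk.integrable_min_mul hα0 hα2).mul_prod
      (((hk.integrable_pow_mul_exp hα0 hα2 hκ₀ ht 0).const_mul 2).add
        ((hk.integrable_pow_mul_exp hα0 hα2 hκ₀ ht 2).const_mul (2 * Real.pi ^ 2)))
    refine (h1.const_mul 2).mono' ?_ (ae_of_all _ fun p => ?_)
    · have hm1 : Measurable fun p : 𝓔 d × 𝓔 d =>
          (1 - Real.cos (2 * Real.pi * inner ℝ p.2 p.1)) * k p.1 :=
        (Continuous.measurable (by fun_prop)).mul (hk.measurable.comp measurable_fst)
      have hm2 : Measurable fun p : 𝓔 d × 𝓔 d => m p.2 := Continuous.measurable (by fun_prop)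
      exact ((hm1.const_mul (-2)).complex_ofReal.mul hm2).aestronglyMeasurable
    · simp only [Function.uncurry, hb, hm, Pi.add_apply, pow_zero, one_mul]
      rw [norm_mul, Complex.norm_real, Complex.norm_real, Real.norm_of_nonneg (Real.exp_pos _).le,
        norm_mul, Real.norm_of_nonneg (hk.integrand_nonneg p.2 p.1)]
      have := mul_le_mul_of_nonneg_right (hk.integrand_le p.2 p.1)
        (Real.exp_pos (-(t * symbol k p.2))).le
      norm_num
      linarith
  have hsd : ∀ z, secondDiff (stableKernel k t) x z * κ z * ‖z‖ ^ (-(d : ℝ) - α) =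
      (invFT (b z) x).re := by
    intro z
    have h1 : invFT m (x + z) + invFT m (x - z) - 2 * invFT m x =
        ∫ w, wave w x * ((-2 * (1 - Real.cos (2 * Real.pi * inner ℝ w z)) : ℝ) * m w) := by
      have i1 := integrable_wave_mul hmi (x + z)
      have i2 := integrable_wave_mul hmi (x - z)
      have i12 : Integrable fun w => wave w (x + z) * m w + wave w (x - z) * m w := i1.add i2
      have i3 := (integrable_wave_mul hmi x).const_mul 2
      rw [invFT, invFT, invFT, ← integral_const_mul, ← integral_add i1 i2,
        ← integral_sub i12 i3]
      congr 1; ext w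
      have := wave_add_wave_neg w z
      rw [sub_eq_add_neg x z, wave_add, wave_add]
      push_cast at this ⊢
      linear_combination wave w x * m w * this
    have h2 : invFT (b z) x = (k z : ℂ) *
        (invFT m (x + z) + invFT m (x - z) - 2 * invFT m x) := by
      rw [h1, invFT, ← integral_const_mul]
      congr 1; ext w
      simp only [hb]
      push_cast; ring
    rw [h2, ← ofReal_stableKernel, ← ofReal_stableKernel, ← ofReal_stableKernel,
      Complex.re_ofReal_mul, secondDiff, hk_def]
    simp only [jumpWeight]
    norm_cast
    ring
  have hint : Integrable fun z => invFT (b z) x :=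
    (integrable_wave_mul_prod hbi x).integral_prod_left
  rw [stableLikeOp]
  simp only [hsd]
  have h3 : ∫ z, (invFT (b z) x).re = (∫ z, invFT (b z) x).re := by
    have := integral_re hint
    simpa only [RCLike.re_eq_complex_re] using this
  rw [h3, integral_invFT hbi x, ← Complex.re_ofReal_mul]
  congr 1
  rw [invFT, invFT, ← integral_const_mul]
  congr 1; ext w
  have h4 : ∫ z, b z w = (-2 * symbol k w : ℝ) * m w := by
    simp only [hb]
    rw [integral_mul_const, integral_complex_ofReal, integral_const_mul, symbol]
  rw [h4, hm]
  push_cast; ring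

theorem hasDerivAt_stableKernel (hk : IsStableDensity α κ₀ κ₁ k) (hα0 : 0 < α) (hα2 : α < 2)
    (hκ₀ : 0 < κ₀) {t : ℝ} (ht : 0 < t) (x : 𝓔 d) :
    HasDerivAt (fun s => stableKernel k s x)
      (invFT (fun w => -(symbol k w : ℂ) * Real.exp (-(t * symbol k w))) x).re t := by
  have hsc := hk.continuous_symbol hα0 hα2
  have hwc := continuous_wave_left x
  have ht2 : 0 < t / 2 := by positivity
  have h := hasDerivAt_integral_of_dominated_loc_of_deriv_le (μ := volume) (x₀ := t)
    (F := fun (s : ℝ) w => wave w x * (Real.exp (-(s * symbol k w)) : ℂ))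
    (F' := fun (s : ℝ) w => wave w x * (-(symbol k w : ℂ) * Real.exp (-(s * symbol k w))))
    (bound := fun w => symbol k w * Real.exp (-(t / 2 * symbol k w)))
    (Ioi_mem_nhds (half_lt_self ht))
    (Eventually.of_forall fun s => Continuous.aestronglyMeasurable (by fun_prop))
    (integrable_wave_mul (hk.integrable_exp hα0 hα2 hκ₀ ht) x)
    (Continuous.aestronglyMeasurable (by fun_prop))
    (ae_of_all _ fun w s hs => ?_) (hk.integrable_symbol_mul_exp hα0 hα2 hκ₀ ht2)
    (ae_of_all _ fun w s _ => ?_)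
  · exact Complex.reCLM.hasFDerivAt.comp_hasDerivAt t h.2
  · rw [norm_mul, norm_wave, one_mul, norm_mul, norm_neg, Complex.norm_real, Complex.norm_real,
      Real.norm_of_nonneg (hk.symbol_nonneg w), Real.norm_of_nonneg (Real.exp_pos _).le]
    exact mul_le_mul_of_nonneg_left (hk.exp_neg_mul_symbol_le (le_of_lt hs) w) (hk.symbol_nonneg w)
  · have h1 : HasDerivAt (fun s : ℝ => Real.exp (-(s * symbol k w)))
        (Real.exp (-(s * symbol k w)) * -(1 * symbol k w)) s :=
      ((hasDerivAt_id s).mul_const (symbol k w)).neg.exp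
    refine (h1.ofReal_comp.const_mul (wave w x)).congr_deriv ?_
    push_cast; ring

theorem tendsto_integral_stableKernel_mul (hk : IsStableDensity α κ₀ κ₁ k) (hα0 : 0 < α)
    (hα2 : α < 2) (hκ₀ : 0 < κ₀) (hκ₁ : 0 ≤ κ₁) (f : 𝓔 d →ᵇ ℝ) :
    Tendsto (fun t => ∫ y, stableKernel k t y * f y) (𝓝[>] 0) (𝓝 (f 0)) := by
  obtain ⟨C, hC, hb⟩ := exists_stableKernel_one_le d hα0 hα2 hκ₀ hκ₁
  -- after rescaling to time one the kernels are dominated by a multiple of `ϱ`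
  have hscale : ∀ t : ℝ, 0 < t → ∫ y, stableKernel k t y * f y =
      ∫ y, stableKernel (StableKernel.rescale α (t ^ (1 / α)) k) 1 y * f (t ^ (1 / α) • y) := by
    intro t ht
    have hs : 0 < t ^ (1 / α) := by positivity
    have h := Measure.integral_comp_smul_of_nonneg (volume : Measure (𝓔 d))
      (fun y => stableKernel k t y * f y) (t ^ (1 / α)) (hR := hs.le)
    have h2 : ∀ y, stableKernel k t (t ^ (1 / α) • y) = ((t ^ (1 / α)) ^ d)⁻¹ *
        stableKernel (StableKernel.rescale α (t ^ (1 / α)) k) 1 y := by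
      intro y
      rw [stableKernel_eq_rescale hα0 k ht, inv_smul_smul₀ hs.ne']
    simp only [h2, finrank_euclideanSpace, Fintype.card_fin, smul_eq_mul, mul_assoc] at h
    rw [integral_const_mul] at h
    exact (mul_left_cancel₀ (by positivity) h).symm
  have hdiff : Tendsto (fun t : ℝ => ∫ y : 𝓔 d, C * decay α y * |f (t ^ (1 / α) • y) - f 0|)
      (𝓝[>] 0) (𝓝 0) := by
    have h0 : (0 : ℝ) = ∫ y : 𝓔 d, (0 : ℝ) := by simp
    rw [h0]
    have hdc := continuous_decay (d := d) α
    refine tendsto_integral_filter_of_dominated_convergence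
      (fun y => C * decay α y * (2 * ‖f‖)) (Eventually.of_forall fun t => ?_)
      (Eventually.of_forall fun t => ae_of_all _ fun y => ?_)
      (((integrable_decay hα0).const_mul C).mul_const _) (ae_of_all _ fun y => ?_)
    · exact Continuous.aestronglyMeasurable (by fun_prop)
    · have := decay_pos α y
      rw [Real.norm_of_nonneg (by positivity)]
      gcongr
      have := (abs_sub (f (t ^ (1 / α) • y)) (f 0)).trans
        (add_le_add (f.norm_coe_le_norm _) (f.norm_coe_le_norm _))
      linarith
    · have hs : Tendsto (fun t : ℝ => t ^ (1 / α)) (𝓝[>] 0) (𝓝 0) := by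
        have := (Real.continuousAt_rpow_const 0 (1 / α) (Or.inr (by positivity))).tendsto
        rw [Real.zero_rpow (by positivity)] at this
        exact this.mono_left nhdsWithin_le_nhds
      have h1 : Tendsto (fun t : ℝ => f (t ^ (1 / α) • y)) (𝓝[>] 0) (𝓝 (f 0)) := by
        refine (f.continuous.tendsto 0).comp ?_
        simpa using hs.smul_const y
      have h2 := ((h1.sub_const (f 0)).abs).const_mul (C * decay α y)
      simpa using h2
  rw [tendsto_iff_norm_sub_tendsto_zero]
  refine squeeze_zero' (Eventually.of_forall fun t => norm_nonneg _) ?_ hdiff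
  filter_upwards [self_mem_nhdsWithin] with t ht
  have hs : 0 < t ^ (1 / α) := Real.rpow_pos_of_pos ht _
  have hks := hk.rescale hs
  have hi := hks.integrable_stableKernel hα0 hα2 hκ₀ hκ₁ one_pos
  have h1 := hks.integral_stableKernel hα0 hα2 hκ₀ hκ₁ one_pos
  have hif : Integrable fun y =>
      stableKernel (StableKernel.rescale α (t ^ (1 / α)) k) 1 y * f (t ^ (1 / α) • y) :=
    hi.mul_bdd (c := ‖f‖) (Continuous.aestronglyMeasurable (by fun_prop))
      (ae_of_all _ fun y => f.norm_coe_le_norm _)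
  have h2 : f 0 = ∫ y, stableKernel (StableKernel.rescale α (t ^ (1 / α)) k) 1 y * f 0 := by
    rw [integral_mul_const, h1, one_mul]
  rw [hscale t ht]
  nth_rewrite 1 [h2]
  rw [← integral_sub hif (hi.mul_const _)]
  have hdc := continuous_decay (d := d) α
  refine norm_integral_le_of_norm_le ?_ (ae_of_all _ fun y => ?_)
  · refine ((integrable_decay hα0).const_mul C).mul_bdd (c := 2 * ‖f‖)
      (Continuous.aestronglyMeasurable (by fun_prop)) (ae_of_all _ fun y => ?_)
    rw [Real.norm_eq_abs, abs_abs]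
    have := (abs_sub (f (t ^ (1 / α) • y)) (f 0)).trans
      (add_le_add (f.norm_coe_le_norm _) (f.norm_coe_le_norm _))
    linarith
  · rw [← mul_sub, norm_mul]
    exact mul_le_mul_of_nonneg_right (hb _ hks y) (norm_nonneg _)

theorem isHeatKernel_stableKernel {κ : 𝓔 d → ℝ}
    (hk : IsStableDensity α κ₀ κ₁ fun z => κ z * jumpWeight α z) (hα0 : 0 < α) (hα2 : α < 2)
    (hκ₀ : 0 < κ₀) (hκ₁ : 0 ≤ κ₁) :
    IsHeatKernel α κ (stableKernel fun z => κ z * jumpWeight α z) where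
  nonneg _ ht := hk.stableKernel_nonneg hα0 hα2 hκ₀ ht
  integrable _ ht := hk.integrable_stableKernel hα0 hα2 hκ₀ hκ₁ ht
  integral_eq_one _ ht := hk.integral_stableKernel hα0 hα2 hκ₀ hκ₁ ht
  contDiff _ ht := hk.contDiff_stableKernel hα0 hα2 hκ₀ ht
  bounded_deriv _ ht := hk.exists_norm_iteratedFDeriv_stableKernel_le hα0 hα2 hκ₀ ht
  continuous_time _ ht := hk.tendstoUniformly_iteratedFDeriv hα0 hα2 hκ₀ ht
  heat_equation t ht x := by
    rw [hk.stableLikeOp_stableKernel hα0 hα2 hκ₀ ht]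
    exact hk.hasDerivAt_stableKernel hα0 hα2 hκ₀ ht x
  initial := hk.tendsto_integral_stableKernel_mul hα0 hα2 hκ₀ hκ₁

end IsStableDensity

/-! ### Uniqueness -/

/-- A continuous function bounded by `M` whose second differences are at most `M |z|²`. -/
structure SecondDiffBound (M : ℝ) (f : 𝓔 d → ℝ) : Prop where
  continuous : Continuous f
  bound : ∀ x, |f x| ≤ M
  second : ∀ x z, |secondDiff f x z| ≤ M * ‖z‖ ^ 2

namespace SecondDiffBound
variable {M : ℝ} {f : 𝓔 d → ℝ}

theorem nonneg (hf : SecondDiffBound M f) : 0 ≤ M := (abs_nonneg _).trans (hf.bound 0)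

theorem abs_secondDiff_le (hf : SecondDiffBound M f) (x z : 𝓔 d) :
    |secondDiff f x z| ≤ 4 * M * min 1 (‖z‖ ^ 2) := by
  have h0 := hf.nonneg
  rcases le_total 1 (‖z‖ ^ 2) with h | h
  · rw [min_eq_left h]
    have e1 := abs_le.1 (hf.bound (x + z))
    have e2 := abs_le.1 (hf.bound (x - z))
    have e3 := abs_le.1 (hf.bound x)
    unfold secondDiff
    rw [abs_le]; constructor <;> linarith
  · rw [min_eq_right h]
    refine (hf.second x z).trans ?_
    nlinarith [mul_nonneg h0 (sq_nonneg ‖z‖)]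

theorem mul {A B : ℝ} {g : 𝓔 d → ℝ} (hf : SecondDiffBound A f) (hg : SecondDiffBound B g)
    (hfl : ∀ x z, |f (x + z) - f x| ≤ A * ‖z‖) (hgl : ∀ x z, |g (x + z) - g x| ≤ B * ‖z‖) :
    SecondDiffBound (4 * (A * B)) fun x => f x * g x where
  continuous := hf.continuous.mul hg.continuous
  bound x := by
    have hA := hf.nonneg
    have hB := hg.nonneg
    rw [abs_mul]
    calc |f x| * |g x| ≤ A * B := mul_le_mul (hf.bound x) (hg.bound x) (abs_nonneg _) hA
      _ ≤ _ := by nlinarith [mul_nonneg hA hB]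
  second x z := by
    have hA := hf.nonneg
    have hid : secondDiff (fun x => f x * g x) x z = secondDiff f x z * g x + f x * secondDiff g x z +
        (f (x + z) - f x) * (g (x + z) - g x) + (f (x + -z) - f x) * (g (x + -z) - g x) := by
      simp only [secondDiff, sub_eq_add_neg]; ring
    have h1 : |secondDiff f x z * g x| ≤ A * ‖z‖ ^ 2 * B := by
      rw [abs_mul]
      exact mul_le_mul (hf.second x z) (hg.bound x) (abs_nonneg _) (by positivity)
    have h2 : |f x * secondDiff g x z| ≤ A * (B * ‖z‖ ^ 2) := by
      rw [abs_mul]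
      exact mul_le_mul (hf.bound x) (hg.second x z) (abs_nonneg _) hA
    have h3 : ∀ y : 𝓔 d, |(f (x + y) - f x) * (g (x + y) - g x)| ≤ A * ‖y‖ * (B * ‖y‖) := by
      intro y
      rw [abs_mul]
      exact mul_le_mul (hfl x y) (hgl x y) (abs_nonneg _) (by positivity)
    have h4 := h3 (-z)
    rw [norm_neg] at h4
    rw [hid]
    refine (abs_add_le _ _).trans ((add_le_add ((abs_add_le _ _).trans (add_le_add
      ((abs_add_le _ _).trans (add_le_add h1 h2)) (h3 z))) h4).trans_eq ?_)
    ring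

theorem comp_smul (hf : SecondDiffBound M f) {r : ℝ} (hr0 : 0 ≤ r) (hr1 : r ≤ 1) :
    SecondDiffBound M fun x => f (r • x) where
  continuous := hf.continuous.comp (continuous_const_smul r)
  bound x := hf.bound _
  second x z := by
    have hid : secondDiff (fun x => f (r • x)) x z = secondDiff f (r • x) (r • z) := by
      simp only [secondDiff, smul_add, smul_sub]
    rw [hid]
    refine (hf.second _ _).trans (mul_le_mul_of_nonneg_left ?_ hf.nonneg)
    rw [norm_smul, Real.norm_of_nonneg hr0]
    exact pow_le_pow_left₀ (by positivity) (mul_le_of_le_one_left (norm_nonneg _) hr1) 2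

end SecondDiffBound

theorem secondDiffBound_re_invFT {m : 𝓔 d → ℂ} (hm : Continuous m)
    (hmi : ∀ n : ℕ, Integrable fun w => ‖w‖ ^ n * ‖m w‖) :
    ∃ B, SecondDiffBound B (fun x => (invFT m x).re) ∧
      ∀ x z, |(invFT m (x + z)).re - (invFT m x).re| ≤ B * ‖z‖ := by
  have hi : Integrable m := by
    have := hmi 0
    simp only [pow_zero, one_mul] at this
    exact (integrable_norm_iff hm.aestronglyMeasurable).1 this
  have hI : ∀ n : ℕ, 0 ≤ ∫ w, ‖w‖ ^ n * ‖m w‖ := fun n => integral_nonneg fun w => by positivity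
  have hpi := Real.pi_pos
  have c1 : 0 ≤ 2 * Real.pi * ∫ w, ‖w‖ ^ 1 * ‖m w‖ := mul_nonneg (by positivity) (hI 1)
  have c2 : 0 ≤ (2 * Real.pi) ^ 2 * ∫ w, ‖w‖ ^ 2 * ‖m w‖ := mul_nonneg (by positivity) (hI 2)
  refine ⟨(∫ w, ‖w‖ ^ 0 * ‖m w‖) + 2 * Real.pi * (∫ w, ‖w‖ ^ 1 * ‖m w‖) +
    (2 * Real.pi) ^ 2 * ∫ w, ‖w‖ ^ 2 * ‖m w‖, ⟨Complex.continuous_re.comp (continuous_invFT hi),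
    fun x => ?_, fun x z => ?_⟩, fun x z => ?_⟩
  · refine (Complex.abs_re_le_norm _).trans ((norm_invFT_le m x).trans ?_)
    simp only [pow_zero, one_mul] at c1 c2 ⊢
    linarith
  · rw [secondDiff_re_invFT hi]
    refine (Complex.abs_re_le_norm _).trans ((norm_invFT_le _ _).trans ?_)
    have hb : ∀ w, ‖(wave w z - 1) * ((wave w z - 1) * m w)‖ ≤
        (2 * Real.pi) ^ 2 * ‖z‖ ^ 2 * (‖w‖ ^ 2 * ‖m w‖) := by
      intro w
      rw [norm_mul, norm_mul]
      have := norm_wave_sub_one_le w z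
      calc _ ≤ 2 * Real.pi * (‖w‖ * ‖z‖) * (2 * Real.pi * (‖w‖ * ‖z‖) * ‖m w‖) := by gcongr
        _ = _ := by ring
    refine (integral_mono_of_nonneg (ae_of_all _ fun w => norm_nonneg _) ((hmi 2).const_mul _)
      (ae_of_all _ hb)).trans ?_
    rw [integral_const_mul]
    have := hI 0
    nlinarith [mul_nonneg (add_nonneg (hI 0) c1) (sq_nonneg ‖z‖)]
  · rw [← Complex.sub_re, invFT_add_sub hi]
    refine (Complex.abs_re_le_norm _).trans ((norm_invFT_le _ _).trans ?_)
    have hb : ∀ w, ‖(wave w z - 1) * m w‖ ≤ 2 * Real.pi * ‖z‖ * (‖w‖ ^ 1 * ‖m w‖) := by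
      intro w
      rw [norm_mul]
      have := norm_wave_sub_one_le w z
      calc _ ≤ 2 * Real.pi * (‖w‖ * ‖z‖) * ‖m w‖ := by gcongr
        _ = _ := by ring
    refine (integral_mono_of_nonneg (ae_of_all _ fun w => norm_nonneg _) ((hmi 1).const_mul _)
      (ae_of_all _ hb)).trans ?_
    rw [integral_const_mul]
    nlinarith [mul_nonneg (add_nonneg (hI 0) c2) (norm_nonneg z)]

/-- A phase-shifted plane wave. -/
def cosWave (w : 𝓔 d) (θ : ℝ) (x : 𝓔 d) : ℝ := Real.cos (2 * Real.pi * inner ℝ w x + θ)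

theorem secondDiff_cosWave (w : 𝓔 d) (θ : ℝ) (x z : 𝓔 d) : secondDiff (cosWave w θ) x z =
    -2 * cosWave w θ x * (1 - Real.cos (2 * Real.pi * inner ℝ w z)) := by
  have h1 : 2 * Real.pi * inner ℝ w (x + z) + θ =
      (2 * Real.pi * inner ℝ w x + θ) + 2 * Real.pi * inner ℝ w z := by rw [inner_add_right]; ring
  have h2 : 2 * Real.pi * inner ℝ w (x - z) + θ =
      (2 * Real.pi * inner ℝ w x + θ) - 2 * Real.pi * inner ℝ w z := by rw [inner_sub_right]; ring
  rw [secondDiff, cosWave, cosWave, cosWave, h1, h2, Real.cos_add, Real.cos_sub]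
  ring

theorem secondDiffBound_cosWave (w : 𝓔 d) (θ : ℝ) :
    ∃ A, SecondDiffBound A (cosWave w θ) ∧
      ∀ x z, |cosWave w θ (x + z) - cosWave w θ x| ≤ A * ‖z‖ := by
  have hpi := Real.pi_pos
  refine ⟨1 + 2 * Real.pi * ‖w‖ + (2 * Real.pi * ‖w‖) ^ 2, ⟨by unfold cosWave; fun_prop,
    fun x => (Real.abs_cos_le_one _).trans ?_, fun x z => ?_⟩, fun x z => ?_⟩
  · have : 0 ≤ 2 * Real.pi * ‖w‖ := by positivity
    nlinarith
  · have h0 := one_sub_cos_nonneg (2 * Real.pi * inner ℝ w z)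
    have h1 := Real.one_sub_sq_div_two_le_cos (x := 2 * Real.pi * inner ℝ w z)
    have h2 : (2 * Real.pi * inner ℝ w z) ^ 2 ≤ (2 * Real.pi * (‖w‖ * ‖z‖)) ^ 2 :=
      sq_le_sq' (abs_le.1 (abs_two_pi_inner_le w z)).1 (abs_le.1 (abs_two_pi_inner_le w z)).2
    have h3 : |cosWave w θ x| ≤ 1 := Real.abs_cos_le_one _
    rw [secondDiff_cosWave, abs_mul, abs_mul, abs_of_nonneg h0]
    calc _ ≤ |(-2 : ℝ)| * 1 * ((2 * Real.pi * (‖w‖ * ‖z‖)) ^ 2 / 2) := by gcongr; linarith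
      _ = (2 * Real.pi * ‖w‖) ^ 2 * ‖z‖ ^ 2 := by rw [abs_neg, abs_two]; ring
      _ ≤ _ := by
        have : 0 ≤ (1 + 2 * Real.pi * ‖w‖) * ‖z‖ ^ 2 := by positivity
        linarith
  · have h : |cosWave w θ (x + z) - cosWave w θ x| ≤ |2 * Real.pi * inner ℝ w z| := by
      refine (Real.abs_cos_sub_cos_le _ _).trans_eq ?_
      rw [inner_add_right]; congr 1; ring
    refine h.trans ((abs_two_pi_inner_le w z).trans ?_)
    have : 0 ≤ (1 + (2 * Real.pi * ‖w‖) ^ 2) * ‖z‖ := by positivity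
    linarith

theorem stableLikeOp_eq {α : ℝ} {κ : 𝓔 d → ℝ} (f : 𝓔 d → ℝ) (x : 𝓔 d) :
    stableLikeOp α κ f x = (1 / 2) * ∫ z, secondDiff f x z * (κ z * jumpWeight α z) := by
  simp only [stableLikeOp, jumpWeight, mul_assoc]

theorem stableLikeOp_const_mul_cosWave {α : ℝ} {κ : 𝓔 d → ℝ} (c : ℝ) (w : 𝓔 d) (θ : ℝ) (x : 𝓔 d) :
    stableLikeOp α κ (fun x => c * cosWave w θ x) x =
      -symbol (fun z => κ z * jumpWeight α z) w * (c * cosWave w θ x) := by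
  have h : ∀ z, secondDiff (fun x => c * cosWave w θ x) x z * (κ z * jumpWeight α z) =
      (-2 * (c * cosWave w θ x)) *
        ((1 - Real.cos (2 * Real.pi * inner ℝ w z)) * (κ z * jumpWeight α z)) := by
    intro z
    have h1 : secondDiff (fun x => c * cosWave w θ x) x z = c * secondDiff (cosWave w θ) x z := by
      simp only [secondDiff]; ring
    rw [h1, secondDiff_cosWave]; ring
  rw [stableLikeOp_eq]
  simp only [h]
  rw [integral_const_mul, symbol]; ring

namespace IsJumpDensity
variable {α Λ : ℝ} {κ : 𝓔 d → ℝ} {M : ℝ} {f : 𝓔 d → ℝ}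

theorem abs_secondDiff_mul_le (hk : IsJumpDensity α Λ fun z => κ z * jumpWeight α z)
    (hf : SecondDiffBound M f) (x z : 𝓔 d) :
    ‖secondDiff f x z * (κ z * jumpWeight α z)‖ ≤
      4 * M * (min 1 (‖z‖ ^ 2) * (κ z * jumpWeight α z)) := by
  rw [norm_mul, Real.norm_of_nonneg (hk.nonneg z)]
  exact (mul_le_mul_of_nonneg_right (hf.abs_secondDiff_le x z) (hk.nonneg z)).trans_eq (by ring)

theorem measurable_secondDiff_mul (hk : IsJumpDensity α Λ fun z => κ z * jumpWeight α z)
    (hf : SecondDiffBound M f) : Measurable fun p : 𝓔 d × 𝓔 d =>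
      secondDiff f p.1 p.2 * (κ p.2 * jumpWeight α p.2) := by
  have := hf.continuous
  have h : Continuous fun p : 𝓔 d × 𝓔 d => secondDiff f p.1 p.2 := by unfold secondDiff; fun_prop
  exact h.measurable.mul (hk.measurable.comp measurable_snd)

theorem abs_stableLikeOp_le (hk : IsJumpDensity α Λ fun z => κ z * jumpWeight α z) (hα0 : 0 < α)
    (hα2 : α < 2) (hf : SecondDiffBound M f) (x : 𝓔 d) :
    |stableLikeOp α κ f x| ≤ 2 * M * (Λ * levyMass d α) := by
  have h0 := hf.nonneg
  have h := norm_integral_le_of_norm_le ((hk.integrable_min_mul hα0 hα2).const_mul (4 * M))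
    (ae_of_all _ fun z => hk.abs_secondDiff_mul_le hf x z)
  rw [integral_const_mul, Real.norm_eq_abs] at h
  have h2 := mul_le_mul_of_nonneg_left (hk.integral_min_mul_le hα0 hα2)
    (by positivity : 0 ≤ 4 * M)
  rw [stableLikeOp_eq, abs_mul, abs_of_pos (by norm_num : (0 : ℝ) < 1 / 2)]
  linarith

theorem measurable_stableLikeOp (hk : IsJumpDensity α Λ fun z => κ z * jumpWeight α z)
    (hf : SecondDiffBound M f) : Measurable (stableLikeOp α κ f) := by
  have h : stableLikeOp α κ f = fun x =>
      (1 / 2) * ∫ z, secondDiff f x z * (κ z * jumpWeight α z) := funext (stableLikeOp_eq f)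
  rw [h]
  exact ((hk.measurable_secondDiff_mul hf).stronglyMeasurable.integral_prod_right').measurable.const_mul _

theorem tendsto_stableLikeOp (hk : IsJumpDensity α Λ fun z => κ z * jumpWeight α z) (hα0 : 0 < α)
    (hα2 : α < 2) {F : ℕ → 𝓔 d → ℝ} (hF : ∀ n, SecondDiffBound M (F n))
    (hlim : ∀ x, Tendsto (fun n => F n x) atTop (𝓝 (f x))) (x : 𝓔 d) :
    Tendsto (fun n => stableLikeOp α κ (F n) x) atTop (𝓝 (stableLikeOp α κ f x)) := by
  simp only [stableLikeOp_eq]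
  refine Tendsto.const_mul _ (tendsto_integral_of_dominated_convergence
    (fun z => 4 * M * (min 1 (‖z‖ ^ 2) * (κ z * jumpWeight α z)))
    (fun n => ((hk.measurable_secondDiff_mul (hF n)).comp measurable_prodMk_left).aestronglyMeasurable)
    ((hk.integrable_min_mul hα0 hα2).const_mul _)
    (fun n => ae_of_all _ fun z => hk.abs_secondDiff_mul_le (hF n) x z)
    (ae_of_all _ fun z => Tendsto.mul_const _ ?_))
  exact ((hlim _).add (hlim _)).sub ((hlim _).const_mul 2)

theorem integral_secondDiff_mul_comm {g : 𝓔 d → ℝ} {N : ℝ}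
    (hg : SecondDiffBound N g) (hfi : Integrable f) (z : 𝓔 d) :
    ∫ x, secondDiff f x z * g x = ∫ x, f x * secondDiff g x z := by
  have hgb : ∀ (φ : 𝓔 d → ℝ), Integrable φ → ∀ y, Integrable fun x => φ x * g (x + y) :=
    fun φ hφ y => hφ.mul_bdd (c := N)
      (hg.continuous.comp (continuous_add_const y)).aestronglyMeasurable
      (ae_of_all _ fun x => hg.bound _)
  have hshift : ∀ y, ∫ x, f (x + y) * g x = ∫ x, f x * g (x + -y) := by
    intro y
    rw [← integral_add_right_eq_self (fun x => f x * g (x + -y)) y]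
    simp only [add_neg_cancel_right]
  have h0 := hgb f hfi 0
  simp only [add_zero] at h0
  have hl : ∀ y, Integrable fun x => f (x + y) * g x := fun y => by
    simpa only [add_zero] using hgb _ (hfi.comp_add_right y) 0
  have e1 : ∫ x, secondDiff f x z * g x =
      (∫ x, f (x + z) * g x) + (∫ x, f (x + -z) * g x) - 2 * ∫ x, f x * g x := by
    have i12 : Integrable fun x => f (x + z) * g x + f (x + -z) * g x := (hl z).add (hl (-z))
    rw [← integral_const_mul, ← integral_add (hl z) (hl (-z)), ← integral_sub i12 (h0.const_mul 2)]
    congr 1; ext x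
    rw [secondDiff, sub_eq_add_neg x z]; ring
  have e2 : ∫ x, f x * secondDiff g x z =
      (∫ x, f x * g (x + z)) + (∫ x, f x * g (x + -z)) - 2 * ∫ x, f x * g x := by
    have i12 : Integrable fun x => f x * g (x + z) + f x * g (x + -z) :=
      (hgb f hfi z).add (hgb f hfi (-z))
    rw [← integral_const_mul, ← integral_add (hgb f hfi z) (hgb f hfi (-z)),
      ← integral_sub i12 (h0.const_mul 2)]
    congr 1; ext x
    rw [secondDiff, sub_eq_add_neg x z]; ring
  rw [e1, e2, hshift, hshift, neg_neg]; ring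

/-- The operator is symmetric. -/
theorem integral_stableLikeOp_mul_comm (hk : IsJumpDensity α Λ fun z => κ z * jumpWeight α z)
    (hα0 : 0 < α) (hα2 : α < 2) {g : 𝓔 d → ℝ} {N : ℝ} (hf : SecondDiffBound M f)
    (hg : SecondDiffBound N g) (hfi : Integrable f) (hgi : Integrable g) :
    ∫ x, stableLikeOp α κ f x * g x = ∫ x, f x * stableLikeOp α κ g x := by
  have hprod : ∀ {f g : 𝓔 d → ℝ} {M : ℝ}, SecondDiffBound M f → Continuous g → Integrable g →
      Integrable (Function.uncurry fun x z => secondDiff f x z * (κ z * jumpWeight α z) * g x)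
        (volume.prod volume) := by
    intro f g M hf hg hgi
    have h1 := (hgi.mul_prod (hk.integrable_min_mul hα0 hα2)).norm.const_mul (4 * M)
    refine h1.mono' ((hk.measurable_secondDiff_mul hf).mul
      (hg.measurable.comp measurable_fst)).aestronglyMeasurable (ae_of_all _ fun p => ?_)
    have h2 := hk.abs_secondDiff_mul_le hf p.1 p.2
    simp only [Function.uncurry]
    have h3 : 0 ≤ min 1 (‖p.2‖ ^ 2) := by positivity
    rw [norm_mul, norm_mul (g p.1), Real.norm_of_nonneg (mul_nonneg h3 (hk.nonneg p.2))]
    calc _ ≤ 4 * M * (min 1 (‖p.2‖ ^ 2) * (κ p.2 * jumpWeight α p.2)) * ‖g p.1‖ := by gcongr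
      _ = _ := by ring
  have e1 : ∫ x, stableLikeOp α κ f x * g x =
      1 / 2 * ∫ z, ∫ x, secondDiff f x z * (κ z * jumpWeight α z) * g x := by
    rw [← integral_integral_swap (hprod hf hg.continuous hgi), ← integral_const_mul]
    congr 1; ext x
    rw [stableLikeOp_eq, integral_mul_const]; ring
  have e2 : ∫ x, f x * stableLikeOp α κ g x =
      1 / 2 * ∫ z, ∫ x, secondDiff g x z * (κ z * jumpWeight α z) * f x := by
    rw [← integral_integral_swap (hprod hg hf.continuous hfi), ← integral_const_mul]
    congr 1; ext x
    rw [stableLikeOp_eq, integral_mul_const]; ring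
  rw [e1, e2]
  congr 2; ext z
  have e3 : ∀ (f g : 𝓔 d → ℝ), ∫ x, secondDiff f x z * (κ z * jumpWeight α z) * g x =
      (κ z * jumpWeight α z) * ∫ x, secondDiff f x z * g x := by
    intro f g
    rw [← integral_const_mul]
    congr 1; ext x; ring
  rw [e3, e3, integral_secondDiff_mul_comm hg hfi]
  congr 2; ext x; ring

end IsJumpDensity

theorem abs_secondDiff_le_of_iteratedFDeriv {f : 𝓔 d → ℝ} (hf : ContDiff ℝ 2 f) {M : ℝ}
    (hM : ∀ x, ‖iteratedFDeriv ℝ 2 f x‖ ≤ M) (x z : 𝓔 d) :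
    |secondDiff f x z| ≤ M * ‖z‖ ^ 2 := by
  have hM0 : 0 ≤ M := (norm_nonneg _).trans (hM 0)
  have hd1 : Differentiable ℝ f := hf.differentiable (by norm_num)
  have hd2 : Differentiable ℝ (fderiv ℝ f) :=
    (hf.fderiv_right (m := 1) (by norm_num)).differentiable (by norm_num)
  have h1 : ∀ y, ‖fderiv ℝ f (y + z) - fderiv ℝ f y‖ ≤ M * ‖z‖ := by
    intro y
    have := convex_univ.norm_image_sub_le_of_norm_fderiv_le (𝕜 := ℝ) (f := fderiv ℝ f) (C := M)
      (fun y _ => hd2 y) (fun y _ => ?_) (Set.mem_univ y) (Set.mem_univ (y + z))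
    · simpa using this
    · rw [← norm_iteratedFDeriv_one, norm_iteratedFDeriv_fderiv]
      exact hM y
  have h2 := convex_univ.norm_image_sub_le_of_norm_fderiv_le (𝕜 := ℝ)
    (f := fun y => f (y + z) - f y) (C := M * ‖z‖)
    (fun y _ => ((hd1 _).comp y (by fun_prop)).sub (hd1 y))
    (fun y _ => by
      rw [fderiv_fun_sub (by exact (hd1 _).comp y (by fun_prop)) (hd1 y), fderiv_comp_add_right]
      exact h1 y) (Set.mem_univ (x - z)) (Set.mem_univ x)
  simp only [sub_add_cancel, sub_sub_cancel, Real.norm_eq_abs] at h2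
  rw [secondDiff]
  calc _ = |f (x + z) - f x - (f x - f (x - z))| := by congr 1; ring
    _ ≤ _ := h2
    _ = _ := by ring

section IsHeatKernel
variable {α : ℝ} {κ : 𝓔 d → ℝ} {p : ℝ → 𝓔 d → ℝ}

theorem _root_.IsHeatKernel.exists_secondDiffBound (hp : IsHeatKernel α κ p) {t : ℝ} (ht : 0 < t) :
    ∃ M, ∀ᶠ s in 𝓝 t, SecondDiffBound M (p s) := by
  obtain ⟨M₀, h₀⟩ := hp.bounded_deriv t ht 0
  obtain ⟨M₂, h₂⟩ := hp.bounded_deriv t ht 2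
  have hM₀ : 0 ≤ M₀ := (norm_nonneg _).trans (h₀ 0)
  have hM₂ : 0 ≤ M₂ := (norm_nonneg _).trans (h₂ 0)
  refine ⟨M₀ + M₂ + 1, ?_⟩
  filter_upwards [lt_mem_nhds ht, Metric.tendstoUniformly_iff.1 (hp.continuous_time t ht 0) 1 one_pos,
    Metric.tendstoUniformly_iff.1 (hp.continuous_time t ht 2) 1 one_pos] with s hs hs₀ hs₂
  have hb : ∀ (n : ℕ) (x : 𝓔 d) (M : ℝ), ‖iteratedFDeriv ℝ n (p t) x‖ ≤ M →
      dist (iteratedFDeriv ℝ n (p t) x) (iteratedFDeriv ℝ n (p s) x) < 1 →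
      ‖iteratedFDeriv ℝ n (p s) x‖ ≤ M + 1 := by
    intro n x M h1 h2
    rw [dist_comm, dist_eq_norm] at h2
    have := norm_sub_norm_le (iteratedFDeriv ℝ n (p s) x) (iteratedFDeriv ℝ n (p t) x)
    linarith
  refine ⟨(hp.contDiff s hs).continuous, fun x => ?_, fun x z => ?_⟩
  · have := hb 0 x _ (h₀ x) (hs₀ x)
    rw [norm_iteratedFDeriv_zero, Real.norm_eq_abs] at this
    linarith
  · refine (abs_secondDiff_le_of_iteratedFDeriv (contDiff_infty.1 (hp.contDiff s hs) 2)
      (fun x => hb 2 x _ (h₂ x) (hs₂ x)) x z).trans ?_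
    gcongr
    linarith

/-- The weak form of the heat equation. -/
theorem _root_.IsHeatKernel.hasDerivAt_integral_mul {Λ : ℝ} (hp : IsHeatKernel α κ p)
    (hk : IsJumpDensity α Λ fun z => κ z * jumpWeight α z) (hα0 : 0 < α) (hα2 : α < 2)
    {φ : 𝓔 d → ℝ} {N : ℝ} (hφ : SecondDiffBound N φ) (hφi : Integrable φ) {t : ℝ} (ht : 0 < t) :
    HasDerivAt (fun s => ∫ x, p s x * φ x) (∫ x, p t x * stableLikeOp α κ φ x) t := by
  obtain ⟨M, hM⟩ := hp.exists_secondDiffBound ht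
  have hMt := hM.self_of_nhds
  have hint : ∀ {s}, SecondDiffBound M (p s) → Integrable fun x => p s x * φ x := fun hs =>
    hφi.bdd_mul hs.continuous.aestronglyMeasurable (ae_of_all _ hs.bound)
  have h := hasDerivAt_integral_of_dominated_loc_of_deriv_le (μ := volume) (x₀ := t)
    (F := fun s x => p s x * φ x) (F' := fun s x => stableLikeOp α κ (p s) x * φ x)
    (bound := fun x => 2 * M * (Λ * levyMass d α) * |φ x|) (hM.and (lt_mem_nhds ht))
    (hM.mono fun s hs => (hint hs).1) (hint hMt)
    ((hk.measurable_stableLikeOp hMt).mul hφ.continuous.measurable).aestronglyMeasurable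
    (ae_of_all _ fun x s hs => ?_) (hφi.abs.const_mul _) (ae_of_all _ fun x s hs => ?_)
  · rw [← hk.integral_stableLikeOp_mul_comm hα0 hα2 hMt hφ (hp.integrable t ht) hφi]
    exact h.2
  · rw [norm_mul]
    exact mul_le_mul_of_nonneg_right (hk.abs_stableLikeOp_le hα0 hα2 hs.1 x) (norm_nonneg _)
  · exact (hp.heat_equation s hs.2 x).mul_const _

theorem _root_.IsHeatKernel.abs_integral_mul_le (hp : IsHeatKernel α κ p) {t : ℝ} (ht : 0 < t) {f : 𝓔 d → ℝ} {M : ℝ}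
    (hf : ∀ x, |f x| ≤ M) : |∫ x, p t x * f x| ≤ M := by
  have h := norm_integral_le_of_norm_le ((hp.integrable t ht).mul_const M)
    (ae_of_all _ fun x => (by
      rw [norm_mul, Real.norm_of_nonneg (hp.nonneg t ht x)]
      exact mul_le_mul_of_nonneg_left (hf x) (hp.nonneg t ht x) : ‖p t x * f x‖ ≤ p t x * M))
  rwa [integral_mul_const, hp.integral_eq_one t ht, one_mul] at h

theorem _root_.IsHeatKernel.tendsto_integral_mul (hp : IsHeatKernel α κ p) {t : ℝ} (ht : 0 < t) {F : ℕ → 𝓔 d → ℝ}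
    {f : 𝓔 d → ℝ} {M : ℝ} (hF : ∀ n x, |F n x| ≤ M) (hFm : ∀ n, Measurable (F n))
    (hlim : ∀ x, Tendsto (fun n => F n x) atTop (𝓝 (f x))) :
    Tendsto (fun n => ∫ x, p t x * F n x) atTop (𝓝 (∫ x, p t x * f x)) := by
  refine tendsto_integral_of_dominated_convergence (fun x => p t x * M)
    (fun n => (hp.integrable t ht).1.mul (hFm n).aestronglyMeasurable)
    ((hp.integrable t ht).mul_const M) (fun n => ae_of_all _ fun x => ?_)
    (ae_of_all _ fun x => (hlim x).const_mul _)
  rw [norm_mul, Real.norm_of_nonneg (hp.nonneg t ht x)]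
  exact mul_le_mul_of_nonneg_left (hF n x) (hp.nonneg t ht x)

end IsHeatKernel

/-- If the derivatives tend to zero boundedly on `[s, t]`, the limit takes the same value at both
ends. -/
theorem eq_of_tendsto_of_hasDerivAt {J J' : ℕ → ℝ → ℝ} {s t a b C : ℝ} (hst : s ≤ t)
    (hd : ∀ n, ∀ x ∈ Set.Icc s t, HasDerivAt (J n) (J' n x) x)
    (hC : ∀ n, ∀ x ∈ Set.Icc s t, |J' n x| ≤ C)
    (h0 : ∀ x ∈ Set.Icc s t, Tendsto (fun n => J' n x) atTop (𝓝 0))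
    (ha : Tendsto (fun n => J n s) atTop (𝓝 a)) (hb : Tendsto (fun n => J n t) atTop (𝓝 b)) :
    a = b := by
  have hIoc : ∀ x ∈ Set.uIoc s t, x ∈ Set.Icc s t := fun x hx => by
    rw [Set.uIoc_of_le hst] at hx
    exact Set.Ioc_subset_Icc_self hx
  have hm : ∀ n, AEStronglyMeasurable (J' n) (volume.restrict (Set.uIoc s t)) := fun n =>
    (measurable_deriv (J n)).aestronglyMeasurable.congr
      ((ae_restrict_iff' measurableSet_uIoc).2 (ae_of_all _ fun x hx => (hd n x (hIoc x hx)).deriv))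
  have hint : ∀ n, ∫ x in s..t, J' n x = J n t - J n s := fun n =>
    intervalIntegral.integral_eq_sub_of_hasDerivAt
      (fun x hx => hd n x (by rwa [Set.uIcc_of_le hst] at hx))
      ((intervalIntegrable_const (c := C)).mono_fun' (hm n)
        ((ae_restrict_iff' measurableSet_uIoc).2 (ae_of_all _ fun x hx => hC n x (hIoc x hx))))
  have h := intervalIntegral.tendsto_integral_filter_of_dominated_convergence (μ := volume)
    (F := J') (f := fun _ => 0) (l := atTop) (fun _ => C) (.of_forall hm)
    (.of_forall fun n => ae_of_all _ fun x hx => hC n x (hIoc x hx)) intervalIntegrable_const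
    (ae_of_all _ fun x hx => h0 x (hIoc x hx))
  simp only [hint, intervalIntegral.integral_zero] at h
  have := tendsto_nhds_unique h (hb.sub ha)
  linarith

namespace IsStableDensity
variable {α κ₀ κ₁ : ℝ} {κ : 𝓔 d → ℝ} {p : ℝ → 𝓔 d → ℝ}

theorem stableKernel_zero_pos {k : 𝓔 d → ℝ} (hk : IsStableDensity α κ₀ κ₁ k) (hα0 : 0 < α)
    (hα2 : α < 2) (hκ₀ : 0 < κ₀) {t : ℝ} (ht : 0 < t) : 0 < stableKernel k t 0 := by
  have hi := hk.integrable_pow_mul_exp hα0 hα2 hκ₀ ht 0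
  simp only [pow_zero, one_mul] at hi
  have h : stableKernel k t 0 = ∫ w, Real.exp (-(t * symbol k w)) := by
    have := ofReal_stableKernel k t (0 : 𝓔 d)
    rw [invFT] at this
    simp only [wave_zero, one_mul, integral_complex_ofReal] at this
    exact_mod_cast this
  rw [h]
  exact integral_exp_pos hi

/-- The plane waves are approximated by integrable functions, namely by their products with
dilates of the bump `stableKernel k 1`, with second differences under uniform control. -/
theorem exists_cosWave_approx {k : 𝓔 d → ℝ} (hk : IsStableDensity α κ₀ κ₁ k) (hα0 : 0 < α)
    (hα2 : α < 2) (hκ₀ : 0 < κ₀) (hκ₁ : 0 ≤ κ₁) (w : 𝓔 d) (θ : ℝ) :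
    ∃ (M c : ℝ) (F : ℕ → 𝓔 d → ℝ), 0 < c ∧ (∀ n, SecondDiffBound M (F n)) ∧
      (∀ n, Integrable (F n)) ∧
      ∀ x, Tendsto (fun n => F n x) atTop (𝓝 (c * cosWave w θ x)) := by
  have hsc := hk.continuous_symbol hα0 hα2
  obtain ⟨B, hB, hBl⟩ := secondDiffBound_re_invFT
    (m := fun w => (Real.exp (-(1 * symbol k w)) : ℂ)) (by fun_prop)
    (hk.integrable_pow_mul_norm_exp hα0 hα2 hκ₀ one_pos)
  obtain ⟨A, hA, hAl⟩ := secondDiffBound_cosWave w θ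
  have hr0 : ∀ n : ℕ, (0 : ℝ) < 1 / (n + 1) := fun n => by positivity
  have hr1 : ∀ n : ℕ, (1 : ℝ) / (n + 1) ≤ 1 := fun n =>
    (div_le_one (by positivity)).2 (by linarith [(Nat.cast_nonneg n : (0 : ℝ) ≤ n)])
  refine ⟨4 * (B * A), stableKernel k 1 0,
    fun n x => stableKernel k 1 ((1 / ((n : ℝ) + 1)) • x) * cosWave w θ x,
    hk.stableKernel_zero_pos hα0 hα2 hκ₀ one_pos, fun n => ?_, fun n => ?_, fun x => ?_⟩
  · refine (hB.comp_smul (hr0 n).le (hr1 n)).mul hA (fun x z => ?_) hAl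
    rw [smul_add]
    refine (hBl _ _).trans (mul_le_mul_of_nonneg_left ?_ hB.nonneg)
    rw [norm_smul, Real.norm_of_nonneg (hr0 n).le]
    exact mul_le_of_le_one_left (norm_nonneg _) (hr1 n)
  · exact ((hk.integrable_stableKernel hα0 hα2 hκ₀ hκ₁ one_pos).comp_smul (hr0 n).ne').mul_bdd
      hA.continuous.aestronglyMeasurable (ae_of_all _ hA.bound)
  · refine Tendsto.mul_const _ ?_
    have h1 : Tendsto (fun n : ℕ => (1 / ((n : ℝ) + 1)) • x) atTop (𝓝 0) := by
      simpa using (tendsto_one_div_add_atTop_nhds_zero_nat (𝕜 := ℝ)).smul_const x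
    exact ((hk.continuous_stableKernel hα0 hα2 hκ₀ one_pos).tendsto 0).comp h1

/-- Plane waves are eigenfunctions of the operator, so their integrals against any heat kernel
solve `I' = -ψ I`. As they are not integrable, the equation is tested against approximations, and
the derivative is passed to the limit in integrated form. -/
theorem integral_mul_cosWave (hk : IsStableDensity α κ₀ κ₁ fun z => κ z * jumpWeight α z)
    (hα0 : 0 < α) (hα2 : α < 2) (hκ₀ : 0 < κ₀) (hκ₁ : 0 ≤ κ₁) (hp : IsHeatKernel α κ p)
    (w : 𝓔 d) (θ : ℝ) {t : ℝ} (ht : 0 < t) :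
    ∫ x, p t x * cosWave w θ x =
      Real.exp (-(t * symbol (fun z => κ z * jumpWeight α z) w)) * Real.cos θ := by
  obtain ⟨M, c, F, hc, hF, hFi, hlim⟩ := hk.exists_cosWave_approx hα0 hα2 hκ₀ hκ₁ w θ
  have hj := hk.toIsJumpDensity
  have hΛ : 0 ≤ κ₁ * levyMass d α := mul_nonneg hκ₁ (levyMass_nonneg α)
  have hM := (hF 0).nonneg
  set ψ := symbol (fun z => κ z * jumpWeight α z) w with hψ
  have hψ0 : 0 ≤ ψ := hj.symbol_nonneg w
  have hcomm : ∀ s, ∫ x, p s x * (c * cosWave w θ x) = c * ∫ x, p s x * cosWave w θ x := fun s => by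
    rw [← integral_const_mul]
    congr 1; ext x; ring
  have hI : ∀ s, 0 < s → Tendsto (fun n => ∫ x, p s x * F n x) atTop
      (𝓝 (c * ∫ x, p s x * cosWave w θ x)) := fun s hs => by
    have := hp.tendsto_integral_mul hs (fun n => (hF n).bound)
      (fun n => (hF n).continuous.measurable) hlim
    rwa [hcomm] at this
  have hD : ∀ s, 0 < s → Tendsto (fun n => ∫ x, p s x * stableLikeOp α κ (F n) x) atTop
      (𝓝 (-ψ * (c * ∫ x, p s x * cosWave w θ x))) := fun s hs => by
    have := hp.tendsto_integral_mul hs (fun n => hj.abs_stableLikeOp_le hα0 hα2 (hF n))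
      (fun n => hj.measurable_stableLikeOp (hF n)) (hj.tendsto_stableLikeOp hα0 hα2 hF hlim)
    simp only [stableLikeOp_const_mul_cosWave, ← hψ] at this
    rw [← hcomm, ← integral_const_mul]
    simpa only [mul_left_comm (-ψ)] using this
  -- with the integrating factor `e^{ψ s}` the limit of the weak equations has derivative zero
  have hconst : ∀ s, 0 < s → s ≤ t →
      Real.exp (ψ * s) * (c * ∫ x, p s x * cosWave w θ x) =
        Real.exp (ψ * t) * (c * ∫ x, p t x * cosWave w θ x) := by
    intro s hs hst
    refine eq_of_tendsto_of_hasDerivAt (C := Real.exp (ψ * t) *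
        (ψ * M + 2 * M * (κ₁ * levyMass d α))) (J := fun n s => Real.exp (ψ * s) * ∫ x, p s x * F n x)
      (J' := fun n s => Real.exp (ψ * s) *
        (ψ * (∫ x, p s x * F n x) + ∫ x, p s x * stableLikeOp α κ (F n) x)) hst
      (fun n u hu => ?_) (fun n u hu => ?_) (fun u hu => ?_)
      ((hI s hs).const_mul _) ((hI t ht).const_mul _)
    · have h1 := ((hasDerivAt_id u).const_mul ψ).exp.mul
        (hp.hasDerivAt_integral_mul hj hα0 hα2 (hF n) (hFi n) (hs.trans_le hu.1))
      refine h1.congr_deriv ?_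
      simp only [id]; ring
    · have hu0 := hs.trans_le hu.1
      have h1 := hp.abs_integral_mul_le hu0 (hF n).bound
      have h2 := hp.abs_integral_mul_le hu0 (hj.abs_stableLikeOp_le hα0 hα2 (hF n))
      rw [abs_mul, abs_of_pos (Real.exp_pos _)]
      refine mul_le_mul (Real.exp_le_exp.2 (mul_le_mul_of_nonneg_left hu.2 hψ0))
        ((abs_add_le _ _).trans (add_le_add ?_ h2)) (abs_nonneg _) (Real.exp_pos _).le
      rw [abs_mul, abs_of_nonneg hψ0]
      exact mul_le_mul_of_nonneg_left h1 hψ0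
    · have hu0 := hs.trans_le hu.1
      have := (((hI u hu0).const_mul ψ).add (hD u hu0)).const_mul (Real.exp (ψ * u))
      rwa [neg_mul, add_neg_cancel, mul_zero] at this
  have hinit : Tendsto (fun s => ∫ x, p s x * cosWave w θ x) (𝓝[>] 0) (𝓝 (Real.cos θ)) := by
    have h := hp.initial (BoundedContinuousFunction.ofNormedAddCommGroup (cosWave w θ)
      (by unfold cosWave; fun_prop) 1 fun x => Real.abs_cos_le_one _)
    have h0 : cosWave w θ 0 = Real.cos θ := by simp [cosWave]
    rw [← h0]
    exact h
  have hexp : Tendsto (fun s => Real.exp (ψ * s)) (𝓝[>] 0) (𝓝 1) := by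
    have h : Continuous fun s => Real.exp (ψ * s) := by fun_prop
    simpa using (h.tendsto 0).mono_left nhdsWithin_le_nhds
  have h1 := hexp.mul (hinit.const_mul c)
  have h2 : Tendsto (fun s => Real.exp (ψ * s) * (c * ∫ x, p s x * cosWave w θ x)) (𝓝[>] 0)
      (𝓝 (Real.exp (ψ * t) * (c * ∫ x, p t x * cosWave w θ x))) := by
    refine tendsto_const_nhds.congr' ?_
    filter_upwards [Ioc_mem_nhdsGT ht] with s hs
    exact (hconst s hs.1 hs.2).symm
  have h3 := tendsto_nhds_unique h1 h2
  have h4 : Real.cos θ = Real.exp (ψ * t) * ∫ x, p t x * cosWave w θ x := by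
    apply mul_left_cancel₀ hc.ne'
    linarith
  rw [h4, ← mul_assoc, ← Real.exp_add, mul_comm t, neg_add_cancel, Real.exp_zero, one_mul]

/-- Uniqueness of the heat kernel. -/
theorem eq_stableKernel (hk : IsStableDensity α κ₀ κ₁ fun z => κ z * jumpWeight α z)
    (hα0 : 0 < α) (hα2 : α < 2) (hκ₀ : 0 < κ₀) (hκ₁ : 0 ≤ κ₁) (hp : IsHeatKernel α κ p)
    {t : ℝ} (ht : 0 < t) : p t = stableKernel (fun z => κ z * jumpWeight α z) t := by
  have hpi := hp.integrable t ht
  have hF : FourierTransform.fourier (fun x => (p t x : ℂ)) =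
      fun w => (Real.exp (-(t * symbol (fun z => κ z * jumpWeight α z) w)) : ℂ) := by
    ext w
    -- the phases `0` and `-π/2` give the real and the imaginary part of the Fourier integral
    have hc := hk.integral_mul_cosWave hα0 hα2 hκ₀ hκ₁ hp w 0 ht
    have hs := hk.integral_mul_cosWave hα0 hα2 hκ₀ hκ₁ hp w (-(Real.pi / 2)) ht
    simp only [cosWave, add_zero, Real.cos_zero, mul_one, Real.cos_neg, Real.cos_pi_div_two,
      mul_zero, ← sub_eq_add_neg, Real.cos_sub_pi_div_two] at hc hs
    have hint : Integrable fun x => Complex.exp (↑(-2 * Real.pi * inner ℝ x w) * Complex.I) •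
        (p t x : ℂ) := by
      refine hpi.ofReal.bdd_mul (c := 1) (Continuous.aestronglyMeasurable (by fun_prop))
        (ae_of_all _ fun x => (Complex.norm_exp_ofReal_mul_I _).le)
    rw [Real.fourier_eq']
    apply Complex.ext
    · rw [Complex.ofReal_re, ← hc, ← RCLike.re_eq_complex_re, ← integral_re hint]
      congr 1; ext x
      rw [RCLike.re_eq_complex_re, smul_eq_mul, Complex.re_mul_ofReal, Complex.exp_ofReal_mul_I_re,
        real_inner_comm, mul_comm, neg_mul, neg_mul, Real.cos_neg]
    · rw [Complex.ofReal_im, ← neg_eq_zero, ← hs, ← RCLike.im_eq_complex_im, ← integral_im hint,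
        ← integral_neg]
      congr 1; ext x
      rw [RCLike.im_eq_complex_im, smul_eq_mul, Complex.im_mul_ofReal, Complex.exp_ofReal_mul_I_im,
        real_inner_comm, mul_comm, neg_mul, neg_mul, Real.sin_neg, mul_neg, neg_neg]
  have hcont : Continuous fun x => (p t x : ℂ) :=
    Complex.continuous_ofReal.comp (hp.contDiff t ht).continuous
  have hinv := hcont.fourierInv_fourier_eq hpi.ofReal
    (by rw [hF]; exact hk.integrable_exp hα0 hα2 hκ₀ ht)
  rw [hF, ← invFT_eq_fourierInv] at hinv
  ext x
  have := congrFun hinv x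
  rw [← ofReal_stableKernel] at this
  exact_mod_cast this.symm

end IsStableDensity

end StableKernel

open StableKernel in
theorem theorem2p4 (d : ℕ) (hd : 1 ≤ d) (α : ℝ) (hα0 : 0 < α) (hα2 : α < 2)
    (κ₀ κ₁ : ℝ) (hκ₀ : 0 < κ₀) :
    ∃ C : ℝ, 0 < C ∧ ∀ κ : EuclideanSpace ℝ (Fin d) → ℝ, Measurable κ →
      (∀ z, κ z = κ (-z)) → (∀ z, κ₀ ≤ κ z ∧ κ z ≤ κ₁) →
      (∃ p : ℝ → EuclideanSpace ℝ (Fin d) → ℝ, IsHeatKernel α κ p) ∧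
      ∀ p : ℝ → EuclideanSpace ℝ (Fin d) → ℝ, IsHeatKernel α κ p →
        ∀ t : ℝ, 0 < t → t ≤ 1 →
          (∀ x : EuclideanSpace ℝ (Fin d),
            Integrable (fun z => |secondDiff (p t) x z| * ‖z‖ ^ (-(d : ℝ) - α)) ∧
            ∫ z, |secondDiff (p t) x z| * ‖z‖ ^ (-(d : ℝ) - α) ≤ C * varrho α 0 0 t x) ∧
          (∀ x x' : EuclideanSpace ℝ (Fin d),
            Integrable (fun z => |secondDiff (p t) x z - secondDiff (p t) x' z| *
              ‖z‖ ^ (-(d : ℝ) - α)) ∧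
            ∫ z, |secondDiff (p t) x z - secondDiff (p t) x' z| * ‖z‖ ^ (-(d : ℝ) - α) ≤
              C * min (t ^ (-1 / α) * ‖x - x'‖) 1 *
                (varrho α 0 0 t x + varrho α 0 0 t x')) := by
  rcases lt_or_ge κ₁ 0 with hκ₁ | hκ₁
  · exact ⟨1, one_pos, fun κ _ _ hb => absurd ((hb 0).1.trans (hb 0).2) (by linarith)⟩
  obtain ⟨C, hC, h⟩ := exists_secondDiff_stableKernel_le d hα0 hα2 hκ₀ hκ₁
  refine ⟨C, hC, fun κ hκm hκe hκb => ?_⟩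
  have hk : IsStableDensity α κ₀ κ₁ fun z => κ z * jumpWeight α z :=
    { measurable := hκm.mul (measurable_jumpWeight α)
      even := fun z => by rw [jumpWeight_neg, ← hκe]
      nonneg := fun z => mul_nonneg (hκ₀.le.trans (hκb z).1) (jumpWeight_nonneg α z)
      le := fun z => mul_le_mul_of_nonneg_right (hκb z).2 (jumpWeight_nonneg α z)
      low := fun z => mul_le_mul_of_nonneg_right (hκb z).1 (jumpWeight_nonneg α z) }
  refine ⟨⟨_, hk.isHeatKernel_stableKernel hα0 hα2 hκ₀ hκ₁⟩, fun p hp t ht _ => ?_⟩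
  rw [hk.eq_stableKernel hα0 hα2 hκ₀ hκ₁ hp ht]
  exact h _ hk t ht

end
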